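/- Let $h(t)=\log\prod_{j,k\ge 1}\bigl(1-e^{-jk(j+k)t/2}\bigr)^{-1}$ for $t>0$, and let $\omega(s)$ denote the meromorphic continuation to $\mathbb{C}$ of the Dirichlet series $\sum_{j,k\ge 1}(jk(j+k))^{-s}$, which converges for $\operatorname{Re}(s)>2/3$; this continuation exists and is holomorphic at $s=0$, with $\omega'(0)$ real. The product defining $h$ converges for every $t>0$, and $h$ is twice continuously differentiable on $(0,\infty)$. Put $$\mu_1=\frac{2^{2/3}}{3}\,\Gamma\left(\tfrac13\right)^2\zeta\left(\tfrac53\right),\qquad \mu_2=\sqrt{2\pi}\,\zeta\left(\tfrac12\right)\zeta\left(\tfrac32\right).$$ Then, as $t\searrow 0$, $$h(t)=\mu_1t^{-2/3}+\mu_2t^{-1/2}-\tfrac13\log t+\omega'(0)+\tfrac13\log 2+O(t^{1/2}),$$ $$h'(t)=-\tfrac23\mu_1t^{-5/3}-\tfrac12\mu_2t^{-3/2}-\tfrac13t^{-1}+O(t^{-1/2}),$$ $$h''(t)=\tfrac{10}{9}\mu_1t^{-8/3}+\tfrac34\mu_2t^{-5/2}+\tfrac13t^{-2}+O(t^{-3/2}).$$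 -/

import Mathlib

open Set Filter Topology Asymptotics

noncomputable section

namespace SU3

/-- The integer `j k (j + k)` attached to a pair `(j, k)` of positive integers. -/
def weight (p : ℕ+ × ℕ+) : ℕ := (p.1 : ℕ) * p.2 * (p.1 + p.2)

/-- The factor `(1 - exp (-j k (j + k) t / 2))⁻¹` of the generating function. -/
def factor (t : ℝ) (p : ℕ+ × ℕ+) : ℝ := (1 - Real.exp (-(weight p : ℝ) * t / 2))⁻¹

/-- `h(t) = log ∏_{j,k ≥ 1} (1 - exp (-j k (j + k) t / 2))⁻¹`, for `t > 0`. -/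
def h (t : ℝ) : ℝ := Real.log (∏' p : ℕ+ × ℕ+, factor t p)

/-- `W` is the meromorphic continuation to `ℂ` of the Dirichlet series
`∑_{j,k ≥ 1} (j k (j + k))^(-s)`, which converges for `Re s > 2/3`. The function is in normal form:
it is analytic wherever it has no pole, and takes the value `0` at its poles. -/
structure IsContinuation (W : ℂ → ℂ) : Prop where
  meromorphic : MeromorphicNFOn W univ
  hasSum : ∀ s : ℂ, 2 / 3 < s.re → HasSum (fun p : ℕ+ × ℕ+ => (weight p : ℂ) ^ (-s)) (W s)

/-- The meromorphic continuation is unique. -/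
theorem IsContinuation.unique {W₁ W₂ : ℂ → ℂ} (h₁ : IsContinuation W₁) (h₂ : IsContinuation W₂) :
    W₁ = W₂ := by
  have hm : MeromorphicOn (W₁ - W₂) univ := fun x hx =>
    (h₁.meromorphic hx).meromorphicAt.sub (h₂.meromorphic hx).meromorphicAt
  have h1 : meromorphicOrderAt (W₁ - W₂) 1 = ⊤ := by
    rw [meromorphicOrderAt_eq_top_iff]
    have ho : IsOpen {s : ℂ | 2 / 3 < s.re} := isOpen_lt continuous_const Complex.continuous_re
    have hmem : {s : ℂ | 2 / 3 < s.re} ∈ 𝓝 (1 : ℂ) := ho.mem_nhds (by simp; norm_num)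
    filter_upwards [mem_nhdsWithin_of_mem_nhds hmem] with s hs
    simp [(h₁.hasSum s hs).unique (h₂.hasSum s hs)]
  funext x
  have hx : meromorphicOrderAt (W₁ - W₂) x = ⊤ := by
    by_contra hne
    exact hm.meromorphicOrderAt_ne_top_of_isPreconnected isPreconnected_univ (mem_univ x)
      (mem_univ 1) hne h1
  rw [meromorphicOrderAt_eq_top_iff] at hx
  have he : W₁ =ᶠ[𝓝[≠] x] W₂ := hx.mono fun s hs => sub_eq_zero.mp hs
  exact (((h₁.meromorphic (mem_univ x)).eventuallyEq_nhdsNE_iff_eventuallyEq_nhds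
    (h₂.meromorphic (mem_univ x))).mp he).eq_of_nhds

/-- The zeta function `ω` of `SU(3)`: the meromorphic continuation of its Dirichlet series. (Its
existence is asserted in the theorem below, its uniqueness is `IsContinuation.unique`.) -/
def omega : ℂ → ℂ := Classical.epsilon IsContinuation

end SU3

end

namespace SU3

open MeasureTheory

/-! ### Meromorphic functions on half-planes -/

/-! Expanding the logarithm of the product gives h(t) = ∑_n heat(n t / 2) / n with heat(z) = ∑
exp(-j k (j + k) z) (`hasSum_h`), so everything rests on the heat trace near 0. In a sector about
the positive axis it is A z^(-2/3) + B z^(-1/2) + 1/3 + O(|z|^(1/2)) (`exists_heat_expansion`).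
Summed against 1/n, the two powers produce ζ(5/3) and ζ(3/2), hence μ₁ and μ₂. The constant 1/3
cannot be summed against 1/n and is replaced by e^(-z)/3, whose sum is -(1/3) log(1 - e^(-t/2));
this is the source of -(1/3) log t + (1/3) log 2.

What is left, `heatRem`, is O(|z|^(1/2)) at 0 and O(|z|^(-1/2)) at infinity. The sum `remSum` of
heatRem(n z)/n is a Riemann sum for ∫ heatRem(u z) du/u, with error O(|z|^(1/2)). That integral is
holomorphic in z and invariant under real dilations, hence constant, equal to the Mellin transform M
of `heatRem` at 0 (`integral_radial_eq`). For 2/3 < Re s < 1 the Mellin transform of heat(x) -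
e^(-x)/3 is Γ(s)(ω(s) - 1/3); subtracting the two powers continues it past 0, so ω(s) = 1/3 + s
M(s)/Γ(s + 1) near 0 and ω'(0) = M(0) (`hasDerivAt_omega_zero`). As the error bound for `remSum`
holds on complex discs, Cauchy's estimates yield the expansions of h' and h'' (`exists_remSum_le`).

For the heat trace, symmetry reduces the sum to k ≥ j, and Euler-Maclaurin summation in k leaves
integrals plus a boundary term whose sum over j tends to 1/12 (`exists_heat_sub_le`). The
substitutions u = j v and y = v(1 + v) collapse the integrals to ∫_{y > 2} (1 + 4y)^(-1/2) C(y z)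
dy, where C(ξ) = ∑ j exp(-j³ ξ) = Γ(2/3)/3 ξ^(-2/3) - 1/12 + O(|ξ|^(3/5)). The power ξ^(-2/3) gives
A through a Beta integral. For the rest of C the kernel is compared with (4y)^(-1/2) on all of (0,
∞): the comparison kernel gives B as a Mellin transform at 1/2, and the difference of kernels, of
integral -3/2, gives the missing 1/4 of the constant.

The continuation of ω starts from the trapezoidal rule in k. Each integral over unit intervals is
split into the mean of its weight, which contributes ζ times a one-variable integral with its own
recursion, and a fluctuation, where integration by parts gains a power of decay (`kerTerm_step`,
`continuesTo_kerSum`). -/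

lemma isOpen_halfPlane (c : ℝ) : IsOpen {s : ℂ | c < s.re} :=
  isOpen_lt continuous_const Complex.continuous_re

lemma isPreconnected_halfPlane (c : ℝ) : IsPreconnected {s : ℂ | c < s.re} :=
  (convex_halfSpace_re_gt c).isPreconnected

/-- Identity theorem: two meromorphic functions on a preconnected set that agree near one point
agree near every point where both are in normal form. -/
lemma eventuallyEq_of_meromorphicOn {f g : ℂ → ℂ} {U : Set ℂ} (hf : MeromorphicOn f U)
    (hg : MeromorphicOn g U) (hU : IsPreconnected U) {p x : ℂ} (hp : p ∈ U) (hx : x ∈ U)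
    (hfg : f =ᶠ[𝓝[≠] p] g) (hfx : MeromorphicNFAt f x) (hgx : MeromorphicNFAt g x) :
    f =ᶠ[𝓝 x] g := by
  have hm : MeromorphicOn (f - g) U := hf.sub hg
  have h1 : meromorphicOrderAt (f - g) p = ⊤ := by
    rw [meromorphicOrderAt_eq_top_iff]
    filter_upwards [hfg] with s hs
    simp [hs]
  have h2 : meromorphicOrderAt (f - g) x = ⊤ := by
    by_contra hne
    exact hm.meromorphicOrderAt_ne_top_of_isPreconnected hU hx hp hne h1
  rw [meromorphicOrderAt_eq_top_iff] at h2
  exact (hfx.eventuallyEq_nhdsNE_iff_eventuallyEq_nhds hgx).mp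
    (h2.mono fun s hs => sub_eq_zero.mp hs)

/-- Continuations to larger and larger half-planes glue to one function in normal form. -/
lemma exists_meromorphicNFOn_univ {D : ℂ → ℂ} {c : ℝ} (hD : DifferentiableOn ℂ D {s | c < s.re})
    (H : ∀ N : ℝ, ∃ g : ℂ → ℂ, MeromorphicOn g {s | N < s.re} ∧
      ∀ s : ℂ, 2 < s.re → g s = D s) :
    ∃ W : ℂ → ℂ, MeromorphicNFOn W univ ∧ ∀ s : ℂ, c < s.re → W s = D s := by
  -- Normal form makes the value at a point depend only on the function near that point, so that
  -- different continuations can be compared pointwise, poles included.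
  have H' : ∀ n : ℕ, ∃ g : ℂ → ℂ, MeromorphicNFOn g {s | -(n : ℝ) < s.re} ∧
      ∀ s : ℂ, max 2 c < s.re → g =ᶠ[𝓝[≠] s] D := by
    intro n
    obtain ⟨g, hg, hgD⟩ := H (-(n : ℝ))
    refine ⟨toMeromorphicNFOn g {s | -(n : ℝ) < s.re}, meromorphicNFOn_toMeromorphicNFOn _ _,
      fun s hs => ?_⟩
    have hs2 : (2 : ℝ) < s.re := (le_max_left _ _).trans_lt hs
    have hsn : -(n : ℝ) < s.re := by
      have : (0 : ℝ) ≤ n := Nat.cast_nonneg n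
      linarith
    refine (hg.toMeromorphicNFOn_eq_self_on_nhdsNE (show s ∈ {s : ℂ | -(n : ℝ) < s.re} from hsn)).trans (?_ : g =ᶠ[𝓝[≠] s] D)
    filter_upwards [mem_nhdsWithin_of_mem_nhds ((isOpen_halfPlane 2).mem_nhds hs2)] with t ht
    exact hgD t ht
  choose G hG hGD using H'
  set p : ℂ := ((max 2 c + 1 : ℝ) : ℂ) with hp
  have hpre : max 2 c < p.re := by simp [hp]
  have hpn : ∀ n : ℕ, -(n : ℝ) < p.re := fun n => by
    have : (0 : ℝ) ≤ n := Nat.cast_nonneg n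
    have := le_max_left 2 c
    linarith
  -- Both functions agree with `D` near `p`, which lies to the right of every half-plane in play;
  -- the identity theorem carries this to all common points.
  have hGG : ∀ m n : ℕ, ∀ s : ℂ, -(m : ℝ) < s.re → -(n : ℝ) < s.re → G m s = G n s := by
    intro m n s hm hn
    set k := min m n
    have hk : -(k : ℝ) < s.re := by
      rcases min_choice m n with h | h <;> simp only [k, h] <;> assumption
    have hkm : {s : ℂ | -(k : ℝ) < s.re} ⊆ {s : ℂ | -(m : ℝ) < s.re} := fun t ht => by
      have : (k : ℝ) ≤ m := by exact_mod_cast min_le_left m n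
      simp only [mem_ofPred_eq] at ht ⊢
      linarith
    have hkn : {s : ℂ | -(k : ℝ) < s.re} ⊆ {s : ℂ | -(n : ℝ) < s.re} := fun t ht => by
      have : (k : ℝ) ≤ n := by exact_mod_cast min_le_right m n
      simp only [mem_ofPred_eq] at ht ⊢
      linarith
    exact (eventuallyEq_of_meromorphicOn (fun z hz => (hG m (hkm hz)).meromorphicAt)
      (fun z hz => (hG n (hkn hz)).meromorphicAt) (isPreconnected_halfPlane _) (hpn k) hk
      ((hGD m p hpre).trans (hGD n p hpre).symm) (hG m hm) (hG n hn)).eq_of_nhds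
  have hceil : ∀ s : ℂ, -((⌈|s.re|⌉₊ + 1 : ℕ) : ℝ) < s.re := fun s => by
    have h1 := Nat.le_ceil |s.re|
    have h2 := neg_abs_le s.re
    push_cast
    linarith
  -- The index is just some half-plane containing `s`. It jumps as `s` moves, but by `hGG` the
  -- choice is immaterial, so `W` is locally one of the `G n`.
  set W : ℂ → ℂ := fun s => G (⌈|s.re|⌉₊ + 1) s with hW
  have hWG : ∀ n : ℕ, ∀ s : ℂ, -(n : ℝ) < s.re → W s = G n s := fun n s hs =>
    hGG _ _ s (hceil s) hs
  have hWn : ∀ s : ℂ, W =ᶠ[𝓝 s] G (⌈|s.re|⌉₊ + 1) := fun s => by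
    filter_upwards [(isOpen_halfPlane _).mem_nhds (hceil s)] with t ht
    exact hWG _ t ht
  have hNF : MeromorphicNFOn W univ := fun s _ =>
    (meromorphicNFAt_congr (hWn s)).mpr (hG _ (hceil s))
  refine ⟨W, hNF, fun s hs => ?_⟩
  have hDan : ∀ z : ℂ, c < z.re → AnalyticAt ℂ D z := fun z hz =>
    hD.analyticAt ((isOpen_halfPlane c).mem_nhds hz)
  refine (eventuallyEq_of_meromorphicOn (U := {s | c < s.re}) (p := p)
    (fun z _ => (hNF (mem_univ z)).meromorphicAt)
    (fun z hz => (hDan z hz).meromorphicAt) (isPreconnected_halfPlane _)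
    (show c < p.re from (le_max_right 2 c).trans_lt hpre) hs ?_ (hNF (mem_univ s))
    (hDan s hs).meromorphicNFAt).eq_of_nhds
  exact (Filter.EventuallyEq.filter_mono (hWn p) nhdsWithin_le_nhds).trans (hGD _ p hpre)

/-! ### Symmetric sums over pairs -/

/-- The two halves `j ≤ k` and `k < j` of the set of pairs of positive integers. -/
noncomputable def pairEquiv : (ℕ × ℕ) ⊕ (ℕ × ℕ) ≃ ℕ+ × ℕ+ :=
  Equiv.ofBijective
    (Sum.elim (fun p => (p.1.succPNat, (p.1 + p.2).succPNat))
      (fun p => ((p.1 + (p.2 + 1)).succPNat, p.1.succPNat))) <| by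
    constructor
    · rintro (⟨a, b⟩ | ⟨a, b⟩) (⟨c, d⟩ | ⟨c, d⟩) h <;>
        simp only [Sum.elim_inl, Sum.elim_inr, Prod.mk.injEq, ← PNat.coe_inj,
          Nat.succPNat_coe, Sum.inl.injEq, Sum.inr.injEq, reduceCtorEq] at h ⊢ <;> omega
    · rintro ⟨⟨j, hj⟩, ⟨k, hk⟩⟩
      rcases le_or_gt j k with h | h
      · refine ⟨Sum.inl (j - 1, k - j), Prod.ext (PNat.eq ?_) (PNat.eq ?_)⟩
        · show j - 1 + 1 = j
          omega
        · show j - 1 + (k - j) + 1 = k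
          omega
      · refine ⟨Sum.inr (k - 1, j - k - 1), Prod.ext (PNat.eq ?_) (PNat.eq ?_)⟩
        · show k - 1 + (j - k - 1 + 1) + 1 = j
          omega
        · show k - 1 + 1 = k
          omega

/-- Folding k < j onto j < k leaves the diagonal counted once. For each j this yields the two end
values of every unit interval [j + l, j + l + 1], which is the form the trapezoidal rule needs. -/
lemma hasSum_of_symm {f : ℕ → ℕ → ℂ} (hf : ∀ j k, f j k = f k j) {a : ℂ}
    (h : HasSum (fun p : ℕ+ × ℕ+ => f p.1 p.2) a) :
    HasSum (fun p : ℕ × ℕ => f (p.1 + 1) (p.1 + 1 + p.2) + f (p.1 + 1) (p.1 + 1 + (p.2 + 1))) a := by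
  have h' := (pairEquiv.hasSum_iff.mpr h)
  have h1 := (h'.summable.comp_injective Sum.inl_injective).hasSum
  have h2 := (h'.summable.comp_injective Sum.inr_injective).hasSum
  have h4 := HasSum.sum h1 h2
  rw [h'.unique h4]
  have e : ∀ p : ℕ × ℕ, f (p.1 + 1) (p.1 + 1 + p.2) + f (p.1 + 1) (p.1 + 1 + (p.2 + 1)) =
      f (p.1 + 1) (p.1 + p.2 + 1) + f (p.1 + (p.2 + 1) + 1) (p.1 + 1) := fun p => by
    rw [hf (p.1 + (p.2 + 1) + 1), add_right_comm p.1 p.2 1, add_right_comm p.1 (p.2 + 1) 1]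
  simp_rw [e]
  exact h1.add h2

/-! ### Summability of power bounds -/

lemma summable_succ_rpow {c : ℝ} (hc : 1 < c) : Summable fun n : ℕ => ((n : ℝ) + 1) ^ (-c) := by
  have := (summable_nat_add_iff 1).mpr (Real.summable_nat_rpow.mpr (neg_lt_neg hc))
  exact_mod_cast this

/-- The family `j^(-a) (j + l)^(-b)` is summable as soon as `b > 1` and `a + b > 2`, with room to
spare in the form needed. -/
lemma summable_pair_rpow {a b c : ℝ} (hc : 1 < c) (hbc : c ≤ b) (habc : 1 < a + b - c) :
    Summable fun p : ℕ × ℕ =>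
      ((p.1 : ℝ) + 1) ^ (-a) * ((p.1 : ℝ) + 1 + p.2) ^ (-b) := by
  refine Summable.of_nonneg_of_le (fun p => by positivity) (fun p => ?_)
    ((summable_succ_rpow habc).mul_of_nonneg (summable_succ_rpow hc) (fun n => by positivity)
      (fun n => by positivity))
  have h1 : (0 : ℝ) < (p.1 : ℝ) + 1 := by positivity
  have h2 : (0 : ℝ) < (p.2 : ℝ) + 1 := by positivity
  have h3 : (p.1 : ℝ) + 1 ≤ (p.1 : ℝ) + 1 + p.2 := by linarith [Nat.cast_nonneg (α := ℝ) p.2]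
  have h4 : (p.2 : ℝ) + 1 ≤ (p.1 : ℝ) + 1 + p.2 := by linarith [Nat.cast_nonneg (α := ℝ) p.1]
  -- Since j + l dominates both j and l + 1, the exponent `b` is shared: `c` is spent on the
  -- summation over l and `b - c` helps the summation over j.
  have e1 : ((p.1 : ℝ) + 1 + p.2) ^ (-b) =
      ((p.1 : ℝ) + 1 + p.2) ^ (-(b - c)) * ((p.1 : ℝ) + 1 + p.2) ^ (-c) := by
    rw [← Real.rpow_add (by linarith)]
    ring_nf
  have e2 : ((p.1 : ℝ) + 1) ^ (-(a + b - c)) =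
      ((p.1 : ℝ) + 1) ^ (-a) * ((p.1 : ℝ) + 1) ^ (-(b - c)) := by
    rw [← Real.rpow_add h1]
    ring_nf
  rw [e1, e2, mul_assoc]
  have i1 := Real.rpow_le_rpow_of_nonpos h1 h3 (z := -(b - c)) (by linarith)
  have i2 := Real.rpow_le_rpow_of_nonpos h2 h4 (z := -c) (by linarith)
  gcongr

/-! ### Unit intervals -/

lemma hasSum_integral_unit {E : Type*} [NormedAddCommGroup E] [NormedSpace ℝ E]
    {g : ℝ → E} {a : ℝ} (hg : IntegrableOn g (Ioi a)) :
    HasSum (fun l : ℕ => ∫ r in (0 : ℝ)..1, g (a + l + r)) (∫ u in Ioi a, g u) := by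
  have hU : (⋃ l : ℕ, Ioc (a + l) (a + l + 1)) = Ioi a := by
    have := iUnion_Ioc_add_intCast a
    ext x
    simp only [mem_iUnion, mem_Ioc, mem_Ioi]
    constructor
    · rintro ⟨l, h1, -⟩
      have := Nat.cast_nonneg (α := ℝ) l
      linarith
    · intro hx
      have h0 : 0 < x - a := by linarith
      have h1 := Nat.ceil_lt_add_one h0.le
      have h2 := Nat.le_ceil (x - a)
      have h3 : 0 < ⌈x - a⌉₊ := Nat.ceil_pos.mpr h0
      obtain ⟨m, hm⟩ := Nat.exists_eq_add_of_lt h3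
      rw [hm] at h1 h2
      push_cast at h1 h2
      exact ⟨m, by linarith, by linarith⟩
  have hd : Pairwise (Function.onFun Disjoint fun l : ℕ => Ioc (a + l) (a + l + 1)) := by
    intro l m hlm
    have := pairwise_disjoint_Ioc_add_intCast a (i := l) (j := m) (by exact_mod_cast hlm)
    simpa [Function.onFun] using this
  have := hasSum_integral_iUnion (fun l : ℕ => measurableSet_Ioc) hd (by rw [hU]; exact hg)
  rw [hU] at this
  convert this using 2 with l
  rw [intervalIntegral.integral_comp_add_left (fun u => g u), add_zero,
    intervalIntegral.integral_of_le (by linarith)]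

/-- Integration by parts against an antiderivative that vanishes at both ends. -/
lemma integral_mul_deriv_eq_neg {P p : ℝ → ℝ} {g g' : ℝ → ℂ}
    (hP : ∀ r ∈ Icc (0 : ℝ) 1, HasDerivAt P (p r) r) (hp : Continuous p)
    (hg : ∀ r ∈ Icc (0 : ℝ) 1, HasDerivAt g (g' r) r) (hg' : ContinuousOn g' (Icc 0 1)) :
    ∫ r in (0 : ℝ)..1, (p r : ℂ) * g r =
      P 1 * g 1 - P 0 * g 0 - ∫ r in (0 : ℝ)..1, (P r : ℂ) * g' r := by
  have hI : uIcc (0 : ℝ) 1 = Icc 0 1 := uIcc_of_le zero_le_one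
  have := intervalIntegral.integral_deriv_mul_eq_sub (a := 0) (b := 1)
    (u := fun r => (P r : ℂ)) (v := g) (u' := fun r => (p r : ℂ)) (v' := g')
    (fun r hr => (hP r (hI ▸ hr)).ofReal_comp) (fun r hr => hg r (hI ▸ hr))
    (Continuous.intervalIntegrable (by fun_prop) _ _)
    (ContinuousOn.intervalIntegrable (by rwa [hI]))
  rw [← this, ← intervalIntegral.integral_sub]
  · refine intervalIntegral.integral_congr fun r _ => ?_
    simp
  · have h1 : ContinuousOn (fun r => (P r : ℂ)) (Icc 0 1) := fun r hr =>
      ((hP r hr).ofReal_comp.continuousAt).continuousWithinAt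
    have h2 : ContinuousOn g (Icc 0 1) := fun r hr => (hg r hr).continuousAt.continuousWithinAt
    exact ContinuousOn.intervalIntegrable (by
      rw [hI]
      exact ((by fun_prop : Continuous fun r => (p r : ℂ)).continuousOn.mul h2).add (h1.mul hg'))
  · have h1 : ContinuousOn (fun r => (P r : ℂ)) (Icc 0 1) := fun r hr =>
      ((hP r hr).ofReal_comp.continuousAt).continuousWithinAt
    exact ContinuousOn.intervalIntegrable (by
      rw [hI]
      exact h1.mul hg')

/-- The trapezoidal rule with its error in terms of the first derivative. -/
lemma trapezoid_one {g g' : ℝ → ℂ} (hg : ∀ r ∈ Icc (0 : ℝ) 1, HasDerivAt g (g' r) r)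
    (hg' : ContinuousOn g' (Icc 0 1)) :
    g 0 + g 1 = 2 * (∫ r in (0 : ℝ)..1, g r) + ∫ r in (0 : ℝ)..1, ((2 * r - 1 : ℝ) : ℂ) * g' r := by
  have := integral_mul_deriv_eq_neg (P := fun r => 2 * r - 1) (p := fun _ => 2)
    (fun r _ => by simpa using ((hasDerivAt_id r).const_mul 2).sub_const 1) (by fun_prop) hg hg'
  rw [intervalIntegral.integral_const_mul] at this
  push_cast at this ⊢
  linear_combination -this

/-- The corrected trapezoidal rule with its error in terms of the fourth derivative. -/
lemma trapezoid_four {g g1 g2 g3 g4 : ℝ → ℂ} (hg : ∀ r ∈ Icc (0 : ℝ) 1, HasDerivAt g (g1 r) r)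
    (hg1 : ∀ r ∈ Icc (0 : ℝ) 1, HasDerivAt g1 (g2 r) r)
    (hg2 : ∀ r ∈ Icc (0 : ℝ) 1, HasDerivAt g2 (g3 r) r)
    (hg3 : ∀ r ∈ Icc (0 : ℝ) 1, HasDerivAt g3 (g4 r) r) (hg4 : ContinuousOn g4 (Icc 0 1))
    {M : ℝ} (hM : ∀ r ∈ Icc (0 : ℝ) 1, ‖g4 r‖ ≤ M) :
    ‖g 0 + g 1 - 2 * (∫ r in (0 : ℝ)..1, g r) - (g1 1 - g1 0) / 6‖ ≤ M := by
  have h1 : ContinuousOn g1 (Icc 0 1) := fun r hr => (hg1 r hr).continuousAt.continuousWithinAt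
  have h2 : ContinuousOn g2 (Icc 0 1) := fun r hr => (hg2 r hr).continuousAt.continuousWithinAt
  have h3 : ContinuousOn g3 (Icc 0 1) := fun r hr => (hg3 r hr).continuousAt.continuousWithinAt
  have e1 := trapezoid_one hg h1
  -- The constants of integration are those of Bernoulli polynomials. The end values 1/6 here give
  -- the correction in `g1`; the integral of r² - r + 1/6 is 0, so the next antiderivative vanishes
  -- at both ends, and so does the last one, r²(1 - r)²/12. No boundary terms in `g2` or `g3`
  -- survive.
  have e2 := integral_mul_deriv_eq_neg (P := fun r => r ^ 2 - r + 1 / 6) (p := fun r => 2 * r - 1)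
    (fun r _ => by exact ((((hasDerivAt_id r).pow 2).sub (hasDerivAt_id r)).add_const (1 / 6)).congr_deriv (by simp))
    (by fun_prop) hg1 h2
  have e3 := integral_mul_deriv_eq_neg (P := fun r => r ^ 3 / 3 - r ^ 2 / 2 + r / 6)
    (p := fun r => r ^ 2 - r + 1 / 6)
    (fun r _ => by
      refine (((((hasDerivAt_id r).pow 3).div_const 3).sub
        (((hasDerivAt_id r).pow 2).div_const 2)).add ((hasDerivAt_id r).div_const 6)).congr_deriv ?_
      simp)
    (by fun_prop) hg2 h3
  have e4 := integral_mul_deriv_eq_neg (P := fun r => r ^ 4 / 12 - r ^ 3 / 6 + r ^ 2 / 12)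
    (p := fun r => r ^ 3 / 3 - r ^ 2 / 2 + r / 6)
    (fun r _ => by
      refine (((((hasDerivAt_id r).pow 4).div_const 12).sub
        (((hasDerivAt_id r).pow 3).div_const 6)).add
        (((hasDerivAt_id r).pow 2).div_const 12)).congr_deriv ?_
      simp
      ring)
    (by fun_prop) hg3 hg4
  have := intervalIntegral.norm_integral_le_of_norm_le_const (a := 0) (b := 1) (C := M)
    (f := fun r : ℝ => ((r ^ 4 / 12 - r ^ 3 / 6 + r ^ 2 / 12 : ℝ) : ℂ) * g4 r) fun r hr => by
      rw [uIoc_of_le zero_le_one] at hr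
      rw [norm_mul, Complex.norm_real, Real.norm_eq_abs]
      have h0 : r ^ 4 / 12 - r ^ 3 / 6 + r ^ 2 / 12 = (r * (1 - r)) ^ 2 / 12 := by ring
      have h00 : 0 ≤ r * (1 - r) := mul_nonneg hr.1.le (by linarith [hr.2])
      have h01 : r * (1 - r) ≤ 1 := by nlinarith [hr.1, hr.2]
      have h3 : |r ^ 4 / 12 - r ^ 3 / 6 + r ^ 2 / 12| ≤ 1 := by
        rw [h0, abs_of_nonneg (by positivity)]
        nlinarith
      have h4 := hM r ⟨hr.1.le, hr.2⟩
      nlinarith [norm_nonneg (g4 r), abs_nonneg (r ^ 4 / 12 - r ^ 3 / 6 + r ^ 2 / 12)]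
  rw [sub_zero, abs_one, mul_one] at this
  refine le_trans (le_of_eq ?_) this
  rw [e1, e2, e3, e4]
  push_cast
  rw [← norm_neg]
  congr 1
  ring

/-- An integral of exponentials is an entire function of the parameter. -/
lemma differentiable_integral_exp {ρ : ℝ → ℂ} {L : ℝ → ℝ} (hρ : ContinuousOn ρ (Icc 0 1))
    (hL : ContinuousOn L (Icc 0 1)) :
    Differentiable ℂ fun s : ℂ => ∫ r in (0 : ℝ)..1, ρ r * Complex.exp (-s * L r) := by
  intro s₀
  obtain ⟨K, hK⟩ := isCompact_Icc.exists_bound_of_continuousOn hρ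
  obtain ⟨K', hK'⟩ := isCompact_Icc.exists_bound_of_continuousOn hL
  have hsub : uIoc (0 : ℝ) 1 ⊆ Icc 0 1 := by
    rw [uIoc_of_le zero_le_one]
    exact Ioc_subset_Icc_self
  have hLc : ContinuousOn (fun r => (L r : ℂ)) (Icc 0 1) :=
    Complex.continuous_ofReal.comp_continuousOn hL
  have hF : ∀ s : ℂ, ContinuousOn (fun r => ρ r * Complex.exp (-s * L r)) (Icc 0 1) := fun s =>
    hρ.mul (Complex.continuous_exp.comp_continuousOn (continuousOn_const.mul hLc))
  have := intervalIntegral.hasDerivAt_integral_of_dominated_loc_of_deriv_le (μ := volume)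
    (F := fun s r => ρ r * Complex.exp (-s * L r))
    (F' := fun s r => ρ r * (Complex.exp (-s * L r) * (-L r))) (x₀ := s₀) (a := 0) (b := 1)
    (s := Metric.ball s₀ 1) (bound := fun _ => K * (Real.exp ((‖s₀‖ + 1) * K') * K'))
    (Metric.ball_mem_nhds _ one_pos)
    (Eventually.of_forall fun s =>
      ((hF s).mono hsub).aestronglyMeasurable measurableSet_uIoc)
    (ContinuousOn.intervalIntegrable (by rw [uIcc_of_le zero_le_one]; exact hF s₀))
    (((hρ.mul ((Complex.continuous_exp.comp_continuousOn
      (continuousOn_const.mul hLc)).mul hLc.neg)).mono hsub).aestronglyMeasurable measurableSet_uIoc)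
    (ae_of_all _ fun r hr s hs => ?_) (by simp)
    (ae_of_all _ fun r hr s hs => ?_)
  · exact this.2.differentiableAt
  · have h1 := hK r (hsub hr)
    have h2 := hK' r (hsub hr)
    have h3 : ‖s‖ ≤ ‖s₀‖ + 1 := by
      have := norm_le_norm_add_norm_sub' s s₀
      have h4 : ‖s - s₀‖ < 1 := by simpa [dist_eq_norm] using hs
      linarith
    rw [norm_mul, norm_mul, norm_neg, Complex.norm_real]
    have h5 : ‖Complex.exp (-s * L r)‖ ≤ Real.exp ((‖s₀‖ + 1) * K') := by
      rw [Complex.norm_exp]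
      refine Real.exp_le_exp.mpr ((Complex.re_le_norm _).trans ?_)
      rw [norm_mul, norm_neg, Complex.norm_real]
      gcongr
    gcongr
    exact (norm_nonneg _).trans h1
  · have h1 : HasDerivAt (fun s : ℂ => -s * L r) (-L r) s := by
      simpa using (hasDerivAt_id s).neg.mul_const (L r : ℂ)
    exact h1.cexp.const_mul _

/-! ### The meromorphic continuation of the Dirichlet series -/

/-- `j^(-s) u^(-s-a) (j+u)^(-s-b)`. -/
noncomputable def ker (a b : ℕ) (s : ℂ) (j u : ℝ) : ℂ :=
  (j : ℂ) ^ (-s) * (u : ℂ) ^ (-s - a) * ((j + u : ℝ) : ℂ) ^ (-s - b)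

/-- The integral of the kernel against a weight over one unit interval. -/
noncomputable def kerTerm (φ : ℝ → ℝ) (a b : ℕ) (p : ℕ × ℕ) (s : ℂ) : ℂ :=
  ∫ r in (0 : ℝ)..1, (φ r : ℂ) * ker a b s (p.1 + 1) (p.1 + 1 + p.2 + r)

/-- The sum of `kerTerm` over all unit intervals. -/
noncomputable def kerSum (φ : ℝ → ℝ) (a b : ℕ) (s : ℂ) : ℂ := ∑' p : ℕ × ℕ, kerTerm φ a b p s

lemma rpow_le_three_rpow {q e M : ℝ} (h1 : 1 ≤ q) (h3 : q ≤ 3) (he : |e| ≤ M) :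
    q ^ e ≤ 3 ^ M :=
  (Real.rpow_le_rpow_of_exponent_le h1 ((le_abs_self e).trans he)).trans
    (Real.rpow_le_rpow (by linarith) h3 ((abs_nonneg e).trans he))

/-- On a unit interval starting at i ≥ j both u and j + u lie in [i, 3i], so their powers are
comparable with those of i. The constants are uniform on the vertical strip, as locally uniform
convergence in `s` requires. -/
lemma norm_ker_le {a b : ℕ} {σ₀ σ₁ : ℝ} {s : ℂ} (h0 : σ₀ ≤ s.re) (h1 : s.re ≤ σ₁) {j i u : ℝ}
    (hj : 1 ≤ j) (hji : j ≤ i) (hiu : i ≤ u) (hui : u ≤ i + 1) :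
    ‖ker a b s j u‖ ≤ 3 ^ (|σ₀| + |σ₁| + a) * 3 ^ (|σ₀| + |σ₁| + b) *
      (j ^ (-σ₀) * i ^ (-(2 * σ₀ + a + b))) := by
  have hi : 0 < i := by linarith
  have hM : |s.re| ≤ |σ₀| + |σ₁| := by
    refine abs_le.mpr ⟨?_, ?_⟩
    · linarith [neg_abs_le σ₀, abs_nonneg σ₁]
    · linarith [le_abs_self σ₁, abs_nonneg σ₀]
  have hE : ∀ c : ℕ, |-s.re - c| ≤ |σ₀| + |σ₁| + c := fun c => by
    refine (abs_sub _ _).trans ?_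
    rw [abs_neg, Nat.abs_cast]
    linarith
  have key : ∀ (c : ℕ) (v : ℝ), i ≤ v → v ≤ 3 * i →
      v ^ (-s.re - c) ≤ 3 ^ (|σ₀| + |σ₁| + c) * i ^ (-s.re - c) := fun c v hv hv3 => by
    have : v = v / i * i := by field_simp
    rw [this, Real.mul_rpow (div_nonneg (hi.le.trans hv) hi.le) hi.le]
    refine mul_le_mul_of_nonneg_right ?_ (Real.rpow_nonneg hi.le _)
    exact rpow_le_three_rpow ((one_le_div hi).mpr hv) ((div_le_iff₀ hi).mpr hv3) (hE c)
  rw [ker, norm_mul, norm_mul, Complex.norm_cpow_eq_rpow_re_of_pos (by linarith),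
    Complex.norm_cpow_eq_rpow_re_of_pos (by linarith),
    Complex.norm_cpow_eq_rpow_re_of_pos (by linarith)]
  simp only [Complex.sub_re, Complex.neg_re, Complex.natCast_re]
  have k1 := key a u hiu (by linarith)
  have k2 := key b (j + u) (by linarith) (by linarith)
  have k3 : j ^ (-s.re) ≤ j ^ (-σ₀) := Real.rpow_le_rpow_of_exponent_le hj (by linarith)
  have k4 : i ^ (-s.re - a) * i ^ (-s.re - b) ≤ i ^ (-(2 * σ₀ + a + b)) := by
    rw [← Real.rpow_add hi]
    exact Real.rpow_le_rpow_of_exponent_le (by linarith) (by linarith)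
  have n1 : 0 ≤ u ^ (-s.re - a) := Real.rpow_nonneg (by linarith) _
  have n2 : 0 ≤ (j + u) ^ (-s.re - b) := Real.rpow_nonneg (by linarith) _
  calc j ^ (-s.re) * u ^ (-s.re - a) * (j + u) ^ (-s.re - b)
      ≤ j ^ (-σ₀) * (3 ^ (|σ₀| + |σ₁| + a) * i ^ (-s.re - a)) *
        (3 ^ (|σ₀| + |σ₁| + b) * i ^ (-s.re - b)) := by gcongr
    _ = 3 ^ (|σ₀| + |σ₁| + a) * 3 ^ (|σ₀| + |σ₁| + b) *
        (j ^ (-σ₀) * (i ^ (-s.re - a) * i ^ (-s.re - b))) := by ring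
    _ ≤ _ := by gcongr

/-- For fixed j and u the kernel is an exponential in `s`; this puts `kerTerm` in the form of
`differentiable_integral_exp` and shows that it is entire. -/
lemma ker_eq_exp {a b : ℕ} {s : ℂ} {j u : ℝ} (hj : 0 < j) (hu : 0 < u) :
    ker a b s j u = ((u ^ (-(a : ℝ)) * (j + u) ^ (-(b : ℝ)) : ℝ) : ℂ) *
      Complex.exp (-s * ((Real.log j + Real.log u + Real.log (j + u) : ℝ) : ℂ)) := by
  have hju : 0 < j + u := by linarith
  have e : ∀ (c : ℕ) (v : ℝ), 0 < v → (v : ℂ) ^ (-s - c) =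
      ((v ^ (-(c : ℝ)) : ℝ) : ℂ) * Complex.exp (-s * (Real.log v : ℂ)) := fun c v hv => by
    have hv' : (v : ℂ) ≠ 0 := by exact_mod_cast hv.ne'
    rw [sub_eq_neg_add, Complex.cpow_add _ _ hv', Complex.ofReal_cpow hv.le]
    push_cast
    congr 1
    rw [Complex.cpow_def_of_ne_zero hv', ← Complex.ofReal_log hv.le, mul_comm]
  have e0 := e 0 j hj
  simp only [Nat.cast_zero, sub_zero, neg_zero, Real.rpow_zero, Complex.ofReal_one, one_mul] at e0
  rw [ker, e0, e a u hu, e b _ hju]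
  push_cast
  rw [mul_add, mul_add, Complex.exp_add, Complex.exp_add]
  ring

/-- Differentiation in u raises `a` or `b` by one: a gain of one power of decay at the price of a
factor linear in `s`. The continuation runs on this gain. -/
lemma hasDerivAt_ker {a b : ℕ} {s : ℂ} {j u : ℝ} (hj : 0 < j) (hu : 0 < u) :
    HasDerivAt (fun u => ker a b s j u)
      (-((s + a) * ker (a + 1) b s j u + (s + b) * ker a (b + 1) s j u)) u := by
  have hju : 0 < j + u := by linarith
  have e : ∀ (c : ℕ) (v : ℝ), 0 < v → HasDerivAt (fun v : ℝ => (v : ℂ) ^ (-s - c))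
      (-(s + c) * (v : ℂ) ^ (-s - (c + 1 : ℕ))) v := fun c v hv => by
    have h1 := (hasDerivAt_id (v : ℂ)).cpow_const (c := -s - c) (Or.inl (by simpa using hv))
    refine h1.comp_ofReal.congr_deriv ?_
    push_cast
    simp only [id]
    ring_nf
  have h2 := (e b (j + u) hju).comp_const_add j u
  refine (((e a u hu).const_mul ((j : ℂ) ^ (-s))).mul h2).congr_deriv ?_
  simp only [ker]
  ring

lemma continuousOn_ker {a b : ℕ} {s : ℂ} {j i : ℝ} (hj : 0 < j) (hi : 0 < i) :
    ContinuousOn (fun r => ker a b s j (i + r)) (Icc 0 1) := fun r hr =>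
  ((hasDerivAt_ker (a := a) (b := b) (s := s) hj
    (by linarith [hr.1] : 0 < i + r)).comp_const_add i r).continuousAt.continuousWithinAt

lemma differentiable_kerTerm {φ : ℝ → ℝ} (hφ : Continuous φ) (a b : ℕ) (p : ℕ × ℕ) :
    Differentiable ℂ (kerTerm φ a b p) := by
  have hj : (0 : ℝ) < p.1 + 1 := by positivity
  have hu : ∀ r ∈ Icc (0 : ℝ) 1, (0 : ℝ) < p.1 + 1 + p.2 + r := fun r hr => by
    have := hr.1
    positivity
  have hju : ∀ r ∈ Icc (0 : ℝ) 1, (0 : ℝ) < p.1 + 1 + (p.1 + 1 + p.2 + r) := fun r hr => by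
    have := hr.1
    positivity
  have := differentiable_integral_exp
    (ρ := fun r => (φ r : ℂ) * (((p.1 + 1 + p.2 + r : ℝ) ^ (-(a : ℝ)) *
      (p.1 + 1 + (p.1 + 1 + p.2 + r) : ℝ) ^ (-(b : ℝ)) : ℝ) : ℂ))
    (L := fun r => Real.log (p.1 + 1) + Real.log (p.1 + 1 + p.2 + r) +
      Real.log (p.1 + 1 + (p.1 + 1 + p.2 + r))) ?_ ?_
  · convert this using 2 with s
    refine intervalIntegral.integral_congr fun r hr => ?_
    rw [uIcc_of_le zero_le_one] at hr
    rw [ker_eq_exp hj (hu r hr), mul_assoc]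
  · refine (by fun_prop : Continuous fun r => (φ r : ℂ)).continuousOn.mul ?_
    refine Complex.continuous_ofReal.comp_continuousOn (ContinuousOn.mul ?_ ?_)
    · exact ContinuousOn.rpow_const (by fun_prop) fun r hr => Or.inl (hu r hr).ne'
    · exact ContinuousOn.rpow_const (by fun_prop) fun r hr => Or.inl (hju r hr).ne'
  · refine (continuousOn_const.add (ContinuousOn.log (by fun_prop) fun r hr => (hu r hr).ne')).add
      (ContinuousOn.log (by fun_prop) fun r hr => (hju r hr).ne')

lemma norm_kerTerm_le {φ : ℝ → ℝ} {K : ℝ} (hK : ∀ r ∈ Icc (0 : ℝ) 1, ‖φ r‖ ≤ K) (a b : ℕ)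
    {σ₀ σ₁ : ℝ} {s : ℂ} (h0 : σ₀ ≤ s.re) (h1 : s.re ≤ σ₁) (p : ℕ × ℕ) :
    ‖kerTerm φ a b p s‖ ≤ K * (3 ^ (|σ₀| + |σ₁| + a) * 3 ^ (|σ₀| + |σ₁| + b)) *
      (((p.1 : ℝ) + 1) ^ (-σ₀) * ((p.1 : ℝ) + 1 + p.2) ^ (-(2 * σ₀ + a + b))) := by
  have hp1 := Nat.cast_nonneg (α := ℝ) p.1
  have hp2 := Nat.cast_nonneg (α := ℝ) p.2
  refine (intervalIntegral.norm_integral_le_of_norm_le_const fun r hr => ?_).trans_eq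
    (by rw [sub_zero, abs_one, mul_one])
  rw [uIoc_of_le zero_le_one] at hr
  rw [norm_mul, Complex.norm_real, mul_assoc K]
  exact mul_le_mul (hK r ⟨hr.1.le, hr.2⟩) (norm_ker_le h0 h1 (by linarith) (by linarith)
    (by linarith [hr.1]) (by linarith [hr.2])) (norm_nonneg _)
    ((norm_nonneg _).trans (hK r ⟨hr.1.le, hr.2⟩))

/-- The bound is far from optimal. All that matters is that it moves left by a fixed amount with
each unit of `n`; with the choice `c = 2` a slope of 1/4 leaves ample room. -/
lemma summable_kerBound {n σ₀ : ℝ} (hn : 0 ≤ n) (hσ : 2 - n / 4 ≤ σ₀) : Summable fun p : ℕ × ℕ =>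
    ((p.1 : ℝ) + 1) ^ (-σ₀) * ((p.1 : ℝ) + 1 + p.2) ^ (-(2 * σ₀ + n)) :=
  summable_pair_rpow (c := 2) (by norm_num) (by linarith) (by linarith)

lemma summable_kerTerm {φ : ℝ → ℝ} (hφ : Continuous φ) (a b : ℕ) {s : ℂ}
    (hs : 2 - ((a : ℝ) + b) / 4 ≤ s.re) : Summable fun p => kerTerm φ a b p s := by
  obtain ⟨K, hK⟩ := isCompact_Icc.exists_bound_of_continuousOn (hφ.continuousOn (s := Icc 0 1))
  refine Summable.of_norm_bounded ?_ (norm_kerTerm_le hK a b le_rfl le_rfl)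
  simp_rw [add_assoc (2 * s.re)]
  exact (summable_kerBound (by positivity) hs).mul_left _

/-- Weierstrass' theorem, on strips because the term bound also needs an upper bound for Re s. The
reindexing `e` lets the same proof serve the full double sum and the single row j = 1. -/
lemma differentiableOn_tsum_kerTerm {φ : ℝ → ℝ} (hφ : Continuous φ) (a b : ℕ) {ι : Type*}
    {e : ι → ℕ × ℕ} (he : Function.Injective e) :
    DifferentiableOn ℂ (fun s => ∑' i, kerTerm φ a b (e i) s)
      {s : ℂ | 2 - ((a : ℝ) + b) / 4 < s.re} := by
  obtain ⟨K, hK⟩ := isCompact_Icc.exists_bound_of_continuousOn (hφ.continuousOn (s := Icc 0 1))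
  intro s hs
  set σ₀ := 2 - ((a : ℝ) + b) / 4
  set U : Set ℂ := {s | σ₀ < s.re} ∩ {t | t.re < s.re + 1}
  have hU : IsOpen U := (isOpen_halfPlane _).inter
    (isOpen_lt Complex.continuous_re continuous_const)
  have hsum : Summable fun p : ℕ × ℕ =>
      K * (3 ^ (|σ₀| + |s.re + 1| + a) * 3 ^ (|σ₀| + |s.re + 1| + b)) *
      (((p.1 : ℝ) + 1) ^ (-σ₀) * ((p.1 : ℝ) + 1 + p.2) ^ (-(2 * σ₀ + a + b))) := by
    simp_rw [add_assoc (2 * σ₀)]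
    exact (summable_kerBound (by positivity) le_rfl).mul_left _
  have hd : DifferentiableOn ℂ (fun s => ∑' i, kerTerm φ a b (e i) s) U :=
    Complex.differentiableOn_tsum_of_summable_norm (hsum.comp_injective he)
      (fun i => (differentiable_kerTerm hφ a b (e i)).differentiableOn) hU
      (fun i t ht => norm_kerTerm_le hK a b (le_of_lt ht.1) (le_of_lt ht.2) (e i))
  have hsU : s ∈ U := ⟨hs, by simp⟩
  exact (hd.differentiableAt (hU.mem_nhds hsU)).differentiableWithinAt

lemma differentiableOn_kerSum {φ : ℝ → ℝ} (hφ : Continuous φ) (a b : ℕ) :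
    DifferentiableOn ℂ (kerSum φ a b) {s | 2 - ((a : ℝ) + b) / 4 < s.re} :=
  differentiableOn_tsum_kerTerm hφ a b Function.injective_id

/-- Only the point 1 needs an argument: the residue limit makes (t - 1) ζ(t), with value 1 put in at
t = 1, continuous there, so the singularity of the product is removable. -/
lemma meromorphicAt_riemannZeta (s : ℂ) : MeromorphicAt riemannZeta s := by
  have hd : ∀ t : ℂ, t ≠ 1 → DifferentiableAt ℂ riemannZeta t := fun t ht =>
    differentiableAt_riemannZeta ht
  have hne : ∀ᶠ t in 𝓝[≠] s, t ≠ 1 := by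
    rcases eq_or_ne s 1 with rfl | hs
    · exact self_mem_nhdsWithin
    · exact mem_nhdsWithin_of_mem_nhds (isOpen_ne.mem_nhds hs)
  have han : AnalyticAt ℂ (Function.update (fun t => (t - 1) * riemannZeta t) 1 1) 1 := by
    refine Complex.analyticAt_of_differentiable_on_punctured_nhds_of_continuousAt ?_
      (continuousAt_update_same.mpr riemannZeta_residue_one)
    filter_upwards [self_mem_nhdsWithin] with t ht
    refine (((differentiableAt_id.sub_const 1).mul (hd t ht))).congr_of_eventuallyEq ?_
    filter_upwards [isOpen_ne.mem_nhds ht] with u hu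
    simp [Function.update_of_ne hu]
  rcases eq_or_ne s 1 with rfl | hs
  · refine MeromorphicAt.congr (f := fun t => Function.update
      (fun t => (t - 1) * riemannZeta t) 1 1 t / (t - 1)) (han.meromorphicAt.div (by fun_prop)) ?_
    filter_upwards [hne] with t ht
    rw [Function.update_of_ne ht, mul_div_cancel_left₀ _ (sub_ne_zero.mpr ht)]
  · refine (DifferentiableOn.analyticAt (s := {1}ᶜ)
      (fun t ht => (hd t ht).differentiableWithinAt) (isOpen_ne.mem_nhds hs)).meromorphicAt

/-- `F`, given for `Re s > 2`, continues meromorphically to `Re s > N`. -/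
def ContinuesTo (N : ℝ) (F : ℂ → ℂ) : Prop :=
  ∃ g : ℂ → ℂ, MeromorphicOn g {s | N < s.re} ∧ ∀ s : ℂ, 2 < s.re → g s = F s

lemma ContinuesTo.add {N : ℝ} {F G : ℂ → ℂ} (hF : ContinuesTo N F) (hG : ContinuesTo N G) :
    ContinuesTo N (fun s => F s + G s) := by
  obtain ⟨f, hf, hfF⟩ := hF
  obtain ⟨g, hg, hgG⟩ := hG
  exact ⟨f + g, hf.add hg, fun s hs => by simp [hfF s hs, hgG s hs]⟩

lemma ContinuesTo.mul {N : ℝ} {F G : ℂ → ℂ} (hF : ContinuesTo N F) (hG : ContinuesTo N G) :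
    ContinuesTo N (fun s => F s * G s) := by
  obtain ⟨f, hf, hfF⟩ := hF
  obtain ⟨g, hg, hgG⟩ := hG
  exact ⟨f * g, hf.mul hg, fun s hs => by simp [hfF s hs, hgG s hs]⟩

lemma ContinuesTo.congr {N : ℝ} {F G : ℂ → ℂ} (hF : ContinuesTo N F)
    (h : ∀ s : ℂ, 2 < s.re → F s = G s) : ContinuesTo N G := by
  obtain ⟨f, hf, hfF⟩ := hF
  exact ⟨f, hf, fun s hs => (hfF s hs).trans (h s hs)⟩

lemma continuesTo_of_meromorphicAt {N : ℝ} {F : ℂ → ℂ} (hF : ∀ s, MeromorphicAt F s) :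
    ContinuesTo N F := ⟨F, fun s _ => hF s, fun _ _ => rfl⟩

lemma continuesTo_of_differentiableOn {N M : ℝ} {F : ℂ → ℂ} (hMN : M ≤ N)
    (hF : DifferentiableOn ℂ F {s | M < s.re}) : ContinuesTo N F :=
  ⟨F, fun _ hs => (hF.analyticAt ((isOpen_halfPlane M).mem_nhds
    (hMN.trans_lt hs))).meromorphicAt, fun _ _ => rfl⟩

/-! #### The integral over a half-line -/

lemma norm_ker_one_le {a b : ℕ} {s : ℂ} (hs : 0 ≤ s.re) {u : ℝ} (hu : 1 ≤ u) :
    ‖ker a b s 1 u‖ ≤ u ^ (-(2 * s.re)) := by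
  have hu0 : 0 < u := by linarith
  have e : ∀ (c : ℕ) (v : ℝ), u ≤ v → v ^ (-s.re - c) ≤ u ^ (-s.re) := fun c v hv => by
    have hc := Nat.cast_nonneg (α := ℝ) c
    exact (Real.rpow_le_rpow_of_exponent_le (hu.trans hv) (by linarith)).trans
      (Real.rpow_le_rpow_of_nonpos hu0 hv (by linarith))
  rw [ker, Complex.ofReal_one, Complex.one_cpow, one_mul, norm_mul,
    Complex.norm_cpow_eq_rpow_re_of_pos hu0,
    Complex.norm_cpow_eq_rpow_re_of_pos (by linarith)]
  simp only [Complex.sub_re, Complex.neg_re, Complex.natCast_re]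
  calc u ^ (-s.re - a) * (1 + u) ^ (-s.re - b) ≤ u ^ (-s.re) * u ^ (-s.re) :=
        mul_le_mul (e a u le_rfl) (e b _ (by linarith)) (Real.rpow_nonneg (by linarith) _)
          (Real.rpow_nonneg hu0.le _)
    _ = _ := by rw [← Real.rpow_add hu0]; ring_nf

lemma integrableOn_ker_one (a b : ℕ) {s : ℂ} (hs : 2 < s.re) :
    IntegrableOn (ker a b s 1) (Ioi 1) := by
  refine Integrable.mono' (integrableOn_Ioi_rpow_of_lt (a := -(2 * s.re)) (by linarith) one_pos)
    ?_ ?_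
  · refine ContinuousOn.aestronglyMeasurable (fun u hu => ?_) measurableSet_Ioi
    exact (hasDerivAt_ker one_pos (one_pos.trans hu)).continuousAt.continuousWithinAt
  · exact (ae_restrict_mem measurableSet_Ioi).mono fun u hu =>
      norm_ker_one_le (by linarith) (le_of_lt hu)

lemma integral_ker_one_eq_tsum (a b : ℕ) {s : ℂ} (hs : 2 < s.re) :
    ∫ u in Ioi 1, ker a b s 1 u = ∑' l : ℕ, kerTerm (fun _ => 1) a b (0, l) s := by
  rw [← (hasSum_integral_unit (integrableOn_ker_one a b hs)).tsum_eq]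
  refine tsum_congr fun l => ?_
  simp [kerTerm]

/-- Integrate the derivative of u · ker over (1, ∞). The factor u lowers the exponent raised in the
first part, and u = (1 + u) - 1 treats the second, so only `b` goes up. Division by 2s + a + b - 1
then continues the integral, with a possible pole at its zero. -/
lemma integral_ker_one_step (a b : ℕ) {s : ℂ} (hs : 2 < s.re) :
    (2 * s + a + b - 1) * ∫ u in Ioi 1, ker a b s 1 u =
      2 ^ (-s - b) + (s + b) * ∫ u in Ioi 1, ker a (b + 1) s 1 u := by
  have hder : ∀ u ∈ Ici (1 : ℝ), HasDerivAt (fun u : ℝ => (u : ℂ) * ker a b s 1 u)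
      (-(2 * s + a + b - 1) * ker a b s 1 u + (s + b) * ker a (b + 1) s 1 u) u := by
    intro u hu
    have hu0 : 0 < u := one_pos.trans_le hu
    have hu' : (u : ℂ) ≠ 0 := by exact_mod_cast hu0.ne'
    have hu1 : ((1 + u : ℝ) : ℂ) ≠ 0 := by
      exact_mod_cast (by linarith : (0 : ℝ) < 1 + u).ne'
    refine ((hasDerivAt_id u).ofReal_comp.mul (hasDerivAt_ker one_pos hu0)).congr_deriv ?_
    have e1 : (u : ℂ) * ker (a + 1) b s 1 u = ker a b s 1 u := by
      have : (u : ℂ) ^ (-s - a) = u * (u : ℂ) ^ (-s - (a + 1 : ℕ)) := by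
        conv_rhs => rw [mul_comm]
        nth_rewrite 3 [← Complex.cpow_one (u : ℂ)]
        rw [← Complex.cpow_add _ _ hu']
        push_cast
        ring_nf
      rw [ker, ker, this]
      ring
    have e2 : ((1 + u : ℝ) : ℂ) * ker a (b + 1) s 1 u = ker a b s 1 u := by
      have : ((1 + u : ℝ) : ℂ) ^ (-s - b) = (1 + u : ℝ) * ((1 + u : ℝ) : ℂ) ^ (-s - (b + 1 : ℕ)) := by
        conv_rhs => rw [mul_comm]
        nth_rewrite 3 [← Complex.cpow_one ((1 + u : ℝ) : ℂ)]
        rw [← Complex.cpow_add _ _ hu1]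
        push_cast
        ring_nf
      rw [ker, ker, this]
      ring
    push_cast at e2
    simp only [id, Complex.ofReal_one]
    linear_combination -(s + a) * e1 - (s + b) * e2
  have hlim : Tendsto (fun u : ℝ => (u : ℂ) * ker a b s 1 u) atTop (𝓝 0) := by
    refine squeeze_zero_norm' ?_ (tendsto_rpow_neg_atTop (y := 2 * s.re - 1) (by linarith))
    filter_upwards [eventually_ge_atTop 1] with u hu
    have hu0 : 0 < u := one_pos.trans_le hu
    rw [norm_mul, Complex.norm_real, Real.norm_of_nonneg hu0.le]
    refine (mul_le_mul_of_nonneg_left (norm_ker_one_le (by linarith) hu) hu0.le).trans_eq ?_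
    conv_lhs => rw [mul_comm, ← Real.rpow_add_one hu0.ne']
    ring_nf
  have hi1 := (integrableOn_ker_one a b hs).const_mul (-(2 * s + a + b - 1))
  have hi2 := (integrableOn_ker_one a (b + 1) hs).const_mul (s + b)
  have := integral_Ioi_of_hasDerivAt_of_tendsto' hder (hi1.add hi2) hlim
  rw [integral_add hi1 hi2, integral_const_mul, integral_const_mul] at this
  have e3 : ((1 : ℝ) : ℂ) * ker a b s 1 1 = 2 ^ (-s - b) := by
    rw [ker]
    norm_num
  rw [e3] at this
  linear_combination -this

lemma continuesTo_integral_ker_one (d : ℕ) : ∀ a b : ℕ,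
    ContinuesTo (2 - ((a : ℝ) + b + d) / 4) fun s => ∫ u in Ioi 1, ker a b s 1 u := by
  induction d with
  | zero =>
    intro a b
    -- The integral over (1, ∞) is the row j = 1 of the double sum, already known to be holomorphic
    -- on the required half-plane.
    refine ContinuesTo.congr ?_ fun s hs => (integral_ker_one_eq_tsum a b hs).symm
    have hφ : Continuous fun _ : ℝ => (1 : ℝ) := continuous_const
    refine continuesTo_of_differentiableOn (M := 2 - ((a : ℝ) + b) / 4) (by simp) ?_
    exact differentiableOn_tsum_kerTerm hφ a b (Prod.mk_right_injective 0)
  | succ d ih =>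
    intro a b
    have h1 := ih a (b + 1)
    have e : (2 : ℝ) - ((a : ℝ) + (b + 1 : ℕ) + d) / 4 = 2 - ((a : ℝ) + b + (d + 1 : ℕ)) / 4 := by
      push_cast
      ring
    rw [e] at h1
    have h2 := (continuesTo_of_meromorphicAt (N := 2 - ((a : ℝ) + b + (d + 1 : ℕ)) / 4)
      (F := fun s => 2 ^ (-s - (b : ℂ))) fun s => by
        have : AnalyticAt ℂ (fun s : ℂ => (2 : ℂ) ^ (-s - (b : ℂ))) s :=
          Differentiable.analyticAt (fun t => by
            refine DifferentiableAt.const_cpow (by fun_prop) (Or.inl two_ne_zero)) s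
        exact this.meromorphicAt).add ((continuesTo_of_meromorphicAt
          (F := fun s => s + b) fun s => by fun_prop).mul h1)
    refine ((continuesTo_of_meromorphicAt (F := fun s : ℂ => (2 * s + a + b - 1)⁻¹)
      fun s => by fun_prop).mul h2).congr fun s hs => ?_
    have hne : 2 * s + a + b - 1 ≠ 0 := fun h0 => by
      have := congrArg Complex.re h0
      simp at this
      have h1 := Nat.cast_nonneg (α := ℝ) a
      have h2 := Nat.cast_nonneg (α := ℝ) b
      linarith
    rw [← integral_ker_one_step a b hs, inv_mul_cancel_left₀ hne]

lemma ker_scale {a b : ℕ} {s : ℂ} {j v : ℝ} (hj : 0 < j) (hv : 0 < v) :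
    ker a b s j (j * v) = (j : ℂ) ^ (-(3 * s + a + b)) * ker a b s 1 v := by
  have hj' : (j : ℂ) ≠ 0 := by exact_mod_cast hj.ne'
  have e : -(3 * s + a + b) = -s + (-s - a) + (-s - b) := by ring
  rw [e, Complex.cpow_add _ _ hj', Complex.cpow_add _ _ hj', ker, ker,
    show j + j * v = j * (1 + v) by ring, Complex.ofReal_mul, Complex.ofReal_mul,
    Complex.mul_cpow_ofReal_nonneg hj.le hv.le,
    Complex.mul_cpow_ofReal_nonneg hj.le (by linarith : (0 : ℝ) ≤ 1 + v), Complex.ofReal_one,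
    Complex.one_cpow]
  ring

/-- With constant weight the unit intervals fill (j, ∞), and u = j v pulls out j^(-(3s + a + b))
times the Jacobian j. The sum over j is therefore a zeta value and the integral no longer depends on
j. -/
lemma kerSum_one_eq (a b : ℕ) {s : ℂ} (hs : 2 < s.re) :
    kerSum (fun _ => 1) a b s =
      riemannZeta (3 * s + a + b - 1) * ∫ u in Ioi 1, ker a b s 1 u := by
  have hsum : Summable fun p => kerTerm (fun _ => 1) a b p s :=
    summable_kerTerm continuous_const a b (by
      have h1 := Nat.cast_nonneg (α := ℝ) a
      have h2 := Nat.cast_nonneg (α := ℝ) b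
      linarith)
  rw [kerSum, hsum.tsum_prod, zeta_eq_tsum_one_div_nat_add_one_cpow, ← tsum_mul_right]
  · refine tsum_congr fun n => ?_
    have hn : (0 : ℝ) < n + 1 := by positivity
    have hn' : ((n : ℂ) + 1) ≠ 0 := by exact_mod_cast hn.ne'
    have hscale : ∫ u in Ioi ((n : ℝ) + 1), ker a b s (n + 1) u =
        1 / ((n : ℂ) + 1) ^ (3 * s + a + b - 1) * ∫ u in Ioi 1, ker a b s 1 u := by
      have h1 := integral_comp_mul_left_Ioi' (fun u => ker a b s (n + 1) u) 1 hn
      rw [mul_one] at h1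
      rw [← h1, setIntegral_congr_fun measurableSet_Ioi
        (fun v hv => ker_scale hn (one_pos.trans hv)), integral_const_mul, Complex.real_smul,
        ← mul_assoc]
      congr 1
      push_cast
      rw [one_div, ← Complex.cpow_neg, mul_comm]
      nth_rewrite 2 [← Complex.cpow_one ((n : ℂ) + 1)]
      rw [← Complex.cpow_add _ _ hn']
      ring_nf
    have hint : IntegrableOn (fun u => ker a b s (n + 1) u) (Ioi ((n : ℝ) + 1)) := by
      have h2 : IntegrableOn (fun v => ker a b s (n + 1) ((n + 1) * v)) (Ioi 1) :=
        IntegrableOn.congr_fun ((integrableOn_ker_one a b hs).const_mul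
          (((n + 1 : ℝ) : ℂ) ^ (-(3 * s + a + b))))
          (fun v hv => (ker_scale hn (one_pos.trans hv)).symm) measurableSet_Ioi
      have h3 := (integrableOn_Ioi_comp_mul_left_iff (fun u => ker a b s (n + 1) u) 1 hn).mp h2
      rwa [mul_one] at h3
    rw [← hscale, ← (hasSum_integral_unit hint).tsum_eq]
    refine tsum_congr fun l => ?_
    simp [kerTerm]
  · have h1 := Nat.cast_nonneg (α := ℝ) a
    have h2 := Nat.cast_nonneg (α := ℝ) b
    simp
    linarith

/-! #### Continuation of the sums over all unit intervals -/

/-- Split the weight into its mean and a fluctuation. The primitive of the fluctuation from 0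
vanishes at both ends of the unit interval, so integrating by parts produces no boundary terms and
moves the derivative onto the kernel. -/
lemma kerTerm_step {φ : ℝ → ℝ} (hφ : Continuous φ) (a b : ℕ) (p : ℕ × ℕ) (s : ℂ) :
    kerTerm φ a b p s = ((∫ r in (0 : ℝ)..1, φ r : ℝ) : ℂ) * kerTerm (fun _ => 1) a b p s +
      ((s + a) * kerTerm (fun r => ∫ t in (0 : ℝ)..r, (φ t - ∫ r in (0 : ℝ)..1, φ r))
        (a + 1) b p s +
      (s + b) * kerTerm (fun r => ∫ t in (0 : ℝ)..r, (φ t - ∫ r in (0 : ℝ)..1, φ r))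
        a (b + 1) p s) := by
  set c := ∫ r in (0 : ℝ)..1, φ r with hc
  have hj : (0 : ℝ) < p.1 + 1 := by positivity
  have hi : (0 : ℝ) < p.1 + 1 + p.2 := by positivity
  have hψ : ∀ r, HasDerivAt (fun r => ∫ t in (0 : ℝ)..r, (φ t - c)) (φ r - c) r := fun r =>
    (hφ.sub continuous_const).integral_hasStrictDerivAt 0 r |>.hasDerivAt
  have hψc : Continuous fun r => ∫ t in (0 : ℝ)..r, (φ t - c) :=
    continuous_iff_continuousAt.mpr fun r => (hψ r).continuousAt
  have hψ1 : ∫ t in (0 : ℝ)..1, (φ t - c) = 0 := by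
    rw [intervalIntegral.integral_sub (hφ.intervalIntegrable _ _) (by simp)]
    simp [hc]
  have hk : ∀ a b : ℕ, ContinuousOn (fun r => ker a b s (p.1 + 1) (p.1 + 1 + p.2 + r)) (Icc 0 1) :=
    fun a b => continuousOn_ker hj hi
  have key := integral_mul_deriv_eq_neg (fun r _ => hψ r) (hφ.sub continuous_const)
    (g := fun r => ker a b s (p.1 + 1) (p.1 + 1 + p.2 + r))
    (fun r hr => (hasDerivAt_ker (a := a) (b := b) (s := s) hj
      (by linarith [hr.1] : 0 < (p.1 : ℝ) + 1 + p.2 + r)).comp_const_add _ r)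
    (((continuousOn_const.mul (hk (a + 1) b)).add
      (continuousOn_const.mul (hk a (b + 1)))).neg)
  have hint : ∀ (f : ℝ → ℝ) (a b : ℕ), Continuous f → IntervalIntegrable
      (fun r => (f r : ℂ) * ker a b s (p.1 + 1) (p.1 + 1 + p.2 + r)) volume 0 1 := fun f a b hf =>
    ContinuousOn.intervalIntegrable (by
      rw [uIcc_of_le zero_le_one]
      exact (by fun_prop : Continuous fun r => (f r : ℂ)).continuousOn.mul (hk a b))
  rw [hψ1] at key
  simp only [intervalIntegral.integral_same, Complex.ofReal_zero, zero_mul, sub_zero, zero_sub]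
    at key
  have e1 : ∫ r in (0 : ℝ)..1, ((φ r - c : ℝ) : ℂ) * ker a b s (p.1 + 1) (p.1 + 1 + p.2 + r) =
      kerTerm φ a b p s - c * kerTerm (fun _ => 1) a b p s := by
    rw [kerTerm, kerTerm, ← intervalIntegral.integral_const_mul, ← intervalIntegral.integral_sub
      (hint φ a b hφ) ((hint _ a b continuous_const).const_mul _)]
    refine intervalIntegral.integral_congr fun r _ => ?_
    simp
    ring
  have e2 : (s + a) * kerTerm (fun r => ∫ t in (0 : ℝ)..r, (φ t - c)) (a + 1) b p s +
      (s + b) * kerTerm (fun r => ∫ t in (0 : ℝ)..r, (φ t - c)) a (b + 1) p s =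
      -∫ r in (0 : ℝ)..1, ((∫ t in (0 : ℝ)..r, (φ t - c) : ℝ) : ℂ) *
        -((s + a) * ker (a + 1) b s (p.1 + 1) (p.1 + 1 + p.2 + r) +
          (s + b) * ker a (b + 1) s (p.1 + 1) (p.1 + 1 + p.2 + r)) := by
    rw [← intervalIntegral.integral_neg]
    simp only [kerTerm]
    rw [← intervalIntegral.integral_const_mul,
      ← intervalIntegral.integral_const_mul, ← intervalIntegral.integral_add
      ((hint _ _ _ hψc).const_mul _) ((hint _ _ _ hψc).const_mul _)]
    refine intervalIntegral.integral_congr fun r _ => ?_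
    ring
  linear_combination key - e1 - e2

/-- The weight must be arbitrary for the induction, since each integration by parts replaces it by a
new primitive. The mean part is explicit by `kerSum_one_eq`; the fluctuation parts have `a + b` one
larger, which pays for the step in `d`. -/
lemma continuesTo_kerSum (d : ℕ) : ∀ (φ : ℝ → ℝ) (a b : ℕ), Continuous φ →
    ContinuesTo (2 - ((a : ℝ) + b + d) / 4) (kerSum φ a b) := by
  induction d with
  | zero =>
    intro φ a b hφ
    exact continuesTo_of_differentiableOn (by simp) (differentiableOn_kerSum hφ a b)
  | succ d ih =>
    intro φ a b hφ
    set c := ∫ r in (0 : ℝ)..1, φ r with hc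
    set ψ : ℝ → ℝ := fun r => ∫ t in (0 : ℝ)..r, (φ t - c) with hψdef
    have hψ : Continuous ψ := continuous_iff_continuousAt.mpr fun r =>
      ((hφ.sub continuous_const).integral_hasStrictDerivAt 0 r |>.hasDerivAt).continuousAt
    have h1 := ih ψ (a + 1) b hψ
    have h2 := ih ψ a (b + 1) hψ
    -- The mean part keeps the same `a` and `b`, so its continuation needs one more step to reach
    -- the same half-plane.
    have h3 := continuesTo_integral_ker_one (d + 1) a b
    set N := (2 : ℝ) - ((a : ℝ) + b + (d + 1 : ℕ)) / 4 with hN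
    have e1 : (2 : ℝ) - (((a + 1 : ℕ) : ℝ) + b + d) / 4 = N := by
      rw [hN]
      push_cast
      ring
    have e2 : (2 : ℝ) - ((a : ℝ) + (b + 1 : ℕ) + d) / 4 = N := by
      rw [hN]
      push_cast
      ring
    rw [e1] at h1
    rw [e2] at h2
    have hζ : ContinuesTo N fun s => riemannZeta (3 * s + a + b - 1) :=
      continuesTo_of_meromorphicAt fun s =>
        MeromorphicAt.comp_analyticAt (meromorphicAt_riemannZeta _) (by fun_prop)
    refine (((continuesTo_of_meromorphicAt (F := fun _ => (c : ℂ)) fun s => by fun_prop).mul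
      (hζ.mul h3)).add (((continuesTo_of_meromorphicAt (F := fun s => s + (a : ℂ))
      fun s => by fun_prop).mul h1).add ((continuesTo_of_meromorphicAt (F := fun s => s + (b : ℂ))
      fun s => by fun_prop).mul h2))).congr fun s hs => ?_
    have hS : ∀ (f : ℝ → ℝ) (a b : ℕ), Continuous f → Summable fun p => kerTerm f a b p s :=
      fun f a b hf => summable_kerTerm hf a b (by
        have h1 := Nat.cast_nonneg (α := ℝ) a
        have h2 := Nat.cast_nonneg (α := ℝ) b
        linarith)
    rw [← kerSum_one_eq a b hs, kerSum, kerSum, kerSum, kerSum, ← tsum_mul_left, ← tsum_mul_left,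
      ← tsum_mul_left, ← ((hS _ _ _ hψ).mul_left _).tsum_add ((hS _ _ _ hψ).mul_left _),
      ← ((hS _ a b continuous_const).mul_left _).tsum_add
        (((hS _ _ _ hψ).mul_left _).add ((hS _ _ _ hψ).mul_left _))]
    exact tsum_congr fun p => (kerTerm_step hφ a b p s).symm

/-! #### The Dirichlet series -/

/-- By j + k ≥ √(jk) the weight is at least (jk)^(3/2), and the double sum is dominated by a product
of two series of exponent 3σ/2 > 1. -/
lemma summable_weight_rpow {σ : ℝ} (hσ : 2 / 3 < σ) :
    Summable fun p : ℕ+ × ℕ+ => (weight p : ℝ) ^ (-σ) := by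
  have h1 : Summable fun n : ℕ+ => ((n : ℕ) : ℝ) ^ (-(3 / 2 * σ)) :=
    (Real.summable_nat_rpow.mpr (by linarith)).comp_injective PNat.coe_injective
  refine Summable.of_nonneg_of_le (fun p => by positivity) (fun p => ?_)
    (h1.mul_of_nonneg h1 (fun n => by positivity) (fun n => by positivity))
  have hj : (0 : ℝ) < (p.1 : ℕ) := by exact_mod_cast p.1.pos
  have hk : (0 : ℝ) < (p.2 : ℕ) := by exact_mod_cast p.2.pos
  rw [← Real.mul_rpow hj.le hk.le]
  have hjk : (0 : ℝ) < (p.1 : ℕ) * (p.2 : ℕ) := mul_pos hj hk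
  rw [show -(3 / 2 * σ) = 3 / 2 * -σ by ring, Real.rpow_mul hjk.le]
  refine Real.rpow_le_rpow_of_nonpos (by positivity) ?_ (by linarith)
  rw [show (3 / 2 : ℝ) = 1 + 1 / 2 by norm_num, Real.rpow_add hjk, Real.rpow_one,
    ← Real.sqrt_eq_rpow, weight]
  push_cast
  gcongr
  rw [Real.sqrt_le_left (by positivity)]
  nlinarith

lemma one_le_weight (p : ℕ+ × ℕ+) : 1 ≤ weight p := by
  have h1 := p.1.pos
  have h2 := p.2.pos
  exact Nat.succ_le_of_lt (by unfold weight; positivity)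

lemma norm_weight_cpow (p : ℕ+ × ℕ+) (s : ℂ) :
    ‖(weight p : ℂ) ^ (-s)‖ = (weight p : ℝ) ^ (-s.re) := by
  have : (0 : ℝ) < weight p := by exact_mod_cast one_le_weight p
  rw [show (weight p : ℂ) = ((weight p : ℝ) : ℂ) by simp,
    Complex.norm_cpow_eq_rpow_re_of_pos this, Complex.neg_re]

lemma summable_weight_cpow {s : ℂ} (hs : 2 / 3 < s.re) :
    Summable fun p : ℕ+ × ℕ+ => (weight p : ℂ) ^ (-s) :=
  Summable.of_norm (by simpa only [norm_weight_cpow] using summable_weight_rpow hs)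

lemma differentiableOn_dirichlet :
    DifferentiableOn ℂ (fun s => ∑' p : ℕ+ × ℕ+, (weight p : ℂ) ^ (-s)) {s : ℂ | 2 / 3 < s.re} := by
  intro s hs
  obtain ⟨σ, h1, h2⟩ := exists_between (show 2 / 3 < s.re from hs)
  have hd : DifferentiableOn ℂ (fun s => ∑' p : ℕ+ × ℕ+, (weight p : ℂ) ^ (-s)) {s : ℂ | σ < s.re} := by
    refine Complex.differentiableOn_tsum_of_summable_norm (summable_weight_rpow h1) (fun p => ?_)
      (isOpen_halfPlane σ) fun p t ht => ?_
    · have : (weight p : ℂ) ≠ 0 := by exact_mod_cast (Nat.pos_of_ne_zero (Nat.one_le_iff_ne_zero.mp (one_le_weight p))).ne'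
      exact fun t _ => (DifferentiableAt.const_cpow (by fun_prop)
        (Or.inl this)).differentiableWithinAt
    · rw [norm_weight_cpow]
      exact Real.rpow_le_rpow_of_exponent_le (by exact_mod_cast one_le_weight p)
        (neg_le_neg (le_of_lt ht))
  exact (hd.differentiableAt ((isOpen_halfPlane σ).mem_nhds h2)).differentiableWithinAt

/-- `trapezoid_one` on each unit interval of the symmetrised series: the integrals give the constant
weight 2, and the first-order error gives the weight 2r - 1 against the derivative of the kernel,
which brings the factor -s and one unit of `a` or `b`. -/
lemma dirichlet_eq_kerSum {s : ℂ} (hs : 2 < s.re) :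
    2 * kerSum (fun _ => 1) 0 0 s + -s * (kerSum (fun r => 2 * r - 1) 1 0 s +
      kerSum (fun r => 2 * r - 1) 0 1 s) = ∑' p : ℕ+ × ℕ+, (weight p : ℂ) ^ (-s) := by
  have hsum := (summable_weight_cpow (s := s) (by linarith)).hasSum
  have h1 := hasSum_of_symm (f := fun j k => ((j * k * (j + k) : ℕ) : ℂ) ^ (-s))
    (fun j k => by rw [mul_comm j k, add_comm j k]) hsum
  have hS : ∀ (f : ℝ → ℝ) (a b : ℕ), Continuous f → Summable fun p => kerTerm f a b p s :=
    fun f a b hf => summable_kerTerm hf a b (by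
      have h1 := Nat.cast_nonneg (α := ℝ) a
      have h2 := Nat.cast_nonneg (α := ℝ) b
      linarith)
  have hc : Continuous fun r : ℝ => 2 * r - 1 := by fun_prop
  rw [← h1.tsum_eq, kerSum, kerSum, kerSum, ← (hS _ 1 0 hc).tsum_add (hS _ 0 1 hc),
    ← tsum_mul_left, ← tsum_mul_left, ← ((hS _ 0 0 continuous_const).mul_left _).tsum_add
      (((hS _ 1 0 hc).add (hS _ 0 1 hc)).mul_left _)]
  refine tsum_congr fun p => ?_
  have hj : (0 : ℝ) < p.1 + 1 := by positivity
  have hi : (0 : ℝ) < p.1 + 1 + p.2 := by positivity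
  have hk : ∀ a b : ℕ, ContinuousOn (fun r => ker a b s (p.1 + 1) (p.1 + 1 + p.2 + r)) (Icc 0 1) :=
    fun a b => continuousOn_ker hj hi
  have key := trapezoid_one (g := fun r => ker 0 0 s (p.1 + 1) (p.1 + 1 + p.2 + r))
    (fun r hr => (hasDerivAt_ker (a := 0) (b := 0) (s := s) hj
      (by linarith [hr.1] : 0 < (p.1 : ℝ) + 1 + p.2 + r)).comp_const_add _ r)
    (((continuousOn_const.mul (hk 1 0)).add (continuousOn_const.mul (hk 0 1))).neg)
  have hint : ∀ (a b : ℕ), IntervalIntegrable (fun r => ((2 * r - 1 : ℝ) : ℂ) *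
      ker a b s (p.1 + 1) (p.1 + 1 + p.2 + r)) volume 0 1 := fun a b =>
    ContinuousOn.intervalIntegrable (by
      rw [uIcc_of_le zero_le_one]
      exact (by fun_prop : Continuous fun r : ℝ => ((2 * r - 1 : ℝ) : ℂ)).continuousOn.mul (hk a b))
  have hker : ∀ m n : ℕ, 0 < m → 0 < n →
      ker 0 0 s m n = ((m * n * (m + n) : ℕ) : ℂ) ^ (-s) := fun m n hm hn => by
    have h1 : (0 : ℝ) ≤ m := by positivity
    have h2 : (0 : ℝ) ≤ n := by positivity
    simp only [ker, Nat.cast_zero, sub_zero]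
    rw [← Complex.mul_cpow_ofReal_nonneg h1 h2, ← Complex.ofReal_mul,
      ← Complex.mul_cpow_ofReal_nonneg (by positivity) (by positivity)]
    push_cast
    rfl
  have e0 := hker (p.1 + 1) (p.1 + 1 + p.2) (by omega) (by omega)
  have e1 := hker (p.1 + 1) (p.1 + 1 + (p.2 + 1)) (by omega) (by omega)
  rw [← e0, ← e1]
  simp only [add_zero] at key
  push_cast at key ⊢
  simp only [kerTerm]
  rw [← add_assoc ((p.1 : ℝ) + 1), key, ← intervalIntegral.integral_add
    (hint 1 0) (hint 0 1), ← intervalIntegral.integral_const_mul (-s)]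
  refine congrArg₂ (· + ·) (by simp) ?_
  refine intervalIntegral.integral_congr fun r _ => ?_
  simp
  ring

theorem isContinuation_omega : IsContinuation omega := by
  refine Classical.epsilon_spec (p := IsContinuation) ?_
  obtain ⟨W, hW, hWD⟩ := exists_meromorphicNFOn_univ differentiableOn_dirichlet fun N => by
    -- Each step of the induction moves the half-plane by 1/4, starting from Re s > 2.
    obtain ⟨d, hd⟩ := exists_nat_ge (4 * (2 - N))
    have hdN : ∀ n : ℝ, 0 ≤ n → 2 - (n + d) / 4 ≤ N := fun n hn => by linarith
    have mono : ∀ {M : ℝ} {F : ℂ → ℂ}, M ≤ N → ContinuesTo M F → ContinuesTo N F := by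
      rintro M F hM ⟨g, hg, hgF⟩
      exact ⟨g, fun s hs => hg s (hM.trans_lt hs), hgF⟩
    have h0 := mono (hdN _ (by positivity)) (continuesTo_kerSum d (fun _ => 1) 0 0 continuous_const)
    have h1 := mono (hdN _ (by positivity))
      (continuesTo_kerSum d (fun r => 2 * r - 1) 1 0 (by fun_prop))
    have h2 := mono (hdN _ (by positivity))
      (continuesTo_kerSum d (fun r => 2 * r - 1) 0 1 (by fun_prop))
    exact (((continuesTo_of_meromorphicAt (F := fun _ => (2 : ℂ)) fun s => by fun_prop).mul h0).add
      ((continuesTo_of_meromorphicAt (F := fun s => -s) fun s => by fun_prop).mul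
        (h1.add h2))).congr fun s hs => dirichlet_eq_kerSum hs
  exact ⟨W, hW, fun s hs => by
    rw [hWD s hs]
    exact (summable_weight_cpow hs).hasSum⟩

/-! ### Euler-Maclaurin summation on a half-line -/

/-- `trapezoid_four` summed over unit intervals: interior values occur twice, g(a) once, and the
corrections in `g1` telescope. The bound with `K` only secures convergence and is asked for u ≥ 1
because `a` may be 0; the error is measured by `M` alone. -/
lemma euler_maclaurin {g g1 g2 g3 g4 : ℝ → ℂ} {a : ℝ} (ha : 0 ≤ a)
    (hg : ∀ u, a ≤ u → HasDerivAt g (g1 u) u) (hg1 : ∀ u, a ≤ u → HasDerivAt g1 (g2 u) u)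
    (hg2 : ∀ u, a ≤ u → HasDerivAt g2 (g3 u) u) (hg3 : ∀ u, a ≤ u → HasDerivAt g3 (g4 u) u)
    (hg4 : ContinuousOn g4 (Ici a)) {K : ℝ}
    (hK : ∀ u, a ≤ u → 1 ≤ u → ‖g u‖ ≤ K * u ^ (-2 : ℝ) ∧ ‖g1 u‖ ≤ K * u ^ (-2 : ℝ))
    {M : ℕ → ℝ} (hM : ∀ l : ℕ, ∀ u, a + l ≤ u → ‖g4 u‖ ≤ M l) (hMs : Summable M) :
    IntegrableOn g (Ioi a) ∧ Summable (fun l : ℕ => g (a + l)) ∧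
    ‖2 * ∑' l : ℕ, g (a + l) - g a - 2 * (∫ u in Ioi a, g u) + g1 a / 6‖ ≤ ∑' l, M l := by
  have hgc : ContinuousOn g (Ici a) := fun u hu => (hg u hu).continuousAt.continuousWithinAt
  have hK0 : 0 ≤ K := by
    have h1 := (norm_nonneg _).trans (hK (a + 1) (by linarith) (by linarith)).1
    exact nonneg_of_mul_nonneg_left h1 (by positivity)
  have hint : IntegrableOn g (Ioi a) := by
    rw [← Ioc_union_Ioi_eq_Ioi (show a ≤ a + 1 by linarith)]
    refine IntegrableOn.union ?_ ?_
    · exact ((hgc.mono Icc_subset_Ici_self).integrableOn_Icc).mono_set Ioc_subset_Icc_self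
    · refine Integrable.mono' ((integrableOn_Ioi_rpow_of_lt (a := -2) (by norm_num)
        (show 0 < a + 1 by linarith)).const_mul K) ?_ ?_
      · exact (hgc.mono fun u hu => by
          have : a + 1 < u := hu
          exact mem_Ici.mpr (by linarith)).aestronglyMeasurable measurableSet_Ioi
      · exact (ae_restrict_mem measurableSet_Ioi).mono fun u hu => by
          have : a + 1 < u := hu
          exact (hK u (by linarith) (by linarith)).1
  have hsum : Summable fun l : ℕ => g (a + l) := by
    rw [← summable_nat_add_iff 1]
    refine Summable.of_norm_bounded ((summable_succ_rpow (c := 2) (by norm_num)).mul_left K)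
      fun l => ?_
    have hl : (0 : ℝ) < (l : ℝ) + 1 := by positivity
    push_cast
    refine (hK _ (by linarith) (by linarith [Nat.cast_nonneg (α := ℝ) l])).1.trans ?_
    exact mul_le_mul_of_nonneg_left (Real.rpow_le_rpow_of_nonpos hl (by linarith) (by norm_num)) hK0
  refine ⟨hint, hsum, ?_⟩
  have hlim : Tendsto (fun l : ℕ => g1 (a + l)) atTop (𝓝 0) := by
    rw [← tendsto_add_atTop_iff_nat 1]
    refine squeeze_zero_norm (a := fun l : ℕ => K * ((l : ℝ) + 1) ^ (-2 : ℝ)) (fun l => ?_) ?_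
    · have hl : (0 : ℝ) < (l : ℝ) + 1 := by positivity
      push_cast
      refine (hK _ (by linarith) (by linarith [Nat.cast_nonneg (α := ℝ) l])).2.trans ?_
      exact mul_le_mul_of_nonneg_left
        (Real.rpow_le_rpow_of_nonpos hl (by linarith) (by norm_num)) hK0
    · simpa using ((summable_succ_rpow (c := 2) (by norm_num)).tendsto_atTop_zero).const_mul K
  have hloc : ∀ l : ℕ, ‖g (a + l) + g (a + (l + 1 : ℕ)) - 2 * (∫ r in (0 : ℝ)..1, g (a + l + r)) -
      (g1 (a + (l + 1 : ℕ)) - g1 (a + l)) / 6‖ ≤ M l := by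
    intro l
    have hl := Nat.cast_nonneg (α := ℝ) l
    have := trapezoid_four (g := fun r => g (a + l + r)) (g1 := fun r => g1 (a + l + r))
      (g2 := fun r => g2 (a + l + r)) (g3 := fun r => g3 (a + l + r))
      (g4 := fun r => g4 (a + l + r)) (M := M l)
      (fun r hr => (hg _ (by linarith [hr.1])).comp_const_add _ r)
      (fun r hr => (hg1 _ (by linarith [hr.1])).comp_const_add _ r)
      (fun r hr => (hg2 _ (by linarith [hr.1])).comp_const_add _ r)
      (fun r hr => (hg3 _ (by linarith [hr.1])).comp_const_add _ r)
      (hg4.comp (by fun_prop) fun r hr => mem_Ici.mpr (by linarith [hr.1]))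
      (fun r hr => hM l _ (by linarith [hr.1]))
    simp only [add_zero] at this
    push_cast
    rwa [← add_assoc a]
  have hI := hasSum_integral_unit hint
  have hs1 := (summable_nat_add_iff 1).mpr hsum
  have hT : HasSum (fun l : ℕ => (g1 (a + (l + 1 : ℕ)) - g1 (a + l)) / 6) ((0 - g1 a) / 6) := by
    have h0 : Summable fun l : ℕ => (g1 (a + (l + 1 : ℕ)) - g1 (a + l)) / 6 := by
      have h1 : Summable fun l : ℕ =>
          g (a + l) + g (a + (l + 1 : ℕ)) - 2 * (∫ r in (0 : ℝ)..1, g (a + l + r)) -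
          (g1 (a + (l + 1 : ℕ)) - g1 (a + l)) / 6 := Summable.of_norm_bounded hMs hloc
      have h2 := ((hsum.add hs1).sub (hI.summable.mul_left 2)).sub h1
      refine h2.congr fun l => ?_
      ring
    refine (h0.hasSum_iff_tendsto_nat).mpr ?_
    simp_rw [← Finset.sum_div, Finset.sum_range_sub (fun l : ℕ => g1 (a + l))]
    simpa using (hlim.sub_const (g1 a)).div_const 6
  have hall := ((hsum.hasSum.add hs1.hasSum).sub (hI.mul_left 2)).sub hT
  have hle := tsum_of_norm_bounded hMs.hasSum hloc
  rw [hall.tsum_eq] at hle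
  refine le_trans (le_of_eq ?_) hle
  congr 1
  have := hsum.tsum_eq_zero_add
  simp only [Nat.cast_zero, add_zero] at this
  linear_combination this

/-- Polynomials are absorbed by exponentials. -/
lemma exists_pow_mul_exp_le (n : ℕ) {p : ℝ} (hp : 0 ≤ p) :
    ∃ K : ℝ, 0 < K ∧ ∀ q : ℝ, 0 ≤ q → (1 + q) ^ n * Real.exp (-q / 4) ≤ K * (1 + q) ^ (-p) := by
  set m : ℝ := n + p + 1
  have hm : 0 < m := by positivity
  refine ⟨(4 * m) ^ m * Real.exp (1 / 4), by positivity, fun q hq => ?_⟩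
  have hq1 : 1 ≤ 1 + q := by linarith
  have h1 : ((1 + q) / (4 * m)) ^ m ≤ Real.exp ((1 + q) / 4) := by
    have := Real.rpow_le_rpow (by positivity)
      ((le_add_of_nonneg_right zero_le_one).trans (Real.add_one_le_exp ((1 + q) / (4 * m)))) hm.le
    rw [← Real.exp_mul] at this
    refine this.trans_eq ?_
    congr 1
    field_simp
  have h2 : (1 + q) ^ m ≤ (4 * m) ^ m * Real.exp ((1 + q) / 4) := by
    rw [Real.div_rpow (by linarith) (by positivity), div_le_iff₀ (by positivity)] at h1
    linarith
  have h3 : (1 + q) ^ n * (1 + q) ^ p ≤ (1 + q) ^ m := by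
    rw [← Real.rpow_natCast, ← Real.rpow_add (by linarith)]
    exact Real.rpow_le_rpow_of_exponent_le hq1 (by simp [m])
  have h4 : Real.exp ((1 + q) / 4) * Real.exp (-q / 4) = Real.exp (1 / 4) := by
    rw [← Real.exp_add]
    ring_nf
  rw [Real.rpow_neg (by linarith), ← div_eq_mul_inv, le_div_iff₀ (by positivity)]
  calc (1 + q) ^ n * Real.exp (-q / 4) * (1 + q) ^ p
      = (1 + q) ^ n * (1 + q) ^ p * Real.exp (-q / 4) := by ring
    _ ≤ (4 * m) ^ m * Real.exp ((1 + q) / 4) * Real.exp (-q / 4) := by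
        exact mul_le_mul_of_nonneg_right (h3.trans h2) (Real.exp_nonneg _)
    _ = _ := by rw [mul_assoc, h4]

/-! ### A sector in the right half-plane -/

/-- The sector `|z| ≤ 4 Re z` without its vertex. -/
def InSector (z : ℂ) : Prop := 0 < z.re ∧ ‖z‖ ≤ 4 * z.re

lemma InSector.ne_zero {z : ℂ} (hz : InSector z) : z ≠ 0 := fun h0 => by
  have := hz.1
  simp [h0] at this

lemma InSector.norm_pos {z : ℂ} (hz : InSector z) : 0 < ‖z‖ := norm_pos_iff.mpr hz.ne_zero

lemma InSector.real_mul {z : ℂ} (hz : InSector z) {r : ℝ} (hr : 0 < r) : InSector (r * z) := by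
  refine ⟨by simpa using mul_pos hr hz.1, ?_⟩
  rw [norm_mul, Complex.norm_real, Real.norm_of_nonneg hr.le, Complex.re_ofReal_mul]
  nlinarith [hz.2]

lemma inSector_ofReal {r : ℝ} (hr : 0 < r) : InSector (r : ℂ) := by
  refine ⟨by simpa using hr, ?_⟩
  rw [Complex.norm_real, Real.norm_of_nonneg hr.le, Complex.ofReal_re]
  linarith

/-- Stated with the vertex z = 0 included, because the Euler-Maclaurin sums over cubes start at u =
0. -/
lemma norm_exp_neg_le {z : ℂ} (hz : ‖z‖ ≤ 4 * z.re) :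
    ‖Complex.exp (-z)‖ ≤ Real.exp (-‖z‖ / 4) := by
  rw [Complex.norm_exp, Complex.neg_re]
  exact Real.exp_le_exp.mpr (by linarith)

/-- A polynomial in `|z|` times `exp (-z)`. -/
lemma exists_norm_exp_le (n : ℕ) {p : ℝ} (hp : 0 ≤ p) :
    ∃ K : ℝ, 0 < K ∧ ∀ z : ℂ, ‖z‖ ≤ 4 * z.re →
      (1 + ‖z‖) ^ n * ‖Complex.exp (-z)‖ ≤ K * (1 + ‖z‖) ^ (-p) := by
  obtain ⟨K, hK, h⟩ := exists_pow_mul_exp_le n hp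
  exact ⟨K, hK, fun z hz => (mul_le_mul_of_nonneg_left (norm_exp_neg_le hz) (by positivity)).trans
    (h _ (norm_nonneg z))⟩

lemma exists_norm_exp_le' (n : ℕ) {p : ℝ} (hp : 0 ≤ p) :
    ∃ K : ℝ, 0 < K ∧ ∀ z : ℂ, InSector z →
      (1 + ‖z‖) ^ n * ‖Complex.exp (-z)‖ ≤ K * ‖z‖ ^ (-p) := by
  obtain ⟨K, hK, h⟩ := exists_norm_exp_le n hp
  exact ⟨K, hK, fun z hz => (h z hz.2).trans (mul_le_mul_of_nonneg_left
    (Real.rpow_le_rpow_of_nonpos hz.norm_pos (by linarith) (by linarith)) hK.le)⟩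

/-! ### The Gamma integral with a complex scale -/

lemma ofReal_mul_cpow {r : ℝ} (hr : 0 < r) {z : ℂ} (hz : z ≠ 0) (s : ℂ) :
    ((r : ℂ) * z) ^ s = (r : ℂ) ^ s * z ^ s := by
  have hr' : (r : ℂ) ≠ 0 := by exact_mod_cast hr.ne'
  rw [Complex.cpow_def_of_ne_zero (mul_ne_zero hr' hz), Complex.cpow_def_of_ne_zero hr',
    Complex.cpow_def_of_ne_zero hz, Complex.log_ofReal_mul hr hz, add_mul, Complex.exp_add,
    Complex.ofReal_log hr.le]

lemma integrableOn_rpow_mul_exp {σ ε : ℝ} (hσ : -1 < σ) (hε : 0 < ε) :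
    IntegrableOn (fun t : ℝ => t ^ σ * Real.exp (-ε * t)) (Ioi 0) := by
  have := integrableOn_rpow_mul_exp_neg_mul_rpow (p := 1) hσ one_pos hε
  simpa using this

lemma norm_cpow_mul_exp {s ξ : ℂ} {t : ℝ} (ht : 0 < t) :
    ‖(t : ℂ) ^ (s - 1) * Complex.exp (-(ξ * t))‖ = t ^ (s.re - 1) * Real.exp (-ξ.re * t) := by
  rw [norm_mul, Complex.norm_cpow_eq_rpow_re_of_pos ht, Complex.norm_exp]
  simp

lemma continuousOn_cpow_mul_exp (s ξ : ℂ) :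
    ContinuousOn (fun t : ℝ => (t : ℂ) ^ (s - 1) * Complex.exp (-(ξ * t))) (Ioi 0) := by
  refine ContinuousOn.mul (fun t ht => ?_) (by fun_prop)
  exact (Complex.continuousAt_ofReal_cpow_const t _ (Or.inr (ne_of_gt ht))).continuousWithinAt

lemma integrableOn_cpow_mul_exp {s ξ : ℂ} (hs : 0 < s.re) (hξ : 0 < ξ.re) :
    IntegrableOn (fun t : ℝ => (t : ℂ) ^ (s - 1) * Complex.exp (-(ξ * t))) (Ioi 0) := by
  refine Integrable.mono' (integrableOn_rpow_mul_exp (σ := s.re - 1) (by linarith) hξ)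
    ((continuousOn_cpow_mul_exp s ξ).aestronglyMeasurable measurableSet_Ioi) ?_
  exact (ae_restrict_mem measurableSet_Ioi).mono fun t ht => (norm_cpow_mul_exp ht).le

/-- Both sides are holomorphic in ξ on the right half-plane and agree for real ξ > 0 by the usual
Gamma integral; the identity theorem is applied along 1 + 1/(n + 1) → 1. -/
lemma mellin_exp_neg_mul {s ξ : ℂ} (hs : 0 < s.re) (hξ : 0 < ξ.re) :
    ∫ t in Ioi (0 : ℝ), (t : ℂ) ^ (s - 1) * Complex.exp (-(ξ * t)) =
      Complex.Gamma s * ξ ^ (-s) := by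
  set U : Set ℂ := {z | 0 < z.re} with hU
  have hd : DifferentiableOn ℂ
      (fun ξ : ℂ => ∫ t in Ioi (0 : ℝ), (t : ℂ) ^ (s - 1) * Complex.exp (-(ξ * t))) U := by
    intro ξ₀ hξ₀
    have hξ₀' : 0 < ξ₀.re := hξ₀
    have hmem : {z : ℂ | ξ₀.re / 2 < z.re} ∈ 𝓝 ξ₀ :=
      (isOpen_halfPlane _).mem_nhds (show ξ₀.re / 2 < ξ₀.re by linarith)
    have := hasDerivAt_integral_of_dominated_loc_of_deriv_le (μ := volume.restrict (Ioi (0 : ℝ)))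
      (F := fun ξ t => ((t : ℝ) : ℂ) ^ (s - 1) * Complex.exp (-(ξ * t)))
      (F' := fun ξ t => ((t : ℝ) : ℂ) ^ (s - 1) * (Complex.exp (-(ξ * t)) * -t))
      (bound := fun t => t ^ s.re * Real.exp (-(ξ₀.re / 2) * t)) hmem
      (Eventually.of_forall fun ξ =>
        (continuousOn_cpow_mul_exp s ξ).aestronglyMeasurable measurableSet_Ioi)
      (integrableOn_cpow_mul_exp hs hξ₀') ?_ ?_
      (integrableOn_rpow_mul_exp (by linarith) (by linarith)) ?_
    · exact this.2.differentiableAt.differentiableWithinAt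
    · refine ContinuousOn.aestronglyMeasurable ?_ measurableSet_Ioi
      simp_rw [← mul_assoc]
      exact (continuousOn_cpow_mul_exp s ξ₀).mul (by fun_prop)
    · refine (ae_restrict_mem measurableSet_Ioi).mono fun t ht z hz => ?_
      have ht0 : (0 : ℝ) < t := ht
      rw [← mul_assoc, norm_mul, norm_cpow_mul_exp ht0, norm_neg, Complex.norm_real,
        Real.norm_of_nonneg ht0.le, mul_right_comm, ← Real.rpow_add_one ht0.ne', sub_add_cancel]
      have : ξ₀.re / 2 < z.re := hz
      gcongr
    · refine ae_of_all _ fun t z _ => ?_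
      have h1 : HasDerivAt (fun z : ℂ => -(z * (t : ℂ))) (-(t : ℂ)) z := by
        exact ((hasDerivAt_id z).mul_const (t : ℂ)).neg.congr_deriv (by simp)
      exact h1.cexp.const_mul _
  have hd2 : DifferentiableOn ℂ (fun ξ : ℂ => Complex.Gamma s * ξ ^ (-s)) U := fun z hz =>
    ((DifferentiableAt.cpow_const differentiableAt_id (Or.inl hz)).const_mul
      _).differentiableWithinAt
  have hUo : IsOpen U := isOpen_halfPlane 0
  have hreal : ∀ r : ℝ, 0 < r → (∫ t in Ioi (0 : ℝ), (t : ℂ) ^ (s - 1) *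
      Complex.exp (-((r : ℂ) * t))) = Complex.Gamma s * (r : ℂ) ^ (-s) := fun r hr => by
    rw [Complex.integral_cpow_mul_exp_neg_mul_Ioi hs hr, mul_comm, one_div, Complex.inv_cpow,
      Complex.cpow_neg]
    rw [Complex.arg_ofReal_of_nonneg hr.le]
    exact Real.pi_pos.ne
  refine (hd.analyticOnNhd hUo).eqOn_of_preconnected_of_frequently_eq (hd2.analyticOnNhd hUo)
    (isPreconnected_halfPlane 0) (z₀ := 1) (by simp [hU]) ?_ hξ
  have htend : Tendsto (fun n : ℕ => ((1 + 1 / ((n : ℝ) + 1) : ℝ) : ℂ)) atTop (𝓝[≠] 1) := by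
    refine tendsto_nhdsWithin_iff.mpr ⟨?_, Eventually.of_forall fun n => ?_⟩
    · have := (tendsto_one_div_add_atTop_nhds_zero_nat (𝕜 := ℝ)).const_add 1
      rw [add_zero] at this
      exact (Complex.continuous_ofReal.tendsto 1).comp this
    · have : (0 : ℝ) < 1 / ((n : ℝ) + 1) := by positivity
      intro h0
      have h1 : (1 : ℝ) + 1 / ((n : ℝ) + 1) = 1 :=
        Complex.ofReal_injective ((mem_singleton_iff.mp h0).trans Complex.ofReal_one.symm)
      linarith
  exact htend.frequently (Eventually.of_forall fun n => hreal _ (by positivity)).frequently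

lemma integral_mul_exp_neg_cube {ξ : ℂ} (hξ : 0 < ξ.re) :
    ∫ u in Ioi (0 : ℝ), (u : ℂ) * Complex.exp (-((u : ℂ) ^ 3 * ξ)) =
      Complex.Gamma (2 / 3) / 3 * ξ ^ (-(2 / 3) : ℂ) := by
  have h1 := mellin_comp_rpow (fun t : ℝ => Complex.exp (-(ξ * t))) 2 3
  have h2 : mellin (fun t : ℝ => Complex.exp (-(ξ * t))) (2 / (3 : ℝ)) =
      Complex.Gamma (2 / 3) * ξ ^ (-(2 / 3) : ℂ) := by
    simp only [mellin, smul_eq_mul]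
    have e : (2 / ((3 : ℝ) : ℂ)) = 2 / 3 := by norm_num
    rw [e]
    exact mellin_exp_neg_mul (by norm_num) hξ
  rw [h2] at h1
  simp only [mellin, smul_eq_mul] at h1
  rw [← setIntegral_congr_fun (f := fun t : ℝ => (t : ℂ) ^ ((2 : ℂ) - 1) *
    Complex.exp (-(ξ * ((t ^ (3 : ℝ) : ℝ) : ℂ)))) measurableSet_Ioi, h1]
  · rw [Complex.real_smul, abs_of_pos (by norm_num)]
    push_cast
    ring
  · intro t _
    simp only
    norm_num
    left
    congr 1
    rw [mul_comm]

/-! ### The sum `∑ j exp (-j ^ 3 ξ)` -/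

/-- `∑_{j ≥ 1} j exp (-j ^ 3 ξ)`. -/
noncomputable def cubeSum (ξ : ℂ) : ℂ :=
  ∑' n : ℕ, ((n + 1 : ℕ) : ℂ) * Complex.exp (-(((n + 1 : ℕ) : ℂ) ^ 3 * ξ))

lemma norm_cubeSum_term (n : ℕ) (ξ : ℂ) :
    ‖((n + 1 : ℕ) : ℂ) * Complex.exp (-(((n + 1 : ℕ) : ℂ) ^ 3 * ξ))‖ =
      ((n : ℝ) + 1) * Real.exp (-(((n : ℝ) + 1) ^ 3 * ξ.re)) := by
  rw [norm_mul, Complex.norm_natCast, Complex.norm_exp]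
  have : (((n + 1 : ℕ) : ℂ) ^ 3 * ξ).re = ((n : ℝ) + 1) ^ 3 * ξ.re := by
    rw [show ((n + 1 : ℕ) : ℂ) ^ 3 = ((((n : ℝ) + 1) ^ 3 : ℝ) : ℂ) by push_cast; ring,
      Complex.re_ofReal_mul]
  rw [Complex.neg_re, this]
  push_cast
  rfl

/-- The terms decay like any power. -/
lemma exists_cubeSum_term_le (m : ℕ) : ∃ K : ℝ, 0 < K ∧ ∀ (n : ℕ) (ξ : ℂ), 0 < ξ.re →
    ‖((n + 1 : ℕ) : ℂ) * Complex.exp (-(((n + 1 : ℕ) : ℂ) ^ 3 * ξ))‖ ≤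
      K * ξ.re ^ (-((m : ℝ) + 1)) * ((n : ℝ) + 1) ^ (-2 : ℝ) := by
  obtain ⟨K, hK, h⟩ := exists_pow_mul_exp_le 0 (p := m + 1) (by positivity)
  refine ⟨K * 4 ^ (-((m : ℝ) + 1)), by positivity, fun n ξ hξ => ?_⟩
  have hn : (0 : ℝ) < (n : ℝ) + 1 := by positivity
  have hn1 : (1 : ℝ) ≤ (n : ℝ) + 1 := by linarith [Nat.cast_nonneg (α := ℝ) n]
  rw [norm_cubeSum_term]
  have h1 := h (4 * (((n : ℝ) + 1) ^ 3 * ξ.re)) (by positivity)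
  rw [pow_zero, one_mul, neg_div, mul_div_cancel_left₀ _ (by norm_num : (4 : ℝ) ≠ 0)] at h1
  have h2 : (1 + 4 * (((n : ℝ) + 1) ^ 3 * ξ.re)) ^ (-((m : ℝ) + 1)) ≤
      (4 * (((n : ℝ) + 1) ^ 3 * ξ.re)) ^ (-((m : ℝ) + 1)) :=
    Real.rpow_le_rpow_of_nonpos (by positivity) (by linarith) (by linarith)
  rw [Real.mul_rpow (by norm_num) (by positivity), Real.mul_rpow (by positivity) hξ.le] at h2
  have h3 : ((n : ℝ) + 1) * (((n : ℝ) + 1) ^ 3) ^ (-((m : ℝ) + 1)) ≤ ((n : ℝ) + 1) ^ (-2 : ℝ) := by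
    rw [← Real.rpow_natCast, ← Real.rpow_mul hn.le]
    nth_rewrite 1 [← Real.rpow_one ((n : ℝ) + 1)]
    rw [← Real.rpow_add hn]
    refine Real.rpow_le_rpow_of_exponent_le hn1 ?_
    push_cast
    linarith [Nat.cast_nonneg (α := ℝ) m]
  calc ((n : ℝ) + 1) * Real.exp (-(((n : ℝ) + 1) ^ 3 * ξ.re))
      ≤ ((n : ℝ) + 1) * (K * (4 ^ (-((m : ℝ) + 1)) * ((((n : ℝ) + 1) ^ 3) ^ (-((m : ℝ) + 1)) *
        ξ.re ^ (-((m : ℝ) + 1))))) := by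
        gcongr
        exact h1.trans (mul_le_mul_of_nonneg_left h2 hK.le)
    _ = K * 4 ^ (-((m : ℝ) + 1)) * ξ.re ^ (-((m : ℝ) + 1)) *
        (((n : ℝ) + 1) * (((n : ℝ) + 1) ^ 3) ^ (-((m : ℝ) + 1))) := by ring
    _ ≤ _ := by gcongr

lemma exists_norm_cubeSum_le (m : ℕ) : ∃ K : ℝ, 0 < K ∧ ∀ ξ : ℂ, 0 < ξ.re →
    ‖cubeSum ξ‖ ≤ K * ξ.re ^ (-((m : ℝ) + 1)) := by
  obtain ⟨K, hK, h⟩ := exists_cubeSum_term_le m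
  have hs := summable_succ_rpow (c := 2) (by norm_num)
  refine ⟨K * ∑' n : ℕ, ((n : ℝ) + 1) ^ (-2 : ℝ),
    mul_pos hK (hs.tsum_pos (fun n => by positivity) 0 (by positivity)), fun ξ hξ => ?_⟩
  refine (tsum_of_norm_bounded (hs.mul_left _).hasSum fun n => h n ξ hξ).trans_eq ?_
  rw [tsum_mul_left]
  ring

lemma differentiableOn_cubeSum : DifferentiableOn ℂ cubeSum {ξ | 0 < ξ.re} := by
  intro ξ hξ
  obtain ⟨ε, h1, h2⟩ := exists_between (show 0 < ξ.re from hξ)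
  obtain ⟨K, hK, h⟩ := exists_cubeSum_term_le 0
  have hd : DifferentiableOn ℂ cubeSum {ξ : ℂ | ε < ξ.re} := by
    refine Complex.differentiableOn_tsum_of_summable_norm
      ((summable_succ_rpow (c := 2) (by norm_num)).mul_left (K * ε ^ (-(((0 : ℕ) : ℝ) + 1))))
      (fun n => by fun_prop) (isOpen_halfPlane ε) fun n t ht => ?_
    have ht' : ε < t.re := ht
    refine (h n t (h1.trans ht')).trans ?_
    have : t.re ^ (-(((0 : ℕ) : ℝ) + 1)) ≤ ε ^ (-(((0 : ℕ) : ℝ) + 1)) :=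
      Real.rpow_le_rpow_of_nonpos h1 ht'.le (by norm_num)
    gcongr
  exact (hd.differentiableAt ((isOpen_halfPlane ε).mem_nhds h2)).differentiableWithinAt

/-- Termwise, n exp(-n³ y z) has Mellin transform Γ(s) z^(-s) n^(1 - 3s). The condition Re s > 2/3
makes the sum over n absolutely convergent and justifies the interchange. -/
lemma mellin_cubeSum {z s : ℂ} (hz : 0 < z.re) (hs : 2 / 3 < s.re) :
    mellin (fun y : ℝ => cubeSum (y * z)) s =
      Complex.Gamma s * z ^ (-s) * riemannZeta (3 * s - 1) := by
  have hs0 : 0 < s.re := by linarith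
  have hz0 : z ≠ 0 := fun h0 => by simp [h0] at hz
  have hre : ∀ n : ℕ, 0 < ((((n + 1 : ℕ) : ℝ) ^ 3 : ℝ) * z).re := fun n => by
    rw [Complex.re_ofReal_mul]
    positivity
  have hsum : HasSum (fun n : ℕ => ∫ t in Ioi (0 : ℝ), ((n + 1 : ℕ) : ℂ) *
      ((t : ℂ) ^ (s - 1) * Complex.exp (-(((((n + 1 : ℕ) : ℝ) ^ 3 : ℝ) * z) * t))))
      (∫ t in Ioi (0 : ℝ), ∑' n : ℕ, ((n + 1 : ℕ) : ℂ) *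
      ((t : ℂ) ^ (s - 1) * Complex.exp (-(((((n + 1 : ℕ) : ℝ) ^ 3 : ℝ) * z) * t)))) := by
    refine hasSum_integral_of_summable_integral_norm
      (fun n => (integrableOn_cpow_mul_exp hs0 (hre n)).const_mul _) ?_
    have e : ∀ n : ℕ, ∫ t in Ioi (0 : ℝ), ‖((n + 1 : ℕ) : ℂ) *
        ((t : ℂ) ^ (s - 1) * Complex.exp (-(((((n + 1 : ℕ) : ℝ) ^ 3 : ℝ) * z) * t)))‖ =
        Real.Gamma s.re * z.re ^ (-s.re) * ((n : ℝ) + 1) ^ (-(3 * s.re - 1)) := fun n => by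
      have hn : (0 : ℝ) < (n : ℝ) + 1 := by positivity
      rw [setIntegral_congr_fun (g := fun t : ℝ => ((n : ℝ) + 1) * (t ^ (s.re - 1) *
        Real.exp (-((((n + 1 : ℕ) : ℝ) ^ 3 : ℝ) * z.re * t)))) measurableSet_Ioi fun t ht => ?_]
      · have h1 := Real.integral_rpow_mul_exp_neg_mul_Ioi hs0 (hre n)
        rw [Complex.re_ofReal_mul] at h1
        rw [integral_const_mul, h1, one_div, Real.inv_rpow (by positivity),
          Real.mul_rpow (by positivity) hz.le, mul_inv, ← Real.rpow_neg (by positivity),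
          ← Real.rpow_neg hz.le, ← Real.rpow_natCast, ← Real.rpow_mul (by positivity)]
        push_cast
        rw [show -(3 * s.re - 1) = 1 + 3 * -s.re by ring, Real.rpow_add hn, Real.rpow_one]
        ring
      · simp only
        rw [norm_mul, norm_cpow_mul_exp ht, Complex.norm_natCast, Complex.re_ofReal_mul]
        push_cast
        ring_nf
    simp_rw [e]
    exact (summable_succ_rpow (by linarith)).mul_left _
  have e1 : mellin (fun y : ℝ => cubeSum (y * z)) s = ∫ t in Ioi (0 : ℝ), ∑' n : ℕ,
      ((n + 1 : ℕ) : ℂ) *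
      ((t : ℂ) ^ (s - 1) * Complex.exp (-(((((n + 1 : ℕ) : ℝ) ^ 3 : ℝ) * z) * t))) := by
    refine setIntegral_congr_fun measurableSet_Ioi fun t _ => ?_
    simp only [cubeSum, smul_eq_mul]
    rw [← tsum_mul_left]
    refine tsum_congr fun n => ?_
    push_cast
    ring_nf
  rw [e1, ← hsum.tsum_eq, zeta_eq_tsum_one_div_nat_add_one_cpow (by simp; linarith),
    ← tsum_mul_left]
  refine tsum_congr fun n => ?_
  have hn : (0 : ℝ) < ((n + 1 : ℕ) : ℝ) := by positivity
  have hn' : ((n + 1 : ℕ) : ℂ) ≠ 0 := by exact_mod_cast hn.ne'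
  rw [integral_const_mul, mellin_exp_neg_mul hs0 (hre n), ofReal_mul_cpow (by positivity) hz0]
  have e2 : ((((n + 1 : ℕ) : ℝ) ^ 3 : ℝ) : ℂ) ^ (-s) = ((n + 1 : ℕ) : ℂ) ^ (3 * -s) := by
    rw [show (3 : ℂ) * -s = ((3 : ℕ) : ℂ) * -s by norm_num, Complex.cpow_nat_mul']
    · push_cast
      rfl
    · rw [Complex.natCast_arg]
      simpa using Real.pi_pos
    · rw [Complex.natCast_arg]
      simpa using Real.pi_pos.le
  have e3 : 1 / ((n : ℂ) + 1) ^ (3 * s - 1) = ((n + 1 : ℕ) : ℂ) * ((n + 1 : ℕ) : ℂ) ^ (3 * -s) := by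
    rw [one_div, ← Complex.cpow_neg, show -(3 * s - 1) = 1 + 3 * -s by ring]
    have : (n : ℂ) + 1 = ((n + 1 : ℕ) : ℂ) := by push_cast; rfl
    rw [this, Complex.cpow_add _ _ hn', Complex.cpow_one]
  rw [e2, e3]
  ring

/-! ### Euler-Maclaurin for the sums over cubes -/

lemma hasDerivAt_mul_cexp_neg {P E : ℝ → ℂ} {P' E' : ℂ} {u : ℝ} (hP : HasDerivAt P P' u)
    (hE : HasDerivAt E E' u) :
    HasDerivAt (fun u => P u * Complex.exp (-(E u))) ((P' - E' * P u) * Complex.exp (-(E u))) u := by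
  refine (hP.mul hE.neg.cexp).congr_deriv ?_
  simp only [Pi.neg_apply]
  ring

lemma hasDerivAt_monomial (c : ℂ) (n : ℕ) (u : ℝ) :
    HasDerivAt (fun u : ℝ => c * (u : ℂ) ^ n) (c * (n * (u : ℂ) ^ (n - 1))) u := by
  have h1 : HasDerivAt (fun x : ℂ => c * x ^ n) (c * (n * (u : ℂ) ^ (n - 1))) (u : ℂ) :=
    (hasDerivAt_pow n (u : ℂ)).const_mul c
  exact h1.comp_ofReal

lemma norm_cube_mul_le {z : ℂ} (hz : InSector z) {u : ℝ} (hu : 0 ≤ u) :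
    ‖(u : ℂ) ^ 3 * z‖ ≤ 4 * ((u : ℂ) ^ 3 * z).re := by
  rw [← Complex.ofReal_pow, norm_mul, Complex.norm_real, Complex.re_ofReal_mul,
    Real.norm_of_nonneg (by positivity)]
  nlinarith [hz.2, pow_nonneg hu 3]

lemma norm_cube_mul (z : ℂ) {u : ℝ} (hu : 0 ≤ u) : ‖(u : ℂ) ^ 3 * z‖ = u ^ 3 * ‖z‖ := by
  rw [← Complex.ofReal_pow, norm_mul, Complex.norm_real, Real.norm_of_nonneg (by positivity)]

lemma norm_mul_succ_cube_le {z : ℂ} (hz : ‖z‖ ≤ 1) {u : ℝ} (hu : 0 ≤ u) :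
    ‖z‖ * (1 + u) ^ 3 ≤ 4 * (1 + ‖(u : ℂ) ^ 3 * z‖) := by
  rw [norm_cube_mul z hu]
  have h1 : (1 + u) ^ 3 ≤ 4 * (1 + u ^ 3) := by nlinarith [sq_nonneg (u - 1), mul_nonneg hu (sq_nonneg (u - 1))]
  nlinarith [norm_nonneg z]

lemma norm_poly_three_le {c₀ c₁ c₂ c₃ C : ℝ} {w : ℂ} (h0 : |c₀| ≤ C) (h1 : |c₁| ≤ C) (h2 : |c₂| ≤ C)
    (h3 : |c₃| ≤ C) : ‖(c₀ : ℂ) + c₁ * w + c₂ * w ^ 2 + c₃ * w ^ 3‖ ≤ C * (1 + ‖w‖) ^ 3 := by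
  have hw := norm_nonneg w
  have e : ∀ (c : ℝ) (n : ℕ), |c| ≤ C → ‖(c : ℂ) * w ^ n‖ ≤ C * ‖w‖ ^ n := fun c n hc => by
    rw [norm_mul, Complex.norm_real, norm_pow]
    exact mul_le_mul_of_nonneg_right hc (by positivity)
  have k0 : ‖(c₀ : ℂ)‖ ≤ C := by simpa using h0
  have k1 := e c₁ 1 h1
  have k2 := e c₂ 2 h2
  have k3 := e c₃ 3 h3
  rw [pow_one] at k1
  have hC : 0 ≤ C := (abs_nonneg _).trans h0
  refine (norm_add_le _ _).trans ((add_le_add ((norm_add_le _ _).trans (add_le_add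
    ((norm_add_le _ _).trans (add_le_add k0 k1)) k2)) k3).trans ?_)
  nlinarith [mul_nonneg hC hw, mul_nonneg hC (pow_nonneg hw 2)]

/-- The leading behaviour of `cubeSum` near the vertex of the sector. -/
lemma exists_cubeSum_sub_le : ∃ K : ℝ, 0 < K ∧ ∀ ξ : ℂ, InSector ξ → ‖ξ‖ ≤ 1 →
    ‖cubeSum ξ - Complex.Gamma (2 / 3) / 3 * ξ ^ (-(2 / 3) : ℂ) + 1 / 12‖ ≤ K * ‖ξ‖ ^ (3 / 5 : ℝ) := by
  obtain ⟨K₁, hK₁, h₁⟩ := exists_norm_exp_le' 0 (p := 1) (by norm_num)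
  obtain ⟨K₂, hK₂, h₂⟩ := exists_norm_exp_le' 1 (p := 1) (by norm_num)
  -- Decay of order p turns the error into |ξ|^(1 - p) ∑ (l + 1)^(-3p). Convergence needs p > 1/3,
  -- and the later integral of y^(1 - p) y^(-3/2) at 0 needs p < 1/2; 2/5 lies between.
  obtain ⟨K₃, hK₃, h₃⟩ := exists_norm_exp_le 3 (p := 2 / 5) (by norm_num)
  have hs := summable_succ_rpow (c := 6 / 5) (by norm_num)
  have hspos : 0 < ∑' l : ℕ, ((l : ℝ) + 1) ^ (-(6 / 5) : ℝ) :=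
    hs.tsum_pos (fun n => by positivity) 0 (by positivity)
  refine ⟨432 * K₃ * 4 ^ (2 / 5 : ℝ) * ∑' l : ℕ, ((l : ℝ) + 1) ^ (-(6 / 5) : ℝ), by positivity,
    fun ξ hξ hξ1 => ?_⟩
  have hpos := hξ.norm_pos
  have hE : ∀ u : ℝ, HasDerivAt (fun u : ℝ => (u : ℂ) ^ 3 * ξ) (3 * (u : ℂ) ^ 2 * ξ) u := fun u =>
    ((hasDerivAt_monomial 1 3 u).mul_const ξ).congr_deriv (by norm_num) |>.congr_of_eventuallyEq
      (Eventually.of_forall fun v => by simp)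
  have hu1 : ∀ u : ℝ, 1 ≤ u → InSector ((u : ℂ) ^ 3 * ξ) := fun u hu => by
    rw [← Complex.ofReal_pow]
    exact hξ.real_mul (by positivity)
  have hm := hasDerivAt_monomial
  have EM := euler_maclaurin (a := 0) (le_refl 0)
    (g := fun u : ℝ => (1 * (u : ℂ) ^ 1) * Complex.exp (-((u : ℂ) ^ 3 * ξ)))
    (g1 := fun u : ℝ => (1 + -3 * ξ * (u : ℂ) ^ 3) * Complex.exp (-((u : ℂ) ^ 3 * ξ)))
    (g2 := fun u : ℝ => (9 * ξ ^ 2 * (u : ℂ) ^ 5 + -12 * ξ * (u : ℂ) ^ 2) *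
      Complex.exp (-((u : ℂ) ^ 3 * ξ)))
    (g3 := fun u : ℝ => (81 * ξ ^ 2 * (u : ℂ) ^ 4 + -24 * ξ * (u : ℂ) ^ 1 +
      -27 * ξ ^ 3 * (u : ℂ) ^ 7) * Complex.exp (-((u : ℂ) ^ 3 * ξ)))
    (g4 := fun u : ℝ => ξ * (((-24 : ℝ) : ℂ) + ((396 : ℝ) : ℂ) * ((u : ℂ) ^ 3 * ξ) +
      ((-432 : ℝ) : ℂ) * ((u : ℂ) ^ 3 * ξ) ^ 2 + ((81 : ℝ) : ℂ) * ((u : ℂ) ^ 3 * ξ) ^ 3) *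
      Complex.exp (-((u : ℂ) ^ 3 * ξ)))
    (K := ‖ξ‖ ^ (-1 : ℝ) * (K₁ + 3 * K₂))
    (M := fun l => 432 * K₃ * 4 ^ (2 / 5 : ℝ) * ‖ξ‖ ^ (3 / 5 : ℝ) *
      ((l : ℝ) + 1) ^ (-(6 / 5) : ℝ))
    (fun u _ => (hasDerivAt_mul_cexp_neg (hm _ _ u) (hE u)).congr_deriv (by push_cast; ring))
    (fun u _ => (hasDerivAt_mul_cexp_neg ((hm _ _ u).const_add 1) (hE u)).congr_deriv
      (by push_cast; ring))
    (fun u _ => (hasDerivAt_mul_cexp_neg ((hm _ _ u).add (hm _ _ u)) (hE u)).congr_deriv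
      (by simp only [Pi.add_apply]; push_cast; ring))
    (fun u _ => (hasDerivAt_mul_cexp_neg (((hm _ _ u).add (hm _ _ u)).add (hm _ _ u))
      (hE u)).congr_deriv (by simp only [Pi.add_apply]; push_cast; ring))
    (by fun_prop) ?_ ?_ (hs.mul_left _)
  · obtain ⟨-, hsum, hle⟩ := EM
    rw [tsum_mul_left] at hle
    -- The term l = 0 vanishes, so the sum from 0 is `cubeSum`. The boundary value g1(0) = 1 gives
    -- 1/6, which becomes 1/12 after halving.
    have hV : ∑' l : ℕ, (1 * (((0 : ℝ) + l : ℝ) : ℂ) ^ 1) *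
        Complex.exp (-((((0 : ℝ) + l : ℝ) : ℂ) ^ 3 * ξ)) = cubeSum ξ := by
      rw [hsum.tsum_eq_zero_add]
      simp [cubeSum]
    have hI : ∫ u in Ioi (0 : ℝ), (1 * (u : ℂ) ^ 1) * Complex.exp (-((u : ℂ) ^ 3 * ξ)) =
        Complex.Gamma (2 / 3) / 3 * ξ ^ (-(2 / 3) : ℂ) := by
      simpa using integral_mul_exp_neg_cube hξ.1
    rw [hV, hI] at hle
    simp only [Complex.ofReal_zero, mul_zero, zero_mul, pow_one, ne_eq, OfNat.ofNat_ne_zero,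
      not_false_eq_true, zero_pow, add_zero, neg_zero, Complex.exp_zero, mul_one, sub_zero] at hle
    have e : cubeSum ξ - Complex.Gamma (2 / 3) / 3 * ξ ^ (-(2 / 3) : ℂ) + 1 / 12 =
        1 / 2 * (2 * cubeSum ξ - 2 * (Complex.Gamma (2 / 3) / 3 * ξ ^ (-(2 / 3) : ℂ)) + 1 / 6) := by
      ring
    have hn := norm_nonneg (2 * cubeSum ξ - 2 * (Complex.Gamma (2 / 3) / 3 *
      ξ ^ (-(2 / 3) : ℂ)) + 1 / 6)
    rw [e, norm_mul]
    norm_num at hle ⊢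
    linarith
  · intro u _ hu
    have hu0 : 0 < u := by linarith
    have hb1 := h₁ _ (hu1 u hu)
    have hb2 := h₂ _ (hu1 u hu)
    rw [pow_zero, one_mul] at hb1
    rw [pow_one] at hb2
    rw [norm_cube_mul ξ hu0.le] at hb1 hb2
    rw [Real.mul_rpow (by positivity) (by positivity), ← Real.rpow_natCast u 3,
      ← Real.rpow_mul hu0.le] at hb1 hb2
    have hu3 : u ^ (((3 : ℕ) : ℝ) * -1) ≤ u ^ (-2 : ℝ) :=
      Real.rpow_le_rpow_of_exponent_le hu (by norm_num)
    have huu : u * u ^ (((3 : ℕ) : ℝ) * -1) = u ^ (-2 : ℝ) := by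
      rw [mul_comm, ← Real.rpow_add_one hu0.ne']
      norm_num
    have hp1 : 0 < ‖ξ‖ ^ (-1 : ℝ) := by positivity
    have hp2 : 0 < u ^ (-2 : ℝ) := by positivity
    constructor
    · rw [norm_mul, one_mul, pow_one, Complex.norm_real, Real.norm_of_nonneg hu0.le]
      calc u * ‖Complex.exp (-((u : ℂ) ^ 3 * ξ))‖
          ≤ u * (K₁ * (u ^ (((3 : ℕ) : ℝ) * -1) * ‖ξ‖ ^ (-1 : ℝ))) := by gcongr
        _ = ‖ξ‖ ^ (-1 : ℝ) * K₁ * u ^ (-2 : ℝ) := by rw [← huu]; ring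
        _ ≤ _ := by
          gcongr
          linarith
    · have hP : ‖1 + -3 * ξ * (u : ℂ) ^ 3‖ ≤ 3 * (1 + u ^ 3 * ‖ξ‖) := by
        refine (norm_add_le _ _).trans ?_
        have : ‖-3 * ξ * (u : ℂ) ^ 3‖ = 3 * (u ^ 3 * ‖ξ‖) := by
          rw [show -3 * ξ * (u : ℂ) ^ 3 = -3 * ((u : ℂ) ^ 3 * ξ) by ring, norm_mul,
            norm_cube_mul ξ hu0.le]
          norm_num
        rw [this, norm_one]
        linarith
      rw [← Real.rpow_natCast u 3] at hP
      rw [norm_mul]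
      calc ‖1 + -3 * ξ * (u : ℂ) ^ 3‖ * ‖Complex.exp (-((u : ℂ) ^ 3 * ξ))‖
          ≤ 3 * (1 + u ^ ((3 : ℕ) : ℝ) * ‖ξ‖) * ‖Complex.exp (-((u : ℂ) ^ 3 * ξ))‖ := by gcongr
        _ = 3 * ((1 + u ^ ((3 : ℕ) : ℝ) * ‖ξ‖) * ‖Complex.exp (-((u : ℂ) ^ 3 * ξ))‖) := by ring
        _ ≤ 3 * (K₂ * (u ^ (-2 : ℝ) * ‖ξ‖ ^ (-1 : ℝ))) := by
          refine mul_le_mul_of_nonneg_left (hb2.trans ?_) (by norm_num)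
          gcongr
        _ = ‖ξ‖ ^ (-1 : ℝ) * (3 * K₂) * u ^ (-2 : ℝ) := by ring
        _ ≤ _ := by
          gcongr
          linarith
  · intro l u hlu
    have hu0 : 0 ≤ u := by linarith [Nat.cast_nonneg (α := ℝ) l]
    have hb := h₃ _ (norm_cube_mul_le hξ hu0)
    have hP := norm_poly_three_le (c₀ := -24) (c₁ := 396) (c₂ := -432) (c₃ := 81) (C := 432)
      (w := (u : ℂ) ^ 3 * ξ) (by norm_num) (by norm_num) (by norm_num) (by norm_num)
    have hq : (1 + ‖(u : ℂ) ^ 3 * ξ‖) ^ (-(2 / 5) : ℝ) ≤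
        (‖ξ‖ * ((l : ℝ) + 1) ^ 3 / 4) ^ (-(2 / 5) : ℝ) := by
      refine Real.rpow_le_rpow_of_nonpos (by positivity) ?_ (by norm_num)
      have h1 := norm_mul_succ_cube_le hξ1 hu0
      have h2 : ((l : ℝ) + 1) ^ 3 ≤ (1 + u) ^ 3 :=
        pow_le_pow_left₀ (by positivity) (by linarith) 3
      have h3 := mul_le_mul_of_nonneg_left h2 hpos.le
      linarith
    have hq2 : (‖ξ‖ * ((l : ℝ) + 1) ^ 3 / 4) ^ (-(2 / 5) : ℝ) =
        4 ^ (2 / 5 : ℝ) * (‖ξ‖ ^ (-(2 / 5) : ℝ) * ((l : ℝ) + 1) ^ (-(6 / 5) : ℝ)) := by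
      rw [Real.div_rpow (by positivity) (by norm_num), Real.mul_rpow hpos.le (by positivity),
        ← Real.rpow_natCast, ← Real.rpow_mul (by positivity), Real.rpow_neg (by norm_num : (0:ℝ) ≤ 4),
        div_inv_eq_mul, mul_comm]
      norm_num
    have hξξ : ‖ξ‖ * ‖ξ‖ ^ (-(2 / 5) : ℝ) = ‖ξ‖ ^ (3 / 5 : ℝ) := by
      rw [mul_comm, ← Real.rpow_add_one hpos.ne']
      norm_num
    rw [hq2] at hq
    rw [norm_mul, norm_mul]
    calc _ ≤ ‖ξ‖ * (432 * (1 + ‖(u : ℂ) ^ 3 * ξ‖) ^ 3) * ‖Complex.exp (-((u : ℂ) ^ 3 * ξ))‖ := by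
          gcongr
      _ = 432 * ‖ξ‖ * ((1 + ‖(u : ℂ) ^ 3 * ξ‖) ^ 3 * ‖Complex.exp (-((u : ℂ) ^ 3 * ξ))‖) := by ring
      _ ≤ 432 * ‖ξ‖ * (K₃ * (4 ^ (2 / 5 : ℝ) * (‖ξ‖ ^ (-(2 / 5) : ℝ) *
          ((l : ℝ) + 1) ^ (-(6 / 5) : ℝ)))) := by
          refine mul_le_mul_of_nonneg_left (hb.trans ?_) (by positivity)
          gcongr
      _ = _ := by rw [← hξξ]; ring

lemma integral_sq_mul_exp_neg_cube {ξ : ℂ} (hξ : 0 < ξ.re)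
    (hint : IntegrableOn (fun u : ℝ => ξ * (u : ℂ) ^ 2 * Complex.exp (-((u : ℂ) ^ 3 * ξ))) (Ioi 0)) :
    ∫ u in Ioi (0 : ℝ), ξ * (u : ℂ) ^ 2 * Complex.exp (-((u : ℂ) ^ 3 * ξ)) = 1 / 3 := by
  have hd : ∀ u ∈ Ici (0 : ℝ), HasDerivAt
      (fun u : ℝ => (-(1 / 3 : ℂ) * (u : ℂ) ^ 0) * Complex.exp (-((1 : ℂ) * (u : ℂ) ^ 3 * ξ)))
      (ξ * (u : ℂ) ^ 2 * Complex.exp (-((u : ℂ) ^ 3 * ξ))) u := fun u _ =>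
    (hasDerivAt_mul_cexp_neg (hasDerivAt_monomial (-(1 / 3)) 0 u)
      ((hasDerivAt_monomial 1 3 u).mul_const ξ)).congr_deriv (by push_cast; ring)
  have ht : Tendsto (fun u : ℝ => (-(1 / 3 : ℂ) * (u : ℂ) ^ 0) *
      Complex.exp (-((1 : ℂ) * (u : ℂ) ^ 3 * ξ))) atTop (𝓝 0) := by
    rw [← mul_zero (-(1 / 3 : ℂ))]
    simp only [pow_zero, mul_one, one_mul]
    refine Tendsto.const_mul _ (Complex.tendsto_exp_nhds_zero_iff.mpr ?_)
    have e : ∀ u : ℝ, (-((u : ℂ) ^ 3 * ξ)).re = -(u ^ 3 * ξ.re) := fun u => by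
      rw [← Complex.ofReal_pow, Complex.neg_re, Complex.re_ofReal_mul]
    simp_rw [e]
    exact tendsto_neg_atTop_atBot.comp
      ((tendsto_pow_atTop (by norm_num)).atTop_mul_const hξ)
  rw [integral_Ioi_of_hasDerivAt_of_tendsto' hd hint ht]
  simp

/-- The leading behaviour of `ξ ∑ j² exp (-j³ ξ)` near the vertex of the sector. -/
lemma exists_squareSum_sub_le : ∃ K : ℝ, 0 < K ∧ ∀ ξ : ℂ, InSector ξ → ‖ξ‖ ≤ 1 →
    (Summable fun n : ℕ => ξ * (((n : ℝ) + 1 : ℝ) : ℂ) ^ 2 *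
      Complex.exp (-((((n : ℝ) + 1 : ℝ) : ℂ) ^ 3 * ξ))) ∧
    ‖∑' n : ℕ, ξ * (((n : ℝ) + 1 : ℝ) : ℂ) ^ 2 *
      Complex.exp (-((((n : ℝ) + 1 : ℝ) : ℂ) ^ 3 * ξ)) - 1 / 3‖ ≤ K * ‖ξ‖ := by
  obtain ⟨K₁, hK₁, h₁⟩ := exists_norm_exp_le' 0 (p := 4 / 3) (by norm_num)
  obtain ⟨K₂, hK₂, h₂⟩ := exists_norm_exp_le' 1 (p := 1) (by norm_num)
  obtain ⟨K₃, hK₃, h₃⟩ := exists_norm_exp_le 3 (p := 1) (by norm_num)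
  have hs := summable_succ_rpow (c := 2) (by norm_num)
  have hspos : 0 < ∑' l : ℕ, ((l : ℝ) + 1) ^ (-2 : ℝ) :=
    hs.tsum_pos (fun n => by positivity) 0 (by positivity)
  refine ⟨2880 * K₃ * ∑' l : ℕ, ((l : ℝ) + 1) ^ (-2 : ℝ), by positivity, fun ξ hξ hξ1 => ?_⟩
  have hpos := hξ.norm_pos
  have hE : ∀ u : ℝ, HasDerivAt (fun u : ℝ => (u : ℂ) ^ 3 * ξ) (3 * (u : ℂ) ^ 2 * ξ) u := fun u =>
    ((hasDerivAt_monomial 1 3 u).mul_const ξ).congr_deriv (by norm_num) |>.congr_of_eventuallyEq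
      (Eventually.of_forall fun v => by simp)
  have hu1 : ∀ u : ℝ, 1 ≤ u → InSector ((u : ℂ) ^ 3 * ξ) := fun u hu => by
    rw [← Complex.ofReal_pow]
    exact hξ.real_mul (by positivity)
  have hm := hasDerivAt_monomial
  have EM := euler_maclaurin (a := 0) (le_refl 0)
    (g := fun u : ℝ => (ξ * (u : ℂ) ^ 2) * Complex.exp (-((u : ℂ) ^ 3 * ξ)))
    (g1 := fun u : ℝ => (2 * ξ * (u : ℂ) ^ 1 + -3 * ξ ^ 2 * (u : ℂ) ^ 4) *
      Complex.exp (-((u : ℂ) ^ 3 * ξ)))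
    (g2 := fun u : ℝ => (2 * ξ * (u : ℂ) ^ 0 + -18 * ξ ^ 2 * (u : ℂ) ^ 3 +
      9 * ξ ^ 3 * (u : ℂ) ^ 6) * Complex.exp (-((u : ℂ) ^ 3 * ξ)))
    (g3 := fun u : ℝ => (-60 * ξ ^ 2 * (u : ℂ) ^ 2 + 108 * ξ ^ 3 * (u : ℂ) ^ 5 +
      -27 * ξ ^ 4 * (u : ℂ) ^ 8) * Complex.exp (-((u : ℂ) ^ 3 * ξ)))
    (g4 := fun u : ℝ => ξ ^ 2 * (u : ℂ) * (((-120 : ℝ) : ℂ) + ((720 : ℝ) : ℂ) *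
      ((u : ℂ) ^ 3 * ξ) + ((-540 : ℝ) : ℂ) * ((u : ℂ) ^ 3 * ξ) ^ 2 +
      ((81 : ℝ) : ℂ) * ((u : ℂ) ^ 3 * ξ) ^ 3) * Complex.exp (-((u : ℂ) ^ 3 * ξ)))
    (K := ‖ξ‖ ^ (-(1 / 3) : ℝ) * K₁ + 3 * K₂)
    (M := fun l => 2880 * K₃ * ‖ξ‖ * ((l : ℝ) + 1) ^ (-2 : ℝ))
    (fun u _ => (hasDerivAt_mul_cexp_neg (hm _ _ u) (hE u)).congr_deriv (by push_cast; ring))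
    (fun u _ => (hasDerivAt_mul_cexp_neg ((hm _ _ u).add (hm _ _ u)) (hE u)).congr_deriv
      (by simp only [Pi.add_apply]; push_cast; ring))
    (fun u _ => (hasDerivAt_mul_cexp_neg (((hm _ _ u).add (hm _ _ u)).add (hm _ _ u))
      (hE u)).congr_deriv (by simp only [Pi.add_apply]; push_cast; ring))
    (fun u _ => (hasDerivAt_mul_cexp_neg (((hm _ _ u).add (hm _ _ u)).add (hm _ _ u))
      (hE u)).congr_deriv (by simp only [Pi.add_apply]; push_cast; ring))
    (by fun_prop) ?_ ?_ (hs.mul_left _)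
  · obtain ⟨hint, hsum, hle⟩ := EM
    rw [tsum_mul_left, integral_sq_mul_exp_neg_cube hξ.1 hint, hsum.tsum_eq_zero_add] at hle
    have hsum' := (summable_nat_add_iff 1).mpr hsum
    simp only [zero_add, Nat.cast_add, Nat.cast_one] at hsum' hle
    refine ⟨hsum', ?_⟩
    -- Here `g` and `g1` both vanish at 0, so apart from the exact integral 1/3 only the
    -- fourth-derivative error remains.
    simp only [Nat.cast_zero, Complex.ofReal_zero, mul_zero, zero_mul, pow_one, ne_eq,
      OfNat.ofNat_ne_zero, not_false_eq_true, zero_pow, add_zero, neg_zero, zero_add,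
      Complex.exp_zero, mul_one, sub_zero, zero_div] at hle
    rw [← mul_sub, norm_mul, Complex.norm_ofNat] at hle
    have hn := norm_nonneg (∑' n : ℕ, ξ * (((n : ℝ) + 1 : ℝ) : ℂ) ^ 2 *
      Complex.exp (-((((n : ℝ) + 1 : ℝ) : ℂ) ^ 3 * ξ)) - 1 / 3)
    have e : 2880 * K₃ * (∑' l : ℕ, ((l : ℝ) + 1) ^ (-2 : ℝ)) * ‖ξ‖ =
      2880 * K₃ * ‖ξ‖ * ∑' l : ℕ, ((l : ℝ) + 1) ^ (-2 : ℝ) := by ring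
    rw [e]
    linarith
  · intro u _ hu
    have hu0 : 0 < u := by linarith
    have hb1 := h₁ _ (hu1 u hu)
    have hb2 := h₂ _ (hu1 u hu)
    rw [pow_zero, one_mul] at hb1
    rw [pow_one] at hb2
    rw [norm_cube_mul ξ hu0.le] at hb1 hb2
    rw [Real.mul_rpow (by positivity) (by positivity), ← Real.rpow_natCast u 3,
      ← Real.rpow_mul hu0.le] at hb1
    have huu : u ^ 2 * u ^ (((3 : ℕ) : ℝ) * -(4 / 3)) = u ^ (-2 : ℝ) := by
      rw [← Real.rpow_natCast u 2, ← Real.rpow_add hu0]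
      norm_num
    have hxx : ‖ξ‖ * ‖ξ‖ ^ (-(4 / 3) : ℝ) = ‖ξ‖ ^ (-(1 / 3) : ℝ) := by
      rw [mul_comm, ← Real.rpow_add_one hpos.ne']
      norm_num
    have hp1 : 0 < ‖ξ‖ ^ (-(1 / 3) : ℝ) := by positivity
    have hp2 : 0 < u ^ (-2 : ℝ) := by positivity
    constructor
    · rw [norm_mul, norm_mul, norm_pow, Complex.norm_real, Real.norm_of_nonneg hu0.le]
      calc ‖ξ‖ * u ^ 2 * ‖Complex.exp (-((u : ℂ) ^ 3 * ξ))‖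
          ≤ ‖ξ‖ * u ^ 2 * (K₁ * (u ^ (((3 : ℕ) : ℝ) * -(4 / 3)) * ‖ξ‖ ^ (-(4 / 3) : ℝ))) := by
            gcongr
        _ = ‖ξ‖ ^ (-(1 / 3) : ℝ) * K₁ * u ^ (-2 : ℝ) := by rw [← huu, ← hxx]; ring
        _ ≤ _ := by
          gcongr
          linarith
    · have hP : ‖2 * ξ * (u : ℂ) ^ 1 + -3 * ξ ^ 2 * (u : ℂ) ^ 4‖ ≤
          ‖ξ‖ * u * (3 * (1 + u ^ 3 * ‖ξ‖)) := by
        rw [show 2 * ξ * (u : ℂ) ^ 1 + -3 * ξ ^ 2 * (u : ℂ) ^ 4 =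
          ξ * u * (2 + -3 * ((u : ℂ) ^ 3 * ξ)) by ring, norm_mul, norm_mul, Complex.norm_real,
          Real.norm_of_nonneg hu0.le]
        gcongr
        refine (norm_add_le _ _).trans ?_
        rw [norm_mul, norm_cube_mul ξ hu0.le]
        norm_num
        linarith
      rw [norm_mul]
      calc _ ≤ ‖ξ‖ * u * (3 * (1 + u ^ 3 * ‖ξ‖)) * ‖Complex.exp (-((u : ℂ) ^ 3 * ξ))‖ := by gcongr
        _ = 3 * ‖ξ‖ * u * ((1 + u ^ 3 * ‖ξ‖) * ‖Complex.exp (-((u : ℂ) ^ 3 * ξ))‖) := by ring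
        _ ≤ 3 * ‖ξ‖ * u * (K₂ * (u ^ 3 * ‖ξ‖) ^ (-1 : ℝ)) := by gcongr
        _ = 3 * K₂ * u ^ (-2 : ℝ) := by
          rw [Real.rpow_neg_one, Real.rpow_neg hu0.le, Real.rpow_two]
          field_simp
        _ ≤ _ := by
          gcongr
          nlinarith
  · intro l u hlu
    have hu0 : 0 ≤ u := by linarith [Nat.cast_nonneg (α := ℝ) l]
    have hb := h₃ _ (norm_cube_mul_le hξ hu0)
    have hP := norm_poly_three_le (c₀ := -120) (c₁ := 720) (c₂ := -540) (c₃ := 81) (C := 720)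
      (w := (u : ℂ) ^ 3 * ξ) (by norm_num) (by norm_num) (by norm_num) (by norm_num)
    have h1 := norm_mul_succ_cube_le hξ1 hu0
    have hq : (1 + ‖(u : ℂ) ^ 3 * ξ‖) ^ (-1 : ℝ) ≤ 4 / (‖ξ‖ * (1 + u) ^ 3) := by
      rw [Real.rpow_neg_one, inv_le_comm₀ (by positivity) (by positivity), inv_div,
        div_le_iff₀ (by norm_num)]
      linarith
    have hl : (1 + u) ^ (-2 : ℝ) ≤ ((l : ℝ) + 1) ^ (-2 : ℝ) :=
      Real.rpow_le_rpow_of_nonpos (by positivity) (by linarith) (by norm_num)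
    rw [norm_mul, norm_mul, norm_mul, norm_pow, Complex.norm_real, Real.norm_of_nonneg hu0]
    calc _ ≤ ‖ξ‖ ^ 2 * u * (720 * (1 + ‖(u : ℂ) ^ 3 * ξ‖) ^ 3) *
          ‖Complex.exp (-((u : ℂ) ^ 3 * ξ))‖ := by
          gcongr
      _ = 720 * ‖ξ‖ ^ 2 * u * ((1 + ‖(u : ℂ) ^ 3 * ξ‖) ^ 3 *
          ‖Complex.exp (-((u : ℂ) ^ 3 * ξ))‖) := by ring
      _ ≤ 720 * ‖ξ‖ ^ 2 * (1 + u) * (K₃ * (4 / (‖ξ‖ * (1 + u) ^ 3))) := by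
          have := hb.trans (mul_le_mul_of_nonneg_left hq hK₃.le)
          gcongr
          linarith
      _ = 2880 * K₃ * ‖ξ‖ * (1 + u) ^ (-2 : ℝ) := by
          rw [Real.rpow_neg (by positivity), Real.rpow_two]
          field_simp
          norm_num
      _ ≤ _ := by gcongr

/-! ### The heat trace -/

/-- `∑_{j,k ≥ 1} exp (-j k (j + k) z)`. -/
noncomputable def heat (z : ℂ) : ℂ := ∑' p : ℕ+ × ℕ+, Complex.exp (-((weight p : ℂ) * z))

lemma norm_heat_term (p : ℕ+ × ℕ+) (z : ℂ) :
    ‖Complex.exp (-((weight p : ℂ) * z))‖ = Real.exp (-((weight p : ℝ) * z.re)) := by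
  rw [Complex.norm_exp, Complex.neg_re, ← Complex.ofReal_natCast, Complex.re_ofReal_mul]

lemma exp_neg_le_inv {x : ℝ} (hx : 0 < x) : Real.exp (-x) ≤ x⁻¹ := by
  rw [Real.exp_neg]
  exact inv_anti₀ hx (by linarith [Real.add_one_le_exp x])

lemma norm_heat_term_le (p : ℕ+ × ℕ+) {z : ℂ} (hz : 0 < z.re) :
    ‖Complex.exp (-((weight p : ℂ) * z))‖ ≤ z.re⁻¹ * (weight p : ℝ) ^ (-1 : ℝ) := by
  have hw : (0 : ℝ) < weight p := by exact_mod_cast one_le_weight p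
  rw [norm_heat_term, Real.rpow_neg_one, ← mul_inv, mul_comm]
  exact exp_neg_le_inv (by positivity)

lemma summable_heat {z : ℂ} (hz : 0 < z.re) :
    Summable fun p : ℕ+ × ℕ+ => Complex.exp (-((weight p : ℂ) * z)) :=
  Summable.of_norm_bounded ((summable_weight_rpow (σ := 1) (by norm_num)).mul_left _)
    fun p => norm_heat_term_le p hz

lemma exists_norm_heat_le : ∃ K : ℝ, 0 < K ∧ ∀ z : ℂ, 0 < z.re → ‖heat z‖ ≤ K * z.re⁻¹ := by
  have hs := summable_weight_rpow (σ := 1) (by norm_num)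
  have h0 : ∀ p : ℕ+ × ℕ+, (0 : ℝ) < (weight p : ℝ) ^ (-1 : ℝ) := fun p => by
    have : (0 : ℝ) < weight p := by exact_mod_cast one_le_weight p
    positivity
  refine ⟨∑' p : ℕ+ × ℕ+, (weight p : ℝ) ^ (-1 : ℝ),
    hs.tsum_pos (fun p => (h0 p).le) (1, 1) (h0 _), fun z hz => ?_⟩
  refine (tsum_of_norm_bounded (hs.mul_left _).hasSum fun p => norm_heat_term_le p hz).trans_eq ?_
  rw [tsum_mul_left, mul_comm]

lemma differentiableOn_heat : DifferentiableOn ℂ heat {z | 0 < z.re} := by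
  intro z hz
  obtain ⟨ε, h1, h2⟩ := exists_between (show 0 < z.re from hz)
  have hd : DifferentiableOn ℂ heat {z : ℂ | ε < z.re} := by
    refine Complex.differentiableOn_tsum_of_summable_norm
      ((summable_weight_rpow (σ := 1) (by norm_num)).mul_left ε⁻¹)
      (fun n => by fun_prop) (isOpen_halfPlane ε) fun p t ht => ?_
    have ht' : ε < t.re := ht
    refine (norm_heat_term_le p (h1.trans ht')).trans ?_
    have : t.re⁻¹ ≤ ε⁻¹ := inv_anti₀ h1 ht'.le
    gcongr
  exact (hd.differentiableAt ((isOpen_halfPlane ε).mem_nhds h2)).differentiableWithinAt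

/-- The integrand for the inner sum of the heat trace, with `A = j z`. -/
lemma exists_inner_sum_le : ∃ K : ℝ, 0 < K ∧ ∀ z : ℂ, InSector z → ∀ j : ℝ, 1 ≤ j →
    IntegrableOn (fun u : ℝ => Complex.exp (-((j * u * (j + u) : ℝ) * z))) (Ioi j) ∧
    (Summable fun l : ℕ => Complex.exp (-((j * (j + l) * (j + (j + l)) : ℝ) * z))) ∧
    ‖2 * ∑' l : ℕ, Complex.exp (-((j * (j + l) * (j + (j + l)) : ℝ) * z)) -
      Complex.exp (-((j * j * (j + j) : ℝ) * z)) -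
      2 * (∫ u in Ioi j, Complex.exp (-((j * u * (j + u) : ℝ) * z))) -
      1 / 4 * ((2 * z) * (j : ℂ) ^ 2 * Complex.exp (-((j : ℂ) ^ 3 * (2 * z))))‖ ≤
      ∑' l : ℕ, K * ‖z‖ ^ (1 / 2 : ℝ) * (j ^ (1 / 2 : ℝ) * (j + l) ^ (-3 : ℝ)) := by
  obtain ⟨K₁, hK₁, h₁⟩ := exists_norm_exp_le' 0 (p := 1) (by norm_num)
  obtain ⟨K₂, hK₂, h₂⟩ := exists_norm_exp_le' 0 (p := 3 / 2) (by norm_num)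
  -- With w = j u (j + u) z one has |w| ≥ |A| u², so decay of order 3/2 against the factor A² of
  -- `g4` leaves |A|^(1/2) u^(-3) = |z|^(1/2) j^(1/2) u^(-3). This is the final power of |z|, and it
  -- is summable over both j and l.
  obtain ⟨K₃, hK₃, h₃⟩ := exists_norm_exp_le' 2 (p := 3 / 2) (by norm_num)
  refine ⟨108 * K₃, by positivity, fun z hz j hj => ?_⟩
  have hpos := hz.norm_pos
  have hj0 : 0 < j := by linarith
  set A : ℂ := j * z with hA
  have hAn : ‖A‖ = j * ‖z‖ := by rw [hA, norm_mul, Complex.norm_real, Real.norm_of_nonneg hj0.le]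
  have hApos : 0 < ‖A‖ := by rw [hAn]; positivity
  have hD : ∀ u : ℝ, HasDerivAt (fun u : ℝ => 2 * (u : ℂ) + j) 2 u := fun u =>
    (((hasDerivAt_monomial 2 1 u).add_const (j : ℂ)).congr_deriv (by norm_num)).congr_of_eventuallyEq
      (Eventually.of_forall fun v => by simp)
  have hE : ∀ u : ℝ, HasDerivAt (fun u : ℝ => (j * u * (j + u) : ℝ) * z) (A * (2 * u + j)) u :=
    fun u => (((hasDerivAt_monomial A 2 u).fun_add (hasDerivAt_monomial (A * j) 1 u)).congr_deriv
      (by push_cast; ring)).congr_of_eventuallyEq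
      (Eventually.of_forall fun v => by simp only [hA]; push_cast; ring)
  have hsec : ∀ u : ℝ, j ≤ u → InSector ((j * u * (j + u) : ℝ) * z) := fun u hu =>
    hz.real_mul (by have : 0 < u := by linarith
                    positivity)
  have hw : ∀ u : ℝ, j ≤ u → ‖A‖ * u ^ 2 ≤ ‖((j * u * (j + u) : ℝ) * z : ℂ)‖ := fun u hu => by
    have hu0 : 0 < u := by linarith
    rw [hAn, norm_mul, Complex.norm_real, Real.norm_of_nonneg (by positivity)]
    have := mul_pos (mul_pos (mul_pos hj0 hu0) hj0) hpos
    nlinarith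
  have hDn : ∀ u : ℝ, j ≤ u → ‖2 * (u : ℂ) + j‖ ≤ 3 * u := fun u hu => by
    have : (2 * (u : ℂ) + j) = ((2 * u + j : ℝ) : ℂ) := by push_cast; rfl
    rw [this, Complex.norm_real, Real.norm_of_nonneg (by linarith)]
    linarith
  have hrp : ∀ u : ℝ, j ≤ u → ∀ p : ℝ, 0 ≤ p →
      ‖((j * u * (j + u) : ℝ) * z : ℂ)‖ ^ (-p) ≤ ‖A‖ ^ (-p) * u ^ (2 * -p) := fun u hu p hp => by
    have hu0 : 0 < u := by linarith
    refine (Real.rpow_le_rpow_of_nonpos (by positivity) (hw u hu) (by linarith)).trans_eq ?_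
    rw [Real.mul_rpow (by positivity) (by positivity), ← Real.rpow_natCast, ← Real.rpow_mul hu0.le]
    norm_num
  have hs : Summable fun l : ℕ => j ^ (1 / 2 : ℝ) * (j + l) ^ (-3 : ℝ) := by
    refine Summable.mul_left _ (Summable.of_nonneg_of_le (fun l => by positivity) (fun l => ?_)
      (summable_succ_rpow (c := 3) (by norm_num)))
    exact Real.rpow_le_rpow_of_nonpos (by positivity) (by linarith) (by norm_num)
  have hAA : ‖A‖ ^ 2 * ‖A‖ ^ (-(3 / 2) : ℝ) = ‖z‖ ^ (1 / 2 : ℝ) * j ^ (1 / 2 : ℝ) := by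
    rw [← Real.rpow_natCast, ← Real.rpow_add hApos, hAn, Real.mul_rpow hj0.le hpos.le, mul_comm]
    norm_num
  have hA2 : ‖A‖ * ‖A‖ ^ (-(3 / 2) : ℝ) = ‖A‖ ^ (-(1 / 2) : ℝ) := by
    rw [mul_comm, ← Real.rpow_add_one hApos.ne']
    norm_num
  have EM := euler_maclaurin (a := j) hj0.le
    (g := fun u : ℝ => 1 * Complex.exp (-((j * u * (j + u) : ℝ) * z)))
    (g1 := fun u : ℝ => (-A * (2 * u + j)) * Complex.exp (-((j * u * (j + u) : ℝ) * z)))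
    (g2 := fun u : ℝ => (A ^ 2 * (2 * u + j) ^ 2 - 2 * A) *
      Complex.exp (-((j * u * (j + u) : ℝ) * z)))
    (g3 := fun u : ℝ => (6 * A ^ 2 * (2 * u + j) - A ^ 3 * (2 * u + j) ^ 3) *
      Complex.exp (-((j * u * (j + u) : ℝ) * z)))
    (g4 := fun u : ℝ => A ^ 2 * (12 + -12 * (A * (2 * u + j) ^ 2) + (A * (2 * u + j) ^ 2) ^ 2) *
      Complex.exp (-((j * u * (j + u) : ℝ) * z)))
    (K := ‖A‖ ^ (-1 : ℝ) * K₁ + 3 * ‖A‖ ^ (-(1 / 2) : ℝ) * K₂)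
    (M := fun l => 108 * K₃ * ‖z‖ ^ (1 / 2 : ℝ) * (j ^ (1 / 2 : ℝ) * (j + l) ^ (-3 : ℝ)))
    (fun u _ => (hasDerivAt_mul_cexp_neg (hasDerivAt_const u (1 : ℂ)) (hE u)).congr_deriv (by ring))
    (fun u _ => (hasDerivAt_mul_cexp_neg ((hD u).const_mul (-A)) (hE u)).congr_deriv (by ring))
    (fun u _ => (hasDerivAt_mul_cexp_neg ((((hD u).fun_pow 2).const_mul (A ^ 2)).sub_const (2 * A))
      (hE u)).congr_deriv (by push_cast; ring))
    (fun u _ => (hasDerivAt_mul_cexp_neg (((hD u).const_mul (6 * A ^ 2)).fun_sub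
      (((hD u).fun_pow 3).const_mul (A ^ 3))) (hE u)).congr_deriv (by push_cast; ring))
    (by fun_prop) ?_ ?_ (hs.mul_left _)
  · obtain ⟨hint, hsum, hle⟩ := EM
    simp only [one_mul] at hint hsum hle
    refine ⟨hint, hsum, ?_⟩
    refine le_trans (le_of_eq ?_) hle
    congr 1
    have e : Complex.exp (-((j : ℂ) ^ 3 * (2 * z))) = Complex.exp (-((j * j * (j + j) : ℝ) * z)) := by
      congr 1
      push_cast
      ring
    rw [e, hA]
    ring
  · intro u hu _
    have hu0 : 0 < u := by linarith
    have hb1 := (h₁ _ (hsec u hu)).trans (mul_le_mul_of_nonneg_left (hrp u hu 1 (by norm_num)) hK₁.le)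
    have hb2 := (h₂ _ (hsec u hu)).trans
      (mul_le_mul_of_nonneg_left (hrp u hu (3 / 2) (by norm_num)) hK₂.le)
    rw [pow_zero, one_mul] at hb1 hb2
    have hp1 : 0 < ‖A‖ ^ (-(1 / 2) : ℝ) := by positivity
    have hp2 : 0 < u ^ (-2 : ℝ) := by positivity
    have hp3 : 0 < ‖A‖ ^ (-1 : ℝ) := by positivity
    norm_num only at hb1 hb2
    constructor
    · rw [one_mul]
      refine hb1.trans ?_
      rw [← mul_assoc, mul_comm K₁]
      gcongr
      linarith [mul_pos (mul_pos (by norm_num : (0 : ℝ) < 3) hp1) hK₂]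
    · rw [norm_mul, norm_mul, norm_neg]
      have huu : u * u ^ (-3 : ℝ) = u ^ (-2 : ℝ) := by
        rw [mul_comm, ← Real.rpow_add_one hu0.ne']
        norm_num
      calc _ ≤ ‖A‖ * (3 * u) * (K₂ * (‖A‖ ^ (-(3 / 2) : ℝ) * u ^ (-3 : ℝ))) := by
            have := hDn u hu
            norm_num only
            gcongr
        _ = (‖A‖ * ‖A‖ ^ (-(3 / 2) : ℝ)) * 3 * K₂ * (u * u ^ (-3 : ℝ)) := by ring
        _ = 3 * ‖A‖ ^ (-(1 / 2) : ℝ) * K₂ * u ^ (-2 : ℝ) := by rw [huu, hA2]; ring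
        _ ≤ _ := by
          gcongr
          linarith [mul_pos hp3 hK₁]
  · intro l u hlu
    have hl0 := Nat.cast_nonneg (α := ℝ) l
    have hu : j ≤ u := by linarith
    have hu0 : 0 < u := by linarith
    have hb := (h₃ _ (hsec u hu)).trans
      (mul_le_mul_of_nonneg_left (hrp u hu (3 / 2) (by norm_num)) hK₃.le)
    set w : ℂ := (j * u * (j + u) : ℝ) * z with hwdef
    have hx : ‖A * (2 * u + j) ^ 2‖ ≤ 9 * ‖w‖ := by
      rw [norm_mul, norm_pow]
      calc _ ≤ ‖A‖ * (3 * u) ^ 2 := by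
            have := hDn u hu
            gcongr
        _ = 9 * (‖A‖ * u ^ 2) := by ring
        _ ≤ _ := by
            have := hw u hu
            gcongr
    have hP : ‖12 + -12 * (A * (2 * u + j) ^ 2) + (A * (2 * u + j) ^ 2) ^ 2‖ ≤
        108 * (1 + ‖w‖) ^ 2 := by
      generalize A * (2 * u + j) ^ 2 = x at hx
      refine (norm_add_le _ _).trans ((add_le_add_left (norm_add_le _ _) _).trans ?_)
      rw [norm_pow, norm_mul]
      norm_num
      nlinarith [norm_nonneg w, norm_nonneg x]
    have hul : u ^ (-3 : ℝ) ≤ (j + l) ^ (-3 : ℝ) :=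
      Real.rpow_le_rpow_of_nonpos (by positivity) hlu (by norm_num)
    rw [norm_mul, norm_mul, norm_pow]
    norm_num only at hb
    calc _ ≤ ‖A‖ ^ 2 * (108 * (1 + ‖w‖) ^ 2) * ‖Complex.exp (-w)‖ := by gcongr
      _ = 108 * ‖A‖ ^ 2 * ((1 + ‖w‖) ^ 2 * ‖Complex.exp (-w)‖) := by ring
      _ ≤ 108 * ‖A‖ ^ 2 * (K₃ * (‖A‖ ^ (-(3 / 2) : ℝ) * u ^ (-3 : ℝ))) := by
        norm_num only
        gcongr
      _ = 108 * K₃ * (‖A‖ ^ 2 * ‖A‖ ^ (-(3 / 2) : ℝ)) * u ^ (-3 : ℝ) := by ring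
      _ = 108 * K₃ * ‖z‖ ^ (1 / 2 : ℝ) * (j ^ (1 / 2 : ℝ) * u ^ (-3 : ℝ)) := by rw [hAA]; ring
      _ ≤ _ := by gcongr

/-- Sum the inner Euler-Maclaurin estimate over j. The boundary terms form 1/4 of the sum treated in
`exists_squareSum_sub_le` at ξ = 2z, whence 1/4 · 1/3 = 1/12 and the condition |z| ≤ 1/2. -/
lemma exists_heat_sub_le : ∃ K : ℝ, 0 < K ∧ ∀ z : ℂ, InSector z → ‖z‖ ≤ 1 / 2 → ∀ S : ℂ,
    HasSum (fun n : ℕ => ∫ u in Ioi ((n : ℝ) + 1),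
      Complex.exp (-((((n : ℝ) + 1) * u * ((n : ℝ) + 1 + u) : ℝ) * z))) S →
    ‖heat z - 2 * S - 1 / 12‖ ≤ K * ‖z‖ ^ (1 / 2 : ℝ) := by
  obtain ⟨K₁, hK₁, h₁⟩ := exists_inner_sum_le
  obtain ⟨K₂, hK₂, h₂⟩ := exists_squareSum_sub_le
  have hs : Summable fun p : ℕ × ℕ =>
      ((p.1 : ℝ) + 1) ^ (1 / 2 : ℝ) * ((p.1 : ℝ) + 1 + p.2) ^ (-3 : ℝ) := by
    simpa using summable_pair_rpow (a := -(1 / 2)) (b := 3) (c := 5 / 4) (by norm_num)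
      (by norm_num) (by norm_num)
  have hs0 : 0 ≤ ∑' p : ℕ × ℕ, ((p.1 : ℝ) + 1) ^ (1 / 2 : ℝ) * ((p.1 : ℝ) + 1 + p.2) ^ (-3 : ℝ) :=
    tsum_nonneg fun p => by positivity
  refine ⟨K₁ * (∑' p : ℕ × ℕ, ((p.1 : ℝ) + 1) ^ (1 / 2 : ℝ) * ((p.1 : ℝ) + 1 + p.2) ^ (-3 : ℝ)) + K₂,
    by positivity, fun z hz hz1 S hS => ?_⟩
  have hpos := hz.norm_pos
  have hin := fun n : ℕ => h₁ z hz ((n : ℝ) + 1) (by linarith [Nat.cast_nonneg (α := ℝ) n])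
  have h2z : InSector (2 * z) := by simpa using hz.real_mul (r := 2) (by norm_num)
  have h2n : ‖2 * z‖ = 2 * ‖z‖ := by simp
  obtain ⟨hQs, hQ⟩ := h₂ (2 * z) h2z (by linarith)
  have hsum := hasSum_of_symm (f := fun j k : ℕ => Complex.exp (-(((j * k * (j + k) : ℕ) : ℂ) * z)))
    (fun j k => by ring_nf) (summable_heat hz.1).hasSum
  have hfib : ∀ n : ℕ, HasSum (fun l : ℕ =>
      Complex.exp (-((((n + 1) * (n + 1 + l) * (n + 1 + (n + 1 + l)) : ℕ) : ℂ) * z)) +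
      Complex.exp (-((((n + 1) * (n + 1 + (l + 1)) * (n + 1 + (n + 1 + (l + 1))) : ℕ) : ℂ) * z)))
      (2 * ∑' l : ℕ, Complex.exp (-(((((n : ℝ) + 1) * ((n : ℝ) + 1 + l) *
        ((n : ℝ) + 1 + ((n : ℝ) + 1 + l)) : ℝ)) * z)) - Complex.exp (-((((n : ℝ) + 1) *
        ((n : ℝ) + 1) * ((n : ℝ) + 1 + ((n : ℝ) + 1)) : ℝ) * z))) := fun n => by
    have hsn := (hin n).2.1
    have h3 := hsn.hasSum.add ((hasSum_nat_add_iff' 1).mpr hsn.hasSum)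
    convert h3 using 1
    · ext l
      push_cast
      rfl
    · simp
      ring
  have hT := hsum.prod_fiberwise hfib
  have hE := ((hT.sub (hS.mul_left 2)).sub (hQs.hasSum.mul_left (1 / 4)))
  have hb := (hs.mul_left (K₁ * ‖z‖ ^ (1 / 2 : ℝ)))
  have hle := tsum_of_norm_bounded (f := fun n : ℕ => _) hb.prod.hasSum fun n => (hin n).2.2
  rw [hE.tsum_eq, ← hb.tsum_prod, tsum_mul_left] at hle
  have hz2 : ‖z‖ ≤ ‖z‖ ^ (1 / 2 : ℝ) := by
    nth_rewrite 1 [← Real.rpow_one ‖z‖]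
    exact Real.rpow_le_rpow_of_exponent_ge hpos (by linarith) (by norm_num)
  set Q := ∑' n : ℕ, 2 * z * (((n : ℝ) + 1 : ℝ) : ℂ) ^ 2 *
      Complex.exp (-((((n : ℝ) + 1 : ℝ) : ℂ) ^ 3 * (2 * z)))
  have e : heat z - 2 * S - 1 / 12 = (heat z - 2 * S - 1 / 4 * Q) + 1 / 4 * (Q - 1 / 3) := by ring
  rw [e]
  refine (norm_add_le _ _).trans ((add_le_add hle le_rfl).trans ?_)
  rw [norm_mul]
  norm_num only [norm_div, norm_one, Complex.norm_ofNat]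
  rw [h2n] at hQ
  nlinarith

/-! ### Substitution -/

/-- With y = v(1 + v) the Jacobian is 1 + 2v = √(1 + 4y), and v = 1 corresponds to y = 2. -/
lemma integral_comp_mul_one_add (G : ℝ → ℂ) :
    ∫ v in Ioi (1 : ℝ), G (v * (1 + v)) = ∫ y in Ioi (2 : ℝ), ((√(1 + 4 * y))⁻¹ : ℝ) • G y := by
  have him : (fun v : ℝ => v * (1 + v)) '' Ioi 1 = Ioi 2 := by
    ext y
    constructor
    · rintro ⟨v, hv, rfl⟩
      have : (1 : ℝ) < v := hv
      show (2 : ℝ) < v * (1 + v)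
      nlinarith
    · intro hy
      have hy' : (2 : ℝ) < y := hy
      have h1 : 3 < √(1 + 4 * y) := by
        rw [Real.lt_sqrt (by norm_num)]
        linarith
      have h2 := Real.sq_sqrt (show 0 ≤ 1 + 4 * y by linarith)
      refine ⟨(√(1 + 4 * y) - 1) / 2, ?_, ?_⟩
      · show (1 : ℝ) < (√(1 + 4 * y) - 1) / 2
        linarith
      · simp only
        nlinarith
  have hinj : InjOn (fun v : ℝ => v * (1 + v)) (Ioi 1) := fun a ha b hb hab => by
    have ha' : (1 : ℝ) < a := ha
    have hb' : (1 : ℝ) < b := hb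
    have h1 : (a - b) * (1 + a + b) = 0 := by
      simp only at hab
      linarith
    rcases mul_eq_zero.mp h1 with h | h <;> linarith
  have hd : ∀ v ∈ Ioi (1 : ℝ), HasDerivWithinAt (fun v : ℝ => v * (1 + v)) (1 + 2 * v) (Ioi 1) v :=
    fun v _ => (((hasDerivAt_id v).fun_mul ((hasDerivAt_id v).const_add 1)).congr_deriv
      (by simp; ring)).hasDerivWithinAt
  rw [← him, integral_image_eq_integral_abs_deriv_smul measurableSet_Ioi hd hinj]
  refine setIntegral_congr_fun measurableSet_Ioi fun v hv => ?_
  have hv' : (1 : ℝ) < v := hv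
  have h1 : √(1 + 4 * (v * (1 + v))) = 1 + 2 * v := by
    rw [show 1 + 4 * (v * (1 + v)) = (1 + 2 * v) ^ 2 by ring, Real.sqrt_sq (by linarith)]
  rw [h1, abs_of_pos (by linarith), smul_smul, mul_inv_cancel₀ (by linarith), one_smul]

/-- Scaling u = (n + 1) v turns the exponent into (n + 1)³ v(1 + v) z, and its Jacobian is the
coefficient n + 1 in `cubeSum`. The dependence on n then sits in `cubeSum` alone, and sum and
integral are exchanged under the majorant (n + 1)^(-2) y^(-2). -/
lemma hasSum_inner_integral {z : ℂ} (hz : 0 < z.re) :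
    HasSum (fun n : ℕ => ∫ u in Ioi ((n : ℝ) + 1),
      Complex.exp (-((((n : ℝ) + 1) * u * ((n : ℝ) + 1 + u) : ℝ) * z)))
      (∫ y in Ioi (2 : ℝ), ((√(1 + 4 * y))⁻¹ : ℝ) • cubeSum (y * z)) := by
  have e1 : ∀ n : ℕ, ∫ u in Ioi ((n : ℝ) + 1),
      Complex.exp (-((((n : ℝ) + 1) * u * ((n : ℝ) + 1 + u) : ℝ) * z)) =
      ∫ y in Ioi (2 : ℝ), ((√(1 + 4 * y))⁻¹ : ℝ) •
        (((n + 1 : ℕ) : ℂ) * Complex.exp (-(((n + 1 : ℕ) : ℂ) ^ 3 * (y * z)))) := fun n => by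
    have hn : (0 : ℝ) < (n : ℝ) + 1 := by positivity
    have h1 := integral_comp_mul_left_Ioi (fun u : ℝ => ((n + 1 : ℕ) : ℂ) *
      Complex.exp (-((((n : ℝ) + 1) * u * ((n : ℝ) + 1 + u) : ℝ) * z))) 1 hn
    have h2 := integral_comp_mul_one_add (fun y : ℝ => ((n + 1 : ℕ) : ℂ) *
      Complex.exp (-(((n + 1 : ℕ) : ℂ) ^ 3 * (y * z))))
    rw [← h2]
    rw [mul_one, integral_const_mul (μ := volume.restrict (Ioi ((n : ℝ) + 1))), Complex.real_smul,
      ← mul_assoc] at h1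
    have h3 : ((((n : ℝ) + 1)⁻¹ : ℝ) : ℂ) * ((n + 1 : ℕ) : ℂ) = 1 := by
      have : ((n : ℂ) + 1) ≠ 0 := by exact_mod_cast hn.ne'
      push_cast
      exact inv_mul_cancel₀ this
    rw [h3, one_mul] at h1
    rw [← h1]
    refine setIntegral_congr_fun measurableSet_Ioi fun v _ => ?_
    push_cast
    ring_nf
  simp_rw [e1]
  have e2 : ∀ y : ℝ, ((√(1 + 4 * y))⁻¹ : ℝ) • cubeSum (y * z) = ∑' n : ℕ, ((√(1 + 4 * y))⁻¹ : ℝ) •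
        (((n + 1 : ℕ) : ℂ) * Complex.exp (-(((n + 1 : ℕ) : ℂ) ^ 3 * (y * z)))) := fun y => by
    rw [tsum_const_smul'']
    rfl
  simp_rw [e2]
  obtain ⟨K, hK, hb⟩ := exists_cubeSum_term_le 1
  have hy2 : IntegrableOn (fun y : ℝ => y ^ (-2 : ℝ)) (Ioi 2) :=
    integrableOn_Ioi_rpow_of_lt (by norm_num) (by norm_num)
  have hbd : ∀ n : ℕ, ∀ y ∈ Ioi (2 : ℝ), ‖((√(1 + 4 * y))⁻¹ : ℝ) •
        (((n + 1 : ℕ) : ℂ) * Complex.exp (-(((n + 1 : ℕ) : ℂ) ^ 3 * (y * z))))‖ ≤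
        (K * z.re ^ (-2 : ℝ) * ((n : ℝ) + 1) ^ (-2 : ℝ)) * y ^ (-2 : ℝ) := fun n y hy => by
    have hy' : (2 : ℝ) < y := hy
    have hy0 : 0 < y := by linarith
    have h1 := hb n (y * z) (by rw [Complex.re_ofReal_mul]; positivity)
    rw [Complex.re_ofReal_mul] at h1
    norm_num only [Nat.cast_one] at h1
    rw [Real.mul_rpow hy0.le hz.le] at h1
    rw [norm_smul, Real.norm_of_nonneg (by positivity)]
    have h2 : (√(1 + 4 * y))⁻¹ ≤ 1 :=
      inv_le_one_of_one_le₀ (Real.one_le_sqrt.mpr (by linarith))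
    refine (mul_le_of_le_one_left (norm_nonneg _) h2).trans (h1.trans_eq ?_)
    ring
  have hmeas : ∀ n : ℕ, AEStronglyMeasurable (fun y : ℝ => ((√(1 + 4 * y))⁻¹ : ℝ) •
        (((n + 1 : ℕ) : ℂ) * Complex.exp (-(((n + 1 : ℕ) : ℂ) ^ 3 * (y * z)))))
        (volume.restrict (Ioi 2)) := fun n => by
    refine Measurable.aestronglyMeasurable ?_
    fun_prop
  have hint : ∀ n : ℕ, IntegrableOn (fun y : ℝ => ((√(1 + 4 * y))⁻¹ : ℝ) •
        (((n + 1 : ℕ) : ℂ) * Complex.exp (-(((n + 1 : ℕ) : ℂ) ^ 3 * (y * z))))) (Ioi 2) := fun n =>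
    Integrable.mono' (hy2.const_mul _) (hmeas n)
      ((ae_restrict_mem measurableSet_Ioi).mono fun y hy => hbd n y hy)
  refine hasSum_integral_of_summable_integral_norm hint ?_
  refine Summable.of_nonneg_of_le (fun n => integral_nonneg fun y => norm_nonneg _) (fun n => ?_)
    (((summable_succ_rpow (c := 2) (by norm_num)).mul_left (K * z.re ^ (-2 : ℝ))).mul_right
      (∫ y in Ioi (2 : ℝ), y ^ (-2 : ℝ)))
  rw [← integral_const_mul]
  exact setIntegral_mono_on (hint n).norm (hy2.const_mul _) measurableSet_Ioi (hbd n)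

/-! ### Continuation of Mellin transforms -/

/-- The value is the negative of the one for the same power on (0, 1], in the complementary
half-plane. Hence a pure power contributes nothing to a continued Mellin transform, which is why
`mellin_sub_eq` has no correction term. -/
lemma hasMellin_cpow_Ioi {a s : ℂ} (hs : s.re + a.re < 0) :
    HasMellin (indicator (Ioi 1) (fun t => (t : ℂ) ^ a : ℝ → ℂ)) s (-(1 / (s + a))) := by
  have hs' : (s + a - 1).re < -1 := by
    simp only [Complex.sub_re, Complex.add_re, Complex.one_re]
    linarith
  have e : EqOn (fun t : ℝ => (t : ℂ) ^ (s - 1) • indicator (Ioi 1) (fun t => (t : ℂ) ^ a : ℝ → ℂ) t)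
      (indicator (Ioi 1) (fun t : ℝ => (t : ℂ) ^ (s + a - 1))) (Ioi 0) := fun t ht => by
    by_cases h1 : t ∈ Ioi (1 : ℝ)
    · simp only [indicator_of_mem h1, smul_eq_mul]
      have : (t : ℂ) ≠ 0 := by exact_mod_cast ne_of_gt ht
      rw [← Complex.cpow_add _ _ this]
      congr 1
      ring
    · simp [indicator_of_notMem h1]
  constructor
  · rw [MellinConvergent, integrableOn_congr_fun e measurableSet_Ioi,
      integrableOn_indicator_iff measurableSet_Ioi]
    exact (integrableOn_Ioi_cpow_of_lt hs' one_pos).mono_set inter_subset_left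
  · rw [mellin, setIntegral_congr_fun measurableSet_Ioi e, setIntegral_indicator measurableSet_Ioi,
      inter_eq_self_of_subset_right (Ioi_subset_Ioi zero_le_one), integral_Ioi_cpow_of_lt hs' one_pos]
    simp [neg_div]

lemma isOpen_strip (b a : ℝ) : IsOpen {s : ℂ | b < s.re ∧ s.re < a} :=
  (isOpen_lt continuous_const Complex.continuous_re).inter
    (isOpen_lt Complex.continuous_re continuous_const)

lemma isPreconnected_strip (b a : ℝ) : IsPreconnected {s : ℂ | b < s.re ∧ s.re < a} :=
  ((convex_halfSpace_re_gt b).inter (convex_halfSpace_re_lt a)).isPreconnected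

lemma continuousOn_ofReal_cpow (p : ℂ) : ContinuousOn (fun x : ℝ => (x : ℂ) ^ p) (Ioi 0) :=
  fun t ht => (Complex.continuousAt_ofReal_cpow_const t _ (Or.inr (ne_of_gt ht))).continuousWithinAt

/-- If `f` is `c₁ x^(-p) + c₂ x^(-q)` up to a smaller error at `0`, then subtracting these two terms
continues the Mellin transform of `f` to a strip to the left. -/
lemma mellin_sub_eq {f F : ℝ → ℂ} {W : ℂ → ℂ} {p q c₁ c₂ : ℂ} {a b : ℝ}
    (hF : F = fun x => f x - c₁ * (x : ℂ) ^ (-p) - c₂ * (x : ℂ) ^ (-q))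
    (hf : ContinuousOn f (Ioi 0)) (htop : f =O[atTop] (fun x => x ^ (-a)))
    (hbot : F =O[𝓝[>] 0] (fun x => x ^ (-b))) (hqp : q.re ≤ p.re) (hpa : p.re < a)
    (hW : MeromorphicOn W {s : ℂ | b < s.re ∧ s.re < a})
    (heq : ∀ s : ℂ, p.re < s.re → s.re < a → mellin f s = W s) {s : ℂ} (hbs : b < s.re)
    (hsq : s.re < q.re) (han : AnalyticAt ℂ W s) :
    MellinConvergent F s ∧ mellin F s = W s := by
  set V := {s : ℂ | b < s.re ∧ s.re < a}
  set i₁ : ℝ → ℂ := indicator (Ioc 0 1) (fun t => (t : ℂ) ^ (-p) : ℝ → ℂ)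
  set i₂ : ℝ → ℂ := indicator (Ioc 0 1) (fun t => (t : ℂ) ^ (-q) : ℝ → ℂ)
  -- Removing the powers on (0, 1] only improves the behaviour at 0 without spoiling infinity, so
  -- the transform of `g` is holomorphic on the whole strip. To the right its explicit correction
  -- terms restore f; to the left, removing the powers on (1, ∞) as well gives `F`, and the
  -- corrections cancel.
  set g : ℝ → ℂ := fun x => f x - c₁ • i₁ x - c₂ • i₂ x with hg
  have hm : ∀ p : ℂ, LocallyIntegrableOn (indicator (Ioc 0 1) (fun t => (t : ℂ) ^ (-p) : ℝ → ℂ))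
      (Ioi 0) := fun p => by
    have := (continuousOn_ofReal_cpow (-p)).locallyIntegrableOn (μ := volume) measurableSet_Ioi
    intro x hx
    obtain ⟨u, hu, hi⟩ := this x hx
    exact ⟨u, hu, hi.indicator measurableSet_Ioc⟩
  have hgl : LocallyIntegrableOn g (Ioi 0) :=
    ((hf.locallyIntegrableOn measurableSet_Ioi).sub ((hm p).smul c₁)).sub ((hm q).smul c₂)
  have hgt : g =O[atTop] (fun x => x ^ (-a)) := by
    refine htop.congr' ?_ EventuallyEq.rfl
    filter_upwards [eventually_gt_atTop 1] with x hx
    have : x ∉ Ioc (0 : ℝ) 1 := fun h => absurd h.2 (not_le.mpr hx)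
    simp [hg, i₁, i₂, indicator_of_notMem this]
  have hgb : g =O[𝓝[>] 0] (fun x => x ^ (-b)) := by
    refine hbot.congr' ?_ EventuallyEq.rfl
    filter_upwards [Ioc_mem_nhdsGT (zero_lt_one : (0 : ℝ) < 1)] with x hx
    simp [hF, hg, i₁, i₂, indicator_of_mem hx]
  have hgc : ∀ s ∈ V, MellinConvergent g s := fun s hs =>
    mellinConvergent_of_isBigO_rpow hgl hgt hs.2 hgb hs.1
  have hgd : DifferentiableOn ℂ (mellin g) V := fun s hs =>
    (mellin_differentiableAt_of_isBigO_rpow hgl hgt hs.2 hgb hs.1).differentiableWithinAt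
  have hVo : IsOpen V := isOpen_strip b a
  have hga : AnalyticOnNhd ℂ (mellin g) V := hgd.analyticOnNhd hVo
  have h1 : ∀ s : ℂ, p.re < s.re → s.re < a →
      (fun s => mellin g s + c₁ * (1 / (s + -p)) + c₂ * (1 / (s + -q))) s = W s := fun s hs hsa => by
    have hp := hasMellin_const_smul (hasMellin_cpow_Ioc (-p) (s := s) (by simp; linarith)).1 c₁
    have hq := hasMellin_const_smul (hasMellin_cpow_Ioc (-q) (s := s) (by simp; linarith)).1 c₂
    have h2 := hasMellin_add (hgc s ⟨by linarith, hsa⟩) hp.1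
    have h3 := hasMellin_add h2.1 hq.1
    rw [← heq s hs hsa]
    have e : f = fun x => g x + c₁ • i₁ x + c₂ • i₂ x := by
      ext x
      simp only [hg]
      ring
    rw [e, h3.2, h2.2, hp.2, hq.2, (hasMellin_cpow_Ioc (-p) (s := s) (by simp; linarith)).2,
      (hasMellin_cpow_Ioc (-q) (s := s) (by simp; linarith)).2]
    rfl
  have hsV : s ∈ V := ⟨hbs, by linarith⟩
  have hne : ∀ r : ℂ, s.re < r.re → s + -r ≠ 0 := fun r hr h0 => by
    have := congrArg Complex.re h0
    simp at this
    linarith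
  have hmero : ∀ r c : ℂ, Meromorphic fun s : ℂ => c * (1 / (s + -r)) := fun r c s => by fun_prop
  have hmid : ((((p.re + a) / 2 : ℝ) : ℂ)).re = (p.re + a) / 2 := Complex.ofReal_re _
  have h4 := eventuallyEq_of_meromorphicOn (f := fun s => mellin g s + c₁ * (1 / (s + -p)) +
      c₂ * (1 / (s + -q))) (g := W) (U := V) (p := (((p.re + a) / 2 : ℝ) : ℂ)) (x := s)
      (fun t ht => (((hga t ht).meromorphicAt).add (hmero p c₁ t)).add (hmero q c₂ t)) hW
      (isPreconnected_strip b a) ⟨by rw [hmid]; linarith, by rw [hmid]; linarith⟩ hsV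
      (mem_nhdsWithin_of_mem_nhds (mem_of_superset ((isOpen_strip p.re a).mem_nhds
        ⟨by rw [hmid]; linarith, by rw [hmid]; linarith⟩) fun t ht => h1 t ht.1 ht.2))
      (AnalyticAt.meromorphicNFAt (((hga s hsV).add (analyticAt_const.mul
        (analyticAt_const.div (analyticAt_id.add analyticAt_const) (hne p (by linarith))))).add
        (analyticAt_const.mul (analyticAt_const.div (analyticAt_id.add analyticAt_const)
        (hne q hsq))))) han.meromorphicNFAt
  have hp := hasMellin_const_smul (hasMellin_cpow_Ioi (a := -p) (s := s) (by simp; linarith)).1 c₁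
  have hq := hasMellin_const_smul (hasMellin_cpow_Ioi (a := -q) (s := s) (by simp; linarith)).1 c₂
  have h2 := hasMellin_sub (hgc s hsV) hp.1
  have h3 := hasMellin_sub h2.1 hq.1
  have e : EqOn F (fun x => g x - c₁ • indicator (Ioi 1) (fun t => (t : ℂ) ^ (-p) : ℝ → ℂ) x -
      c₂ • indicator (Ioi 1) (fun t => (t : ℂ) ^ (-q) : ℝ → ℂ) x) (Ioi 0) := fun x hx => by
    rcases le_or_gt x 1 with hx1 | hx1
    · have m1 : x ∈ Ioc (0 : ℝ) 1 := ⟨hx, hx1⟩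
      have m2 : x ∉ Ioi (1 : ℝ) := not_lt.mpr hx1
      simp [hF, hg, i₁, i₂, indicator_of_mem m1, indicator_of_notMem m2]
    · have m1 : x ∉ Ioc (0 : ℝ) 1 := fun h => absurd h.2 (not_le.mpr hx1)
      have m2 : x ∈ Ioi (1 : ℝ) := hx1
      simp [hF, hg, i₁, i₂, indicator_of_notMem m1, indicator_of_mem m2]
  have e' : EqOn (fun x : ℝ => (x : ℂ) ^ (s - 1) • F x) _ (Ioi 0) := fun x hx =>
    congrArg ((x : ℂ) ^ (s - 1) • ·) (e hx)
  constructor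
  · rw [MellinConvergent, integrableOn_congr_fun e' measurableSet_Ioi]
    exact h3.1
  · rw [← h4.eq_of_nhds]
    have : mellin F s = _ := setIntegral_congr_fun measurableSet_Ioi e'
    rw [this]
    refine h3.2.trans ?_
    rw [h2.2, hp.2, hq.2, (hasMellin_cpow_Ioi (a := -p) (s := s) (by simp; linarith)).2,
      (hasMellin_cpow_Ioi (a := -q) (s := s) (by simp; linarith)).2, smul_eq_mul, smul_eq_mul]
    ring

/-! ### Explicit integrals -/

/-- The Beta integral B(1/3, 1/3) is symmetric under x ↦ 1 - x, so half of its range carries half of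
its value. -/
lemma integral_half_beta : 2 * ∫ x in (0 : ℝ)..(1 / 2), (x : ℂ) ^ (-(2 / 3) : ℂ) *
    (1 - (x : ℂ)) ^ (-(2 / 3) : ℂ) = Complex.Gamma (1 / 3) ^ 2 / Complex.Gamma (2 / 3) := by
  have hg : Complex.Gamma (2 / 3) ≠ 0 := Complex.Gamma_ne_zero_of_re_pos (by norm_num)
  have h1 := Complex.Gamma_mul_Gamma_eq_betaIntegral (s := 1 / 3) (t := 1 / 3) (by norm_num)
    (by norm_num)
  have hc := Complex.betaIntegral_convergent (u := 1 / 3) (v := 1 / 3) (by norm_num) (by norm_num)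
  rw [Complex.betaIntegral] at h1
  norm_num only at h1 hc
  rw [eq_div_iff hg, pow_two, h1, mul_comm]
  congr 1
  set φ : ℝ → ℂ := fun x => (x : ℂ) ^ (-(2 / 3) : ℂ) * (1 - (x : ℂ)) ^ (-(2 / 3) : ℂ) with hφ
  have h2 : ∫ x in (0 : ℝ)..(1 / 2), φ (1 - x) = ∫ x in (1 / 2 : ℝ)..1, φ x := by
    rw [intervalIntegral.integral_comp_sub_left φ 1]
    norm_num
  have h3 : ∫ x in (0 : ℝ)..(1 / 2), φ (1 - x) = ∫ x in (0 : ℝ)..(1 / 2), φ x := by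
    congr 1
    ext x
    simp only [hφ]
    push_cast
    rw [sub_sub_cancel, mul_comm]
  have h4 : IntervalIntegrable φ volume 0 (1 / 2) :=
    IntervalIntegrable.mono_set (b := 1) (a := 0) hc (by
      rw [uIcc_of_le (by norm_num), uIcc_of_le (by norm_num)]
      exact Icc_subset_Icc le_rfl (by norm_num))
  have h5 : IntervalIntegrable φ volume (1 / 2) 1 :=
    IntervalIntegrable.mono_set (b := 1) (a := 0) hc (by
      rw [uIcc_of_le (by norm_num), uIcc_of_le (by norm_num)]
      exact Icc_subset_Icc (by norm_num) le_rfl)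
  rw [← intervalIntegral.integral_add_adjacent_intervals h4 h5, ← h2, h3, two_mul]

/-- Substitute x = 1/(1 + v), which sends (1, ∞) to (0, 1/2). -/
lemma integral_Ioi_one_mul_one_add : ∫ v in Ioi (1 : ℝ), ((v * (1 + v) : ℝ) : ℂ) ^ (-(2 / 3) : ℂ) =
    ∫ x in (0 : ℝ)..(1 / 2), (x : ℂ) ^ (-(2 / 3) : ℂ) * (1 - (x : ℂ)) ^ (-(2 / 3) : ℂ) := by
  have him : (fun x : ℝ => x⁻¹ - 1) '' Ioo 0 (1 / 2) = Ioi 1 := by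
    ext v
    constructor
    · rintro ⟨x, hx, rfl⟩
      show (1 : ℝ) < x⁻¹ - 1
      have : 2 < x⁻¹ := by
        rw [lt_inv_comm₀ (by norm_num) hx.1]
        linarith [hx.2]
      linarith
    · intro hv
      have hv' : (1 : ℝ) < v := hv
      refine ⟨(1 + v)⁻¹, ⟨by positivity, ?_⟩, by simp⟩
      rw [inv_lt_comm₀ (by positivity) (by norm_num)]
      norm_num
      linarith
  have hinj : InjOn (fun x : ℝ => x⁻¹ - 1) (Ioo 0 (1 / 2)) := fun a _ b _ hab => by
    simpa using hab
  have hd : ∀ x ∈ Ioo (0 : ℝ) (1 / 2), HasDerivWithinAt (fun x : ℝ => x⁻¹ - 1) (-(x ^ 2)⁻¹)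
      (Ioo 0 (1 / 2)) x := fun x hx => ((hasDerivAt_inv hx.1.ne').sub_const 1).hasDerivWithinAt
  rw [← him, integral_image_eq_integral_abs_deriv_smul measurableSet_Ioo hd hinj,
    intervalIntegral.integral_of_le (by norm_num), integral_Ioc_eq_integral_Ioo]
  refine setIntegral_congr_fun measurableSet_Ioo fun x hx => ?_
  have hx0 : 0 < x := hx.1
  have hx1 : 0 < 1 - x := by linarith [hx.2]
  have e1 : (x⁻¹ - 1) * (1 + (x⁻¹ - 1)) = x⁻¹ ^ 2 * (1 - x) := by
    field_simp
    ring
  have e2 : (1 - (x : ℂ)) = ((1 - x : ℝ) : ℂ) := by push_cast; rfl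
  have e3 : (-(2 / 3) : ℂ) = ((-(2 / 3) : ℝ) : ℂ) := by push_cast; rfl
  rw [e1, abs_neg, abs_of_pos (by positivity), e2, e3, ← Complex.ofReal_cpow (by positivity),
    ← Complex.ofReal_cpow hx0.le, ← Complex.ofReal_cpow hx1.le, Complex.real_smul,
    ← Complex.ofReal_mul, ← Complex.ofReal_mul, Real.mul_rpow (by positivity) hx1.le, ← mul_assoc]
  congr 2
  rw [inv_pow, ← Real.rpow_natCast, ← Real.rpow_neg hx0.le, ← Real.rpow_mul hx0.le,
    ← Real.rpow_add hx0]
  norm_num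

lemma integral_Ioi_two_rpow : ∫ y in Ioi (2 : ℝ), ((√(1 + 4 * y))⁻¹ : ℝ) •
    (y : ℂ) ^ (-(2 / 3) : ℂ) = Complex.Gamma (1 / 3) ^ 2 / (2 * Complex.Gamma (2 / 3)) := by
  rw [← integral_comp_mul_one_add fun y => (y : ℂ) ^ (-(2 / 3) : ℂ), integral_Ioi_one_mul_one_add]
  have := integral_half_beta
  rw [mul_comm 2 (Complex.Gamma _), ← div_div, ← this]
  ring

/-! ### The kernel of the substitution against its leading term -/

/-- The difference between `1_{y > 2} (1 + 4 y)^(-1/2)` and its leading term `(4 y)^(-1/2)`. -/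
noncomputable def kernelDiff (y : ℝ) : ℝ :=
  indicator (Ioi 2) (fun y => (√(1 + 4 * y))⁻¹) y - (2 * √y)⁻¹

lemma measurable_kernelDiff : Measurable kernelDiff := by
  unfold kernelDiff
  exact (Measurable.indicator (by fun_prop) measurableSet_Ioi).sub (by fun_prop)

lemma kernelDiff_of_le {y : ℝ} (hy : y ≤ 2) : kernelDiff y = -(2 * √y)⁻¹ := by
  have : y ∉ Ioi (2 : ℝ) := not_lt.mpr hy
  simp [kernelDiff, indicator_of_notMem this]

lemma kernelDiff_of_lt {y : ℝ} (hy : 2 < y) : kernelDiff y = (√(1 + 4 * y))⁻¹ - (2 * √y)⁻¹ := by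
  have : y ∈ Ioi (2 : ℝ) := hy
  simp [kernelDiff, indicator_of_mem this]

lemma rpow_neg_three_half {y : ℝ} (hy : 0 < y) : y ^ (-(3 / 2) : ℝ) = (√y ^ 3)⁻¹ := by
  rw [Real.rpow_neg hy.le, Real.sqrt_eq_rpow, ← Real.rpow_natCast, ← Real.rpow_mul hy.le]
  norm_num

/-- For y ≤ 2 the claim is exactly y ≤ 2, so the cut-off costs nothing. For y > 2 rationalising uses
(1 + 4y) - 4y = 1 and gives a bound of order y^(-3/2). -/
lemma abs_kernelDiff_le {y : ℝ} (hy : 0 < y) : |kernelDiff y| ≤ y ^ (-(3 / 2) : ℝ) := by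
  have hr : 0 < √y := Real.sqrt_pos.mpr hy
  have hr2 := Real.sq_sqrt hy.le
  rw [rpow_neg_three_half hy]
  rcases le_or_gt y 2 with h | h
  · rw [kernelDiff_of_le h, abs_neg, abs_of_pos (by positivity)]
    refine inv_anti₀ (by positivity) ?_
    nlinarith
  · have hq2 := Real.sq_sqrt (show 0 ≤ 1 + 4 * y by linarith)
    have hq : 2 * √y ≤ √(1 + 4 * y) := Real.le_sqrt_of_sq_le (by nlinarith)
    have hq0 : 0 < √(1 + 4 * y) := by linarith
    rw [kernelDiff_of_lt h, abs_sub_comm, abs_of_nonneg (sub_nonneg.mpr (inv_anti₀ (by positivity) hq))]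
    have e : (2 * √y)⁻¹ - (√(1 + 4 * y))⁻¹ =
        (2 * √y * √(1 + 4 * y) * (√(1 + 4 * y) + 2 * √y))⁻¹ := by
      have : 0 < √(1 + 4 * y) + 2 * √y := by positivity
      field_simp
      nlinarith
    rw [e]
    refine inv_anti₀ (by positivity) ?_
    have h1 : 2 * √y * (2 * √y) ≤ 2 * √y * √(1 + 4 * y) := by gcongr
    have h2 : 2 * √y * (2 * √y) * (2 * √y + 2 * √y) ≤
      2 * √y * √(1 + 4 * y) * (√(1 + 4 * y) + 2 * √y) := by gcongr
    nlinarith [pow_pos hr 3]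

lemma integral_kernelDiff_Ioc : IntegrableOn kernelDiff (Ioc 0 2) ∧
    ∫ y in Ioc (0 : ℝ) 2, kernelDiff y = -√2 := by
  have e : EqOn kernelDiff (fun y => -(1 / 2) * y ^ (-(1 / 2) : ℝ)) (Ioc 0 2) := fun y hy => by
    simp only
    rw [kernelDiff_of_le hy.2, Real.rpow_neg hy.1.le, Real.sqrt_eq_rpow]
    ring
  have hi : IntervalIntegrable (fun y : ℝ => y ^ (-(1 / 2) : ℝ)) volume 0 2 :=
    intervalIntegral.intervalIntegrable_rpow' (by norm_num)
  constructor
  · rw [integrableOn_congr_fun e measurableSet_Ioc]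
    exact ((intervalIntegrable_iff_integrableOn_Ioc_of_le (by norm_num)).mp hi).const_mul _
  · rw [setIntegral_congr_fun measurableSet_Ioc e, ← intervalIntegral.integral_of_le (by norm_num),
      intervalIntegral.integral_const_mul, integral_rpow (Or.inl (by norm_num)), Real.sqrt_eq_rpow]
    norm_num
    ring

lemma integral_kernelDiff_Ioi : IntegrableOn kernelDiff (Ioi 2) ∧
    ∫ y in Ioi (2 : ℝ), kernelDiff y = √2 - 3 / 2 := by
  set F : ℝ → ℝ := fun y => 1 / 2 * √(1 + 4 * y) - √y
  have hd : ∀ y ∈ Ici (2 : ℝ), HasDerivAt F ((√(1 + 4 * y))⁻¹ - (2 * √y)⁻¹) y := fun y hy => by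
    have hy' : (2 : ℝ) ≤ y := hy
    have h1 : HasDerivAt (fun y : ℝ => 1 + 4 * y) 4 y :=
      (((hasDerivAt_id y).const_mul 4).const_add 1).congr_deriv (by simp)
    refine (((h1.sqrt (by linarith)).const_mul (1 / 2)).fun_sub
      (Real.hasDerivAt_sqrt (by linarith : y ≠ 0))).congr_deriv ?_
    field_simp
    ring
  have hneg : ∀ y ∈ Ioi (2 : ℝ), (√(1 + 4 * y))⁻¹ - (2 * √y)⁻¹ ≤ 0 := fun y hy => by
    have hy' : (2 : ℝ) < y := hy
    have hr : 0 < √y := Real.sqrt_pos.mpr (by linarith)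
    have hr2 := Real.sq_sqrt (show 0 ≤ y by linarith)
    exact sub_nonpos.mpr (inv_anti₀ (by positivity) (Real.le_sqrt_of_sq_le (by nlinarith)))
  have ht : Tendsto F atTop (𝓝 0) := by
    refine squeeze_zero_norm' (a := fun y => (√y)⁻¹) ?_ (tendsto_inv_atTop_zero.comp
      Real.tendsto_sqrt_atTop)
    filter_upwards [eventually_gt_atTop 2] with y hy
    have hr : 0 < √y := Real.sqrt_pos.mpr (by linarith)
    have hr2 := Real.sq_sqrt (show 0 ≤ y by linarith)
    have hq2 := Real.sq_sqrt (show 0 ≤ 1 + 4 * y by linarith)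
    have hq : 2 * √y ≤ √(1 + 4 * y) := Real.le_sqrt_of_sq_le (by nlinarith)
    have h0 : 0 ≤ F y := by simp only [F]; linarith
    show ‖F y‖ ≤ (√y)⁻¹
    rw [Real.norm_of_nonneg h0, ← one_div, le_div_iff₀ hr]
    simp only [F]
    have h1 : (√(1 + 4 * y) - 2 * √y) * (4 * √y) ≤
        (√(1 + 4 * y) - 2 * √y) * (√(1 + 4 * y) + 2 * √y) :=
      mul_le_mul_of_nonneg_left (by linarith) (by linarith)
    nlinarith
  have e : EqOn kernelDiff (fun y => (√(1 + 4 * y))⁻¹ - (2 * √y)⁻¹) (Ioi 2) := fun y hy =>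
    kernelDiff_of_lt hy
  constructor
  · rw [integrableOn_congr_fun e measurableSet_Ioi]
    exact integrableOn_Ioi_deriv_of_nonpos' hd hneg ht
  · rw [setIntegral_congr_fun measurableSet_Ioi e, integral_Ioi_of_hasDerivAt_of_nonpos' hd hneg ht]
    simp only [F]
    rw [show (1 : ℝ) + 4 * 2 = 3 ^ 2 by norm_num, Real.sqrt_sq (by norm_num)]
    ring

/-- The contributions ±√2 of the comparison kernel cancel at the cut, leaving minus the value of the
antiderivative √(1 + 4y)/2 at y = 2. -/
lemma integral_kernelDiff : IntegrableOn kernelDiff (Ioi 0) ∧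
    ∫ y in Ioi (0 : ℝ), kernelDiff y = -(3 / 2) := by
  obtain ⟨h1, h2⟩ := integral_kernelDiff_Ioc
  obtain ⟨h3, h4⟩ := integral_kernelDiff_Ioi
  rw [← Ioc_union_Ioi_eq_Ioi (zero_le_two : (0 : ℝ) ≤ 2)]
  refine ⟨h1.union h3, ?_⟩
  rw [setIntegral_union (Ioc_disjoint_Ioi le_rfl) measurableSet_Ioi h1 h3, h2, h4]
  ring

lemma integrableOn_min_rpow :
    IntegrableOn (fun y : ℝ => min 1 (y ^ (3 / 5 : ℝ)) * y ^ (-(3 / 2) : ℝ)) (Ioi 0) := by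
  rw [← Ioc_union_Ioi_eq_Ioi (zero_le_one : (0 : ℝ) ≤ 1)]
  refine IntegrableOn.union ?_ ?_
  · have hi : IntervalIntegrable (fun y : ℝ => y ^ (-(9 / 10) : ℝ)) volume 0 1 :=
      intervalIntegral.intervalIntegrable_rpow' (by norm_num)
    refine ((intervalIntegrable_iff_integrableOn_Ioc_of_le (by norm_num)).mp hi).congr_fun
      (fun y hy => ?_) measurableSet_Ioc
    simp only
    rw [min_eq_right (Real.rpow_le_one hy.1.le hy.2 (by norm_num)), ← Real.rpow_add hy.1]
    norm_num
  · refine (integrableOn_Ioi_rpow_of_lt (a := -(3 / 2)) (by norm_num) one_pos).congr_fun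
      (fun y hy => ?_) measurableSet_Ioi
    simp only
    rw [min_eq_left (Real.one_le_rpow (le_of_lt hy) (by norm_num)), one_mul]

/-! ### The remainder of the cube sum and the expansion of the heat trace -/

/-- `cubeSum` minus its leading singularity. -/
noncomputable def cubeRem (ξ : ℂ) : ℂ :=
  cubeSum ξ - Complex.Gamma (2 / 3) / 3 * ξ ^ (-(2 / 3) : ℂ)

lemma norm_cpow_neg_two_third (z : ℂ) :
    ‖z ^ (-(2 / 3) : ℂ)‖ = ‖z‖ ^ (-(2 / 3) : ℝ) := by
  rw [← Complex.norm_cpow_real]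
  push_cast
  rfl

lemma exists_cubeRem_le : ∃ K : ℝ, 0 < K ∧ ∀ ξ : ℂ, InSector ξ →
    ‖cubeRem ξ + 1 / 12‖ ≤ K * min 1 (‖ξ‖ ^ (3 / 5 : ℝ)) := by
  obtain ⟨K₁, hK₁, h₁⟩ := exists_cubeSum_sub_le
  obtain ⟨K₂, hK₂, h₂⟩ := exists_norm_cubeSum_le 0
  set a := ‖Complex.Gamma (2 / 3) / 3‖
  have ha : 0 ≤ a := norm_nonneg _
  refine ⟨max K₁ (4 * K₂ + a + 1), lt_max_of_lt_left hK₁, fun ξ hξ => ?_⟩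
  rcases le_or_gt ‖ξ‖ 1 with h | h
  · rw [min_eq_right (Real.rpow_le_one (norm_nonneg _) h (by norm_num))]
    exact (h₁ ξ hξ h).trans (mul_le_mul_of_nonneg_right (le_max_left _ _) (by positivity))
  · rw [min_eq_left (Real.one_le_rpow h.le (by norm_num)), mul_one]
    refine le_trans ?_ (le_max_right _ _)
    have hre : 1 / 4 ≤ ξ.re := by linarith [hξ.2]
    have h3 := h₂ ξ hξ.1
    have h4 : ξ.re ^ (-(((0 : ℕ) : ℝ) + 1)) ≤ 4 := by
      norm_num only [Nat.cast_zero, zero_add]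
      rw [Real.rpow_neg_one, inv_le_comm₀ hξ.1 (by norm_num)]
      linarith
    have h5 : ‖ξ ^ (-(2 / 3) : ℂ)‖ ≤ 1 := by
      rw [norm_cpow_neg_two_third ξ]
      exact Real.rpow_le_one_of_one_le_of_nonpos h.le (by norm_num)
    rw [cubeRem]
    refine (norm_add_le _ _).trans (add_le_add ((norm_sub_le _ _).trans (add_le_add ?_ ?_)) ?_)
    · nlinarith
    · rw [norm_mul]
      exact mul_le_of_le_one_right ha h5
    · norm_num

lemma continuousOn_cubeSum_ray {z : ℂ} (hz : 0 < z.re) :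
    ContinuousOn (fun y : ℝ => cubeSum (y * z)) (Ioi 0) := by
  refine differentiableOn_cubeSum.continuousOn.comp (by fun_prop) fun y hy => ?_
  show 0 < ((y : ℂ) * z).re
  rw [Complex.re_ofReal_mul]
  exact mul_pos hy hz

lemma cubeRem_ray {z : ℂ} (hz : z ≠ 0) {y : ℝ} (hy : 0 < y) : cubeRem (y * z) =
    cubeSum (y * z) - Complex.Gamma (2 / 3) / 3 * z ^ (-(2 / 3) : ℂ) * (y : ℂ) ^ (-(2 / 3) : ℂ) := by
  rw [cubeRem, ofReal_mul_cpow hy hz]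
  ring

lemma continuousOn_cubeRem_ray {z : ℂ} (hz : 0 < z.re) :
    ContinuousOn (fun y : ℝ => cubeRem (y * z)) (Ioi 0) := by
  have hz0 : z ≠ 0 := fun h0 => by simp [h0] at hz
  exact ((continuousOn_cubeSum_ray hz).sub ((continuousOn_ofReal_cpow _).const_mul _)).congr
    fun y hy => cubeRem_ray hz0 hy

/-- The Mellin transform of `cubeRem` at `1/2`, by continuation. -/
lemma mellin_cubeRem {z : ℂ} (hz : InSector z) :
    MellinConvergent (fun y : ℝ => cubeRem (y * z)) (1 / 2) ∧
    mellin (fun y : ℝ => cubeRem (y * z)) (1 / 2) =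
      Complex.Gamma (1 / 2) * z ^ (-(1 / 2) : ℂ) * riemannZeta (1 / 2) := by
  obtain ⟨K₁, hK₁, h₁⟩ := exists_cubeRem_le
  obtain ⟨K₂, hK₂, h₂⟩ := exists_norm_cubeSum_le 0
  have hz0 := hz.ne_zero
  set c : ℂ := Complex.Gamma (2 / 3) / 3 * z ^ (-(2 / 3) : ℂ) with hc
  -- Only one power has to be removed, while `mellin_sub_eq` expects two. The second gets
  -- coefficient 0 and the dummy exponent 7/12, which lies between the evaluation point 1/2 and 2/3
  -- as that lemma requires.
  set F : ℝ → ℂ := fun y => cubeSum (y * z) - c * (y : ℂ) ^ (-(2 / 3) : ℂ) -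
    0 * (y : ℂ) ^ (-(7 / 12) : ℂ) with hF
  have hFe : ∀ y ∈ Ioi (0 : ℝ), cubeRem (y * z) = F y := fun y hy => by
    rw [cubeRem_ray hz0 hy, hF]
    simp [hc]
  have htop : (fun y : ℝ => cubeSum (y * z)) =O[atTop] (fun y => y ^ (-1 : ℝ)) := by
    refine IsBigO.of_bound (K₂ * z.re ^ (-1 : ℝ)) ?_
    filter_upwards [eventually_gt_atTop 0] with y hy
    have h3 := h₂ (y * z) (by rw [Complex.re_ofReal_mul]; exact mul_pos hy hz.1)
    rw [Complex.re_ofReal_mul] at h3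
    norm_num only [Nat.cast_zero, zero_add] at h3
    rw [Real.mul_rpow hy.le hz.1.le] at h3
    rw [Real.norm_of_nonneg (by positivity)]
    exact h3.trans_eq (by ring)
  have hbot : F =O[𝓝[>] 0] (fun y => y ^ (-0 : ℝ)) := by
    refine IsBigO.of_bound (K₁ + 1) ?_
    filter_upwards [self_mem_nhdsWithin] with y hy
    rw [← hFe y hy, neg_zero, Real.rpow_zero, norm_one, mul_one]
    have h3 := h₁ _ (hz.real_mul hy)
    have h4 : K₁ * min 1 (‖(y : ℂ) * z‖ ^ (3 / 5 : ℝ)) ≤ K₁ :=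
      mul_le_of_le_one_right hK₁.le (min_le_left _ _)
    calc ‖cubeRem (y * z)‖ = ‖(cubeRem (y * z) + 1 / 12) - 1 / 12‖ := by ring_nf
      _ ≤ _ := (norm_sub_le _ _).trans (add_le_add (h3.trans h4) (by norm_num))
  set W : ℂ → ℂ := fun s => Complex.Gamma s * z ^ (-s) * riemannZeta (3 * s - 1) with hW
  have hdiff : ∀ s : ℂ, 0 < s.re → s ≠ 2 / 3 → DifferentiableAt ℂ W s := fun s hs hs1 => by
    have hG : DifferentiableAt ℂ Complex.Gamma s := Complex.differentiableAt_Gamma _ fun m hm => by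
      rw [hm] at hs
      simp at hs
      linarith [Nat.cast_nonneg (α := ℝ) m]
    have hζ : DifferentiableAt ℂ riemannZeta (3 * s - 1) := differentiableAt_riemannZeta fun h => by
      apply hs1
      linear_combination h / 3
    have h3 : DifferentiableAt ℂ (fun s : ℂ => 3 * s - 1) s := by fun_prop
    exact (hG.mul (differentiableAt_id.neg.const_cpow (Or.inl hz0))).mul
      (DifferentiableAt.fun_comp' s hζ h3)
  have hopen : IsOpen {s : ℂ | 0 < s.re ∧ s.re < 2 / 3} := isOpen_strip _ _
  have han : AnalyticAt ℂ W (1 / 2) := by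
    refine DifferentiableOn.analyticAt (s := {s : ℂ | 0 < s.re ∧ s.re < 2 / 3}) (fun s hs =>
      (hdiff s hs.1 fun h => ?_).differentiableWithinAt) (hopen.mem_nhds ⟨by norm_num, by norm_num⟩)
    have := hs.2
    rw [h] at this
    norm_num at this
  have hmero : MeromorphicOn W {s : ℂ | 0 < s.re ∧ s.re < 1} := fun s hs => by
    have hd : DifferentiableOn ℂ (fun s : ℂ => Complex.Gamma s * z ^ (-s)) {s : ℂ | 0 < s.re} :=
      fun s hs => by
      have hG : DifferentiableAt ℂ Complex.Gamma s := Complex.differentiableAt_Gamma _ fun m hm => by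
        have hs' : 0 < s.re := hs
        rw [hm] at hs'
        simp at hs'
        linarith [Nat.cast_nonneg (α := ℝ) m]
      exact (hG.mul (differentiableAt_id.neg.const_cpow (Or.inl hz0))).differentiableWithinAt
    have h1 := (hd.analyticAt ((isOpen_halfPlane 0).mem_nhds hs.1)).meromorphicAt
    have h2 : MeromorphicAt (fun s : ℂ => riemannZeta (3 * s - 1)) s :=
      MeromorphicAt.comp_analyticAt (meromorphicAt_riemannZeta _) (by fun_prop)
    exact h1.mul h2
  have hre : (2 / 3 : ℂ).re = 2 / 3 := by norm_num
  have hre' : (7 / 12 : ℂ).re = 7 / 12 := by norm_num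
  obtain ⟨hc1, hc2⟩ := mellin_sub_eq (f := fun y : ℝ => cubeSum (y * z)) (F := F) (W := W)
    (p := 2 / 3) (q := 7 / 12) (c₁ := c) (c₂ := 0) (a := 1) (b := 0) (s := 1 / 2) rfl
    (continuousOn_cubeSum_ray hz.1) htop hbot (by rw [hre, hre']; norm_num)
    (by rw [hre]; norm_num) hmero (fun s hs _ => mellin_cubeSum hz.1 (by rwa [hre] at hs))
    (by norm_num) (by rw [hre']; norm_num) han
  have e : EqOn (fun y : ℝ => (y : ℂ) ^ ((1 / 2 : ℂ) - 1) • cubeRem (y * z))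
      (fun y : ℝ => (y : ℂ) ^ ((1 / 2 : ℂ) - 1) • F y) (Ioi 0) := fun y hy => by
    simp only [hFe y hy]
  constructor
  · rw [MellinConvergent, integrableOn_congr_fun e measurableSet_Ioi]
    exact hc1
  · rw [mellin, setIntegral_congr_fun measurableSet_Ioi e]
    refine hc2.trans ?_
    simp only [hW]
    norm_num

/-- The expansion of the heat trace at the vertex of the sector. -/
lemma exists_heat_expansion : ∃ K : ℝ, 0 < K ∧ ∀ z : ℂ, InSector z → ‖z‖ ≤ 1 / 2 →
    ‖heat z - (Complex.Gamma (1 / 3) ^ 2 / 3 * z ^ (-(2 / 3) : ℂ) +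
      Complex.Gamma (1 / 2) * riemannZeta (1 / 2) * z ^ (-(1 / 2) : ℂ) + 1 / 3)‖ ≤
      K * ‖z‖ ^ (1 / 2 : ℝ) := by
  obtain ⟨K₁, hK₁, h₁⟩ := exists_heat_sub_le
  obtain ⟨K₂, hK₂, h₂⟩ := exists_cubeRem_le
  obtain ⟨hDi, hD⟩ := integral_kernelDiff
  set J := ∫ y in Ioi (0 : ℝ), min 1 (y ^ (3 / 5 : ℝ)) * y ^ (-(3 / 2) : ℝ) with hJ
  have hJ0 : 0 ≤ J := setIntegral_nonneg measurableSet_Ioi fun y hy => by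
    have : (0 : ℝ) < y := hy
    positivity
  refine ⟨K₁ + 2 * K₂ * J, by positivity, fun z hz hz1 => ?_⟩
  have hpos := hz.norm_pos
  have hz0 := hz.ne_zero
  obtain ⟨hM1, hM2⟩ := mellin_cubeRem hz
  have hmain := h₁ z hz hz1 _ (hasSum_inner_integral hz.1)
  -- the kernel against the remainder
  have hbd : ∀ y ∈ Ioi (0 : ℝ), ‖kernelDiff y • (cubeRem (y * z) + 1 / 12)‖ ≤
      K₂ * ‖z‖ ^ (3 / 2 : ℝ) * (min 1 ((y * ‖z‖) ^ (3 / 5 : ℝ)) * (y * ‖z‖) ^ (-(3 / 2) : ℝ)) :=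
    fun y hy => by
    have hy0 : (0 : ℝ) < y := hy
    have h3 := h₂ _ (hz.real_mul hy0)
    rw [norm_mul, Complex.norm_real, Real.norm_of_nonneg hy0.le] at h3
    rw [norm_smul, Real.norm_eq_abs]
    refine (mul_le_mul (abs_kernelDiff_le hy0) h3 (norm_nonneg _) (by positivity)).trans_eq ?_
    have e : ‖z‖ ^ (3 / 2 : ℝ) * ‖z‖ ^ (-(3 / 2) : ℝ) = 1 := by
      rw [← Real.rpow_add hpos]
      norm_num
    rw [Real.mul_rpow (z := -(3 / 2)) hy0.le hpos.le]
    linear_combination (-K₂ * min 1 ((y * ‖z‖) ^ (3 / 5 : ℝ)) * y ^ (-(3 / 2) : ℝ)) * e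
  have hgi : IntegrableOn (fun y : ℝ => K₂ * ‖z‖ ^ (3 / 2 : ℝ) *
      (min 1 ((y * ‖z‖) ^ (3 / 5 : ℝ)) * (y * ‖z‖) ^ (-(3 / 2) : ℝ))) (Ioi 0) := by
    have := (integrableOn_Ioi_comp_mul_right_iff
      (fun y : ℝ => min 1 (y ^ (3 / 5 : ℝ)) * y ^ (-(3 / 2) : ℝ)) 0 hpos).mpr
      (by rw [zero_mul]; exact integrableOn_min_rpow)
    exact this.const_mul _
  have hgJ : ∫ y in Ioi (0 : ℝ), K₂ * ‖z‖ ^ (3 / 2 : ℝ) *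
      (min 1 ((y * ‖z‖) ^ (3 / 5 : ℝ)) * (y * ‖z‖) ^ (-(3 / 2) : ℝ)) = K₂ * J * ‖z‖ ^ (1 / 2 : ℝ) := by
    rw [integral_const_mul, integral_comp_mul_right_Ioi
      (fun y : ℝ => min 1 (y ^ (3 / 5 : ℝ)) * y ^ (-(3 / 2) : ℝ)) 0 hpos, zero_mul, smul_eq_mul]
    have e : ‖z‖ ^ (3 / 2 : ℝ) * ‖z‖⁻¹ = ‖z‖ ^ (1 / 2 : ℝ) := by
      rw [← Real.rpow_neg_one, ← Real.rpow_add hpos]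
      norm_num
    rw [← e]
    ring
  have hmeas : AEStronglyMeasurable (fun y : ℝ => kernelDiff y • (cubeRem (y * z) + 1 / 12))
      (volume.restrict (Ioi 0)) :=
    measurable_kernelDiff.aestronglyMeasurable.smul
      (((continuousOn_cubeRem_ray hz.1).add continuousOn_const).aestronglyMeasurable
        measurableSet_Ioi)
  have hi1 : IntegrableOn (fun y : ℝ => kernelDiff y • (cubeRem (y * z) + 1 / 12)) (Ioi 0) :=
    Integrable.mono' hgi hmeas ((ae_restrict_mem measurableSet_Ioi).mono fun y hy => hbd y hy)
  have hle : ‖∫ y in Ioi (0 : ℝ), kernelDiff y • (cubeRem (y * z) + 1 / 12)‖ ≤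
      K₂ * J * ‖z‖ ^ (1 / 2 : ℝ) := by
    rw [← hgJ]
    exact norm_integral_le_of_norm_le hgi ((ae_restrict_mem measurableSet_Ioi).mono
      fun y hy => hbd y hy)
  have hi2 : IntegrableOn (fun y : ℝ => kernelDiff y • (1 / 12 : ℂ)) (Ioi 0) := hDi.smul_const _
  have hI2 : ∫ y in Ioi (0 : ℝ), kernelDiff y • (1 / 12 : ℂ) = -(1 / 8) := by
    rw [integral_smul_const, hD, Complex.real_smul]
    push_cast
    norm_num
  have hI3 : ∫ y in Ioi (0 : ℝ), ((2 * √y)⁻¹ : ℝ) • cubeRem (y * z) =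
      1 / 2 * (Complex.Gamma (1 / 2) * z ^ (-(1 / 2) : ℂ) * riemannZeta (1 / 2)) ∧
      IntegrableOn (fun y : ℝ => ((2 * √y)⁻¹ : ℝ) • cubeRem (y * z)) (Ioi 0) := by
    have e : EqOn (fun y : ℝ => (1 / 2 : ℂ) * ((y : ℂ) ^ ((1 / 2 : ℂ) - 1) • cubeRem (y * z)))
        (fun y : ℝ => ((2 * √y)⁻¹ : ℝ) • cubeRem (y * z)) (Ioi 0) := fun y hy => by
      have hy0 : (0 : ℝ) < y := hy
      have e1 : ((1 / 2 : ℂ) - 1) = ((-(1 / 2) : ℝ) : ℂ) := by norm_num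
      simp only
      rw [e1, ← Complex.ofReal_cpow hy0.le, Real.rpow_neg hy0.le, ← Real.sqrt_eq_rpow,
        Complex.real_smul, smul_eq_mul, ← mul_assoc]
      congr 1
      push_cast
      rw [mul_inv]
      norm_num
    constructor
    · rw [← setIntegral_congr_fun measurableSet_Ioi e, integral_const_mul, ← hM2]
      rfl
    · rw [← integrableOn_congr_fun e measurableSet_Ioi]
      exact Integrable.const_mul hM1 _
  -- The three contributions: the singular power against the full kernel, the remainder against the
  -- difference of kernels with its limit -1/12 split off, and the remainder against (4y)^(-1/2), a
  -- Mellin transform at 1/2.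
  have hI4 : ∫ y in Ioi (2 : ℝ), ((√(1 + 4 * y))⁻¹ : ℝ) • cubeSum (y * z) =
      Complex.Gamma (2 / 3) / 3 * z ^ (-(2 / 3) : ℂ) *
        (Complex.Gamma (1 / 3) ^ 2 / (2 * Complex.Gamma (2 / 3))) +
      ((∫ y in Ioi (0 : ℝ), kernelDiff y • (cubeRem (y * z) + 1 / 12)) - -(1 / 8) +
      1 / 2 * (Complex.Gamma (1 / 2) * z ^ (-(1 / 2) : ℂ) * riemannZeta (1 / 2))) := by
    have hi12 : IntegrableOn (fun y : ℝ => kernelDiff y • (cubeRem (y * z) + 1 / 12) -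
      kernelDiff y • (1 / 12 : ℂ)) (Ioi 0) := hi1.sub hi2
    rw [← hI2, ← integral_sub hi1 hi2, ← hI3.1, ← integral_add hi12 hI3.2,
      ← integral_Ioi_two_rpow, ← integral_const_mul]
    have e1 : EqOn (fun y : ℝ => kernelDiff y • (cubeRem (y * z) + 1 / 12) -
        kernelDiff y • (1 / 12 : ℂ) + ((2 * √y)⁻¹ : ℝ) • cubeRem (y * z))
        (indicator (Ioi 2) fun y => ((√(1 + 4 * y))⁻¹ : ℝ) • cubeRem (y * z)) (Ioi 0) :=
      fun y _ => by
      by_cases h : y ∈ Ioi (2 : ℝ)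
      · simp only [indicator_of_mem h]
        rw [kernelDiff_of_lt h]
        simp only [Complex.real_smul]
        push_cast
        ring
      · simp only [indicator_of_notMem h]
        rw [kernelDiff_of_le (not_lt.mp h)]
        simp only [Complex.real_smul]
        push_cast
        ring
    have hi3 : IntegrableOn (indicator (Ioi (2 : ℝ)) fun y => ((√(1 + 4 * y))⁻¹ : ℝ) •
        cubeRem (y * z)) (Ioi 0) :=
      ((integrableOn_congr_fun e1 measurableSet_Ioi).mp (hi12.add hI3.2))
    have hsub : Ioi (0 : ℝ) ∩ Ioi 2 = Ioi 2 :=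
      inter_eq_self_of_subset_right (Ioi_subset_Ioi zero_le_two)
    have hi4 : IntegrableOn (fun y => ((√(1 + 4 * y))⁻¹ : ℝ) • cubeRem (y * z)) (Ioi 2) := by
      rw [integrableOn_indicator_iff measurableSet_Ioi, inter_comm, hsub] at hi3
      exact hi3
    rw [setIntegral_congr_fun measurableSet_Ioi e1, setIntegral_indicator measurableSet_Ioi, hsub,
      ← integral_add ?_ hi4]
    · refine setIntegral_congr_fun measurableSet_Ioi fun y hy => ?_
      have hy0 : (0 : ℝ) < y := lt_trans zero_lt_two hy
      rw [cubeRem_ray hz0 hy0]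
      simp only [Complex.real_smul]
      ring
    · refine Integrable.const_mul ?_ _
      -- Integrability comes for free: a divergent integral would have the default value 0, but the
      -- value computed is nonzero.
      by_contra h
      have := integral_Ioi_two_rpow
      rw [integral_undef h] at this
      have h1 : Complex.Gamma (1 / 3) ≠ 0 := Complex.Gamma_ne_zero_of_re_pos (by norm_num)
      have h2 : Complex.Gamma (2 / 3) ≠ 0 := Complex.Gamma_ne_zero_of_re_pos (by norm_num)
      have h3 : Complex.Gamma (1 / 3) ^ 2 / (2 * Complex.Gamma (2 / 3)) ≠ 0 :=
        div_ne_zero (pow_ne_zero 2 h1) (mul_ne_zero two_ne_zero h2)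
      exact h3 this.symm
  rw [hI4] at hmain
  have hg : Complex.Gamma (2 / 3) ≠ 0 := Complex.Gamma_ne_zero_of_re_pos (by norm_num)
  set I := ∫ y in Ioi (0 : ℝ), kernelDiff y • (cubeRem (y * z) + 1 / 12)
  have e : heat z - (Complex.Gamma (1 / 3) ^ 2 / 3 * z ^ (-(2 / 3) : ℂ) +
      Complex.Gamma (1 / 2) * riemannZeta (1 / 2) * z ^ (-(1 / 2) : ℂ) + 1 / 3) =
      (heat z - 2 * (Complex.Gamma (2 / 3) / 3 * z ^ (-(2 / 3) : ℂ) *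
        (Complex.Gamma (1 / 3) ^ 2 / (2 * Complex.Gamma (2 / 3))) + (I - -(1 / 8) +
      1 / 2 * (Complex.Gamma (1 / 2) * z ^ (-(1 / 2) : ℂ) * riemannZeta (1 / 2)))) - 1 / 12) +
      2 * I := by
    field_simp
    ring
  rw [e]
  refine (norm_add_le _ _).trans ((add_le_add hmain (norm_mul_le _ _)).trans ?_)
  rw [Complex.norm_ofNat]
  linarith

/-! ### The remainder of the heat trace -/

/-- The coefficient of `z ^ (-2/3)` in the expansion of the heat trace. -/
noncomputable def heatA : ℂ := Complex.Gamma (1 / 3) ^ 2 / 3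

/-- The coefficient of `z ^ (-1/2)` in the expansion of the heat trace. -/
noncomputable def heatB : ℂ := Complex.Gamma (1 / 2) * riemannZeta (1 / 2)

/-- The heat trace minus its singular part, with the constant term damped at infinity. -/
noncomputable def heatRem (z : ℂ) : ℂ :=
  heat z - heatA * z ^ (-(2 / 3) : ℂ) - heatB * z ^ (-(1 / 2) : ℂ) - 1 / 3 * Complex.exp (-z)

lemma norm_cpow_neg_half (z : ℂ) : ‖z ^ (-(1 / 2) : ℂ)‖ = ‖z‖ ^ (-(1 / 2) : ℝ) := by
  rw [← Complex.norm_cpow_real]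
  push_cast
  rfl

lemma rpow_neg_le_two_mul {x p : ℝ} (hx : 1 / 2 ≤ x) (hp : 1 / 2 ≤ p) (hp1 : p ≤ 1) :
    x ^ (-p) ≤ 2 * x ^ (-(1 / 2) : ℝ) := by
  have hx0 : 0 < x := by linarith
  rw [show -p = (1 / 2 - p) + -(1 / 2) by ring, Real.rpow_add hx0]
  gcongr
  calc x ^ (1 / 2 - p) ≤ (1 / 2) ^ (1 / 2 - p) :=
        Real.rpow_le_rpow_of_nonpos (by norm_num) hx (by linarith)
    _ ≤ (1 / 2) ^ (-1 : ℝ) := Real.rpow_le_rpow_of_exponent_ge (by norm_num) (by norm_num)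
        (by linarith)
    _ = 2 := by rw [Real.rpow_neg_one]; norm_num

lemma norm_exp_neg_le_of_inSector {z : ℂ} (hz : InSector z) :
    ‖Complex.exp (-z)‖ ≤ 4 * ‖z‖⁻¹ := by
  have h1 := exp_neg_le_inv hz.1
  rw [Complex.norm_exp, Complex.neg_re]
  refine h1.trans ?_
  rw [← div_eq_mul_inv, le_div_iff₀ hz.norm_pos, inv_mul_le_iff₀ hz.1]
  linarith [hz.2]

/-- Near the vertex this is the heat expansion together with 1 - e^(-z) = O(|z|). Away from it every
piece is O(|z|^(-1/2)), the slowest being the power z^(-1/2) itself. Each bound is weaker than the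
other in one of the two regimes, so both hold throughout. -/
lemma exists_heatRem_le : ∃ K : ℝ, 0 < K ∧ ∀ z : ℂ, InSector z →
    ‖heatRem z‖ ≤ K * ‖z‖ ^ (1 / 2 : ℝ) ∧ ‖heatRem z‖ ≤ K * ‖z‖ ^ (-(1 / 2) : ℝ) := by
  obtain ⟨K₁, hK₁, h₁⟩ := exists_heat_expansion
  obtain ⟨K₂, hK₂, h₂⟩ := exists_norm_heat_le
  set C := 8 * K₂ + 2 * ‖heatA‖ + ‖heatB‖ + 8 with hC
  have hA := norm_nonneg heatA
  have hB := norm_nonneg heatB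
  have hC0 : 0 < C := by positivity
  refine ⟨K₁ + 1 + 2 * C, by positivity, fun z hz => ?_⟩
  have hpos := hz.norm_pos
  rcases le_or_gt ‖z‖ (1 / 2) with h | h
  · have h3 : ‖heatRem z‖ ≤ (K₁ + 1) * ‖z‖ ^ (1 / 2 : ℝ) := by
      have e : heatRem z = (heat z - (heatA * z ^ (-(2 / 3) : ℂ) + heatB * z ^ (-(1 / 2) : ℂ) +
          1 / 3)) - 1 / 3 * (Complex.exp (-z) - 1) := by
        rw [heatRem]
        ring
      have h4 := Complex.norm_exp_sub_one_le (x := -z) (by rw [norm_neg]; linarith)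
      rw [norm_neg] at h4
      have h5 : ‖z‖ ≤ ‖z‖ ^ (1 / 2 : ℝ) := by
        nth_rewrite 1 [← Real.rpow_one ‖z‖]
        exact Real.rpow_le_rpow_of_exponent_ge hpos (by linarith) (by norm_num)
      rw [e]
      refine (norm_sub_le _ _).trans ((add_le_add (h₁ z hz h) (norm_mul_le _ _)).trans ?_)
      norm_num only [norm_div, norm_one, Complex.norm_ofNat]
      linarith
    have h6 : ‖z‖ ^ (1 / 2 : ℝ) ≤ ‖z‖ ^ (-(1 / 2) : ℝ) :=
      Real.rpow_le_rpow_of_exponent_ge hpos (by linarith) (by norm_num)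
    have h7 : 0 ≤ ‖z‖ ^ (1 / 2 : ℝ) := by positivity
    constructor <;> nlinarith
  · have h3 : ‖heatRem z‖ ≤ C * ‖z‖ ^ (-(1 / 2) : ℝ) := by
      have h4 : z.re⁻¹ ≤ 4 * ‖z‖⁻¹ := by
        rw [← div_eq_mul_inv, le_div_iff₀ hpos, inv_mul_le_iff₀ hz.1]
        linarith [hz.2]
      have h5 : ‖z‖⁻¹ ≤ 2 * ‖z‖ ^ (-(1 / 2) : ℝ) := by
        rw [← Real.rpow_neg_one]
        exact rpow_neg_le_two_mul h.le (by norm_num) le_rfl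
      have h6 := rpow_neg_le_two_mul (p := 2 / 3) h.le (by norm_num) (by norm_num)
      have h7 := (h₂ z hz.1).trans (mul_le_mul_of_nonneg_left (h4.trans
        (mul_le_mul_of_nonneg_left h5 (by norm_num))) hK₂.le)
      have h8 := (norm_exp_neg_le_of_inSector hz).trans (mul_le_mul_of_nonneg_left h5 (by norm_num))
      have h9 : ‖heatA * z ^ (-(2 / 3) : ℂ)‖ ≤ ‖heatA‖ * (2 * ‖z‖ ^ (-(1 / 2) : ℝ)) := by
        rw [norm_mul, norm_cpow_neg_two_third]
        gcongr
      have h10 : ‖heatB * z ^ (-(1 / 2) : ℂ)‖ = ‖heatB‖ * ‖z‖ ^ (-(1 / 2) : ℝ) := by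
        rw [norm_mul, norm_cpow_neg_half]
      have h11 : ‖1 / 3 * Complex.exp (-z)‖ ≤ ‖Complex.exp (-z)‖ := by
        rw [norm_mul]
        refine mul_le_of_le_one_left (norm_nonneg _) (by norm_num)
      rw [heatRem]
      refine (norm_sub_le _ _).trans ((add_le_add ((norm_sub_le _ _).trans (add_le_add
        ((norm_sub_le _ _).trans (add_le_add h7 h9)) h10.le)) (h11.trans h8)).trans_eq ?_)
      rw [hC]
      ring
    have h6 : ‖z‖ ^ (-(1 / 2) : ℝ) ≤ 2 * ‖z‖ ^ (1 / 2 : ℝ) := by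
      have e : ‖z‖ * ‖z‖ ^ (-(1 / 2) : ℝ) = ‖z‖ ^ (1 / 2 : ℝ) := by
        rw [mul_comm, ← Real.rpow_add_one hpos.ne']
        norm_num
      have : 0 < ‖z‖ ^ (-(1 / 2) : ℝ) := by positivity
      nlinarith
    have h7 : 0 < ‖z‖ ^ (-(1 / 2) : ℝ) := by positivity
    constructor <;> nlinarith

lemma differentiableOn_heatRem : DifferentiableOn ℂ heatRem {z | 0 < z.re} := by
  have h : ∀ a : ℂ, DifferentiableOn ℂ (fun z : ℂ => z ^ a) {z | 0 < z.re} := fun a z hz =>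
    (DifferentiableAt.cpow_const differentiableAt_id (Or.inl hz)).differentiableWithinAt
  exact ((differentiableOn_heat.sub ((h _).const_mul _)).sub ((h _).const_mul _)).sub
    (by fun_prop)

/-! ### The derivative of `omega` at the origin -/

lemma continuousOn_heatRem_ofReal : ContinuousOn (fun x : ℝ => heatRem x) (Ioi 0) :=
  differentiableOn_heatRem.continuousOn.comp (by fun_prop) fun x hx => by simpa using hx

lemma heatRem_isBigO : (fun x : ℝ => heatRem x) =O[𝓝[>] 0] (fun x => x ^ (-(-(1 / 2)) : ℝ)) ∧
    (fun x : ℝ => heatRem x) =O[atTop] (fun x => x ^ (-(1 / 2) : ℝ)) := by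
  obtain ⟨K, hK, h⟩ := exists_heatRem_le
  constructor
  · refine IsBigO.of_bound K ?_
    filter_upwards [self_mem_nhdsWithin] with x hx
    have hx0 : 0 < x := hx
    have := (h x (inSector_ofReal hx0)).1
    rw [Complex.norm_real, Real.norm_of_nonneg hx0.le] at this
    rwa [Real.norm_of_nonneg (by positivity), neg_neg]
  · refine IsBigO.of_bound K ?_
    filter_upwards [eventually_gt_atTop 0] with x hx0
    have := (h x (inSector_ofReal hx0)).2
    rw [Complex.norm_real, Real.norm_of_nonneg hx0.le] at this
    rwa [Real.norm_of_nonneg (by positivity)]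

lemma continuousOn_heat_ofReal : ContinuousOn (fun x : ℝ => heat x) (Ioi 0) :=
  differentiableOn_heat.continuousOn.comp (by fun_prop) fun x hx => by simpa using hx

lemma heat_isBigO_atTop : (fun x : ℝ => heat x) =O[atTop] (fun x => x ^ (-1 : ℝ)) := by
  obtain ⟨K, hK, h⟩ := exists_norm_heat_le
  refine IsBigO.of_bound K ?_
  filter_upwards [eventually_gt_atTop 0] with x hx0
  have := h x (by simpa using hx0)
  rw [Complex.ofReal_re] at this
  rwa [Real.norm_of_nonneg (by positivity), Real.rpow_neg_one]

lemma heat_isBigO_zero : (fun x : ℝ => heat x) =O[𝓝[>] 0] (fun x => x ^ (-(2 / 3) : ℝ)) := by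
  obtain ⟨K, hK, h⟩ := exists_heatRem_le
  refine IsBigO.of_bound (K + ‖heatA‖ + ‖heatB‖ + 1) ?_
  filter_upwards [Ioc_mem_nhdsGT (zero_lt_one : (0 : ℝ) < 1)] with x hx
  have hx0 : 0 < x := hx.1
  have h1 := (h x (inSector_ofReal hx0)).2
  have h2 := norm_cpow_neg_two_third (x : ℂ)
  have h3 := norm_cpow_neg_half (x : ℂ)
  rw [Complex.norm_real, Real.norm_of_nonneg hx0.le] at h1 h2 h3
  have h4 : x ^ (-(1 / 2) : ℝ) ≤ x ^ (-(2 / 3) : ℝ) :=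
    Real.rpow_le_rpow_of_exponent_ge hx0 hx.2 (by norm_num)
  have h5 : 1 ≤ x ^ (-(2 / 3) : ℝ) :=
    Real.one_le_rpow_of_pos_of_le_one_of_nonpos hx0 hx.2 (by norm_num)
  have h6 : ‖Complex.exp (-(x : ℂ))‖ ≤ 1 := by
    rw [Complex.norm_exp]
    simpa using hx0.le
  have e : heat x = heatRem x + heatA * (x : ℂ) ^ (-(2 / 3) : ℂ) +
      heatB * (x : ℂ) ^ (-(1 / 2) : ℂ) + 1 / 3 * Complex.exp (-(x : ℂ)) := by
    rw [heatRem]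
    ring
  have h7 : ‖1 / 3 * Complex.exp (-(x : ℂ))‖ ≤ 1 := by
    rw [norm_mul]
    exact mul_le_one₀ (by norm_num) (norm_nonneg _) h6
  rw [e, Real.norm_of_nonneg (by positivity)]
  refine (norm_add_le _ _).trans ((add_le_add ((norm_add_le _ _).trans (add_le_add
    (norm_add_le _ _) le_rfl)) h7).trans ?_)
  rw [norm_mul, norm_mul, h2, h3]
  have hB := mul_le_mul_of_nonneg_left h4 (norm_nonneg heatB)
  have hK' := mul_le_mul_of_nonneg_left h4 hK.le
  linarith

/-- Termwise Gamma integrals give Γ(s) ω(s), and the subtracted exponential contributes Γ(s)/3. The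
restriction Re s < 1 reflects the crude bound O(1/x) used at infinity. -/
lemma mellin_heat {s : ℂ} (hs : 2 / 3 < s.re) (hs1 : s.re < 1) :
    mellin (fun x : ℝ => heat x - 1 / 3 * Complex.exp (-(x : ℂ))) s =
      Complex.Gamma s * (omega s - 1 / 3) := by
  have hc : MellinConvergent (fun x : ℝ => heat x) s := mellinConvergent_of_isBigO_rpow
    (continuousOn_heat_ofReal.locallyIntegrableOn measurableSet_Ioi) heat_isBigO_atTop hs1
    heat_isBigO_zero hs
  have hs0 : 0 < s.re := by linarith
  have h1 := hasSum_mellin (a := fun _ : ℕ+ × ℕ+ => (1 : ℂ)) (p := fun p => (weight p : ℝ))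
    (F := fun x : ℝ => heat x) (s := s)
    (fun p => Or.inr (by exact_mod_cast one_le_weight p)) hs0 (fun t ht => ?_) ?_
  · have h2 := (isContinuation_omega.hasSum s hs).mul_left (Complex.Gamma s)
    have h3 : mellin (fun x : ℝ => heat x) s = Complex.Gamma s * omega s := by
      refine h1.unique (h2.congr_fun fun p => ?_)
      rw [Complex.cpow_neg]
      push_cast
      ring
    have h4 : HasMellin (fun x : ℝ => Complex.exp (-(x : ℂ))) s (Complex.Gamma s) := by
      have h5 := integrableOn_cpow_mul_exp (s := s) (ξ := 1) hs0 (by simp)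
      have h6 := mellin_exp_neg_mul (s := s) (ξ := 1) hs0 (by simp)
      simp only [one_mul, Complex.one_cpow, mul_one] at h5 h6
      exact ⟨h5, h6⟩
    have h7 := hasMellin_const_smul h4.1 (1 / 3 : ℂ)
    have h8 := hasMellin_sub hc h7.1
    rw [h7.2, h4.2, h3] at h8
    refine h8.2.trans ?_
    rw [smul_eq_mul]
    ring
  · have ht0 : (0 : ℝ) < t := ht
    have := (summable_heat (z := t) (by simpa using ht0)).hasSum
    refine this.congr_fun fun p => ?_
    push_cast
    ring_nf
  · refine (summable_weight_rpow hs).congr fun p => ?_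
    rw [Real.rpow_neg (by positivity), norm_one, one_div]

/-- `omega' 0` as a Mellin integral of the remainder. -/
lemma hasDerivAt_omega_zero :
    HasDerivAt omega (mellin (fun x : ℝ => heatRem x) 0) 0 := by
  have hΓd : DifferentiableOn ℂ (fun s : ℂ => Complex.Gamma (s + 1)) {s : ℂ | -(1 / 2) < s.re} :=
    fun s hs => by
    have hs' : -(1 / 2) < s.re := hs
    refine DifferentiableAt.differentiableWithinAt ?_
    have h1 : DifferentiableAt ℂ Complex.Gamma (s + 1) := Complex.differentiableAt_Gamma _
      fun m hm => by
        have := congrArg Complex.re hm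
        simp at this
        linarith [Nat.cast_nonneg (α := ℝ) m]
    exact DifferentiableAt.fun_comp' s h1 (by fun_prop)
  have hΓa : ∀ s : ℂ, -(1 / 2) < s.re → AnalyticAt ℂ (fun s : ℂ => Complex.Gamma (s + 1)) s :=
    fun s hs => hΓd.analyticAt ((isOpen_halfPlane _).mem_nhds hs)
  -- Γ(s) is written as Γ(s + 1)/s to isolate its pole at 0. Nothing is known about ω at 0 yet, so
  -- `W` is only meromorphic there and is compared with the Mellin transform on a punctured
  -- neighbourhood.
  set W : ℂ → ℂ := fun s => Complex.Gamma (s + 1) / s * (omega s - 1 / 3) with hW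
  have hωm : ∀ s, MeromorphicAt omega s := fun s =>
    (isContinuation_omega.meromorphic (mem_univ s)).meromorphicAt
  have hWm : MeromorphicOn W {s : ℂ | -(1 / 2) < s.re ∧ s.re < 1} := fun s hs =>
    ((hΓa s hs.1).meromorphicAt.div (MeromorphicAt.id s)).mul
      ((hωm s).sub (MeromorphicAt.const _ s))
  have hpu : ∀ᶠ s in 𝓝[≠] (0 : ℂ), AnalyticAt ℂ W s ∧ s ≠ 0 ∧ (-(1 / 2) < s.re ∧ s.re < 1 / 2) := by
    filter_upwards [MeromorphicAt.eventually_analyticAt (hWm 0 ⟨by norm_num, by norm_num⟩),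
      self_mem_nhdsWithin, mem_nhdsWithin_of_mem_nhds ((isOpen_strip (-(1 / 2)) (1 / 2)).mem_nhds
        ⟨by norm_num, by norm_num⟩)] with s h1 h2 h3
    exact ⟨h1, h2, h3⟩
  have hre : (2 / 3 : ℂ).re = 2 / 3 := by norm_num
  have hre' : (1 / 2 : ℂ).re = 1 / 2 := by norm_num
  have hM : ∀ᶠ s in 𝓝[≠] (0 : ℂ), mellin (fun x : ℝ => heatRem x) s = W s := by
    filter_upwards [hpu] with s hs
    refine (mellin_sub_eq (f := fun x : ℝ => heat x - 1 / 3 * Complex.exp (-(x : ℂ)))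
      (p := 2 / 3) (q := 1 / 2) (c₁ := heatA) (c₂ := heatB) (a := 1) (b := -(1 / 2)) ?_ ?_ ?_
      heatRem_isBigO.1 (by rw [hre, hre']; norm_num) (by rw [hre]; norm_num) hWm ?_ hs.2.2.1
      (by rw [hre']; exact hs.2.2.2) hs.1).2
    · ext x
      rw [heatRem]
      ring
    · exact continuousOn_heat_ofReal.sub (by fun_prop)
    · refine heat_isBigO_atTop.sub (IsBigO.of_bound 2 ?_)
      filter_upwards [eventually_gt_atTop 0] with x hx0
      have h1 := norm_exp_neg_le_of_inSector (inSector_ofReal hx0)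
      rw [Complex.norm_real, Real.norm_of_nonneg hx0.le] at h1
      have h2 : 0 < x⁻¹ := by positivity
      rw [norm_mul, Real.rpow_neg_one, Real.norm_of_nonneg h2.le]
      norm_num only [norm_div, norm_one, Complex.norm_ofNat]
      linarith
    · intro s hs hs1
      rw [hre] at hs
      have hs0 : s ≠ 0 := fun h0 => by
        rw [h0] at hs
        norm_num at hs
      rw [mellin_heat hs hs1, hW]
      simp only
      rw [Complex.Gamma_add_one s hs0, mul_div_cancel_left₀ _ hs0]
  have hmd : DifferentiableOn ℂ (mellin fun x : ℝ => heatRem x)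
      {s : ℂ | -(1 / 2) < s.re ∧ s.re < 1 / 2} := fun s hs =>
    (mellin_differentiableAt_of_isBigO_rpow
      (continuousOn_heatRem_ofReal.locallyIntegrableOn measurableSet_Ioi) heatRem_isBigO.2 hs.2
      heatRem_isBigO.1 hs.1).differentiableWithinAt
  have h0 : (0 : ℂ) ∈ {s : ℂ | -(1 / 2) < s.re ∧ s.re < 1 / 2} := ⟨by norm_num, by norm_num⟩
  have hma := hmd.analyticAt ((isOpen_strip _ _).mem_nhds h0)
  have hΓ0 : Complex.Gamma (0 + 1) ≠ 0 := by simp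
  have hGa : AnalyticAt ℂ (fun s : ℂ => mellin (fun x : ℝ => heatRem x) s / Complex.Gamma (s + 1)) 0 :=
    hma.div (hΓa 0 (by norm_num)) hΓ0
  have hTa : AnalyticAt ℂ (fun s : ℂ => 1 / 3 +
      s * (mellin (fun x : ℝ => heatRem x) s / Complex.Gamma (s + 1))) 0 :=
    analyticAt_const.add (analyticAt_id.mul hGa)
  -- Solving for ω gives a right-hand side analytic at 0. As ω is in normal form, equality extends
  -- to the point 0; this shows at once that ω is regular there, with value 1/3 and derivative given
  -- by the Mellin integral.
  have heq : omega =ᶠ[𝓝[≠] 0] fun s : ℂ => 1 / 3 +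
      s * (mellin (fun x : ℝ => heatRem x) s / Complex.Gamma (s + 1)) := by
    filter_upwards [hM, hpu] with s hs hs'
    have hg : Complex.Gamma (s + 1) ≠ 0 := Complex.Gamma_ne_zero_of_re_pos (by
      have := hs'.2.2.1
      simp
      linarith)
    have hs0 := hs'.2.1
    rw [hs, hW]
    field_simp
    ring
  have heq' := ((isContinuation_omega.meromorphic (mem_univ 0)).eventuallyEq_nhdsNE_iff_eventuallyEq_nhds
    hTa.meromorphicNFAt).mp heq
  refine HasDerivAt.congr_of_eventuallyEq ?_ heq'
  refine (((hasDerivAt_id (0 : ℂ)).fun_mul hGa.differentiableAt.hasDerivAt).const_add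
    (1 / 3)).congr_deriv ?_
  simp

/-! ### Riemann sums -/

/-- Right-endpoint sums. The interval at 0 has only an integrable singularity, and its value and
integral cost M + 2M. On the others the mean value inequality gives M n^(-3/2), and n ≥ (n + 1)/2
with 2^(3/2) ≤ 3 yields the common constant. -/
lemma norm_riemann_sum_sub_le {G G' : ℝ → ℂ} {M : ℝ} (hd : ∀ u, 0 < u → HasDerivAt G (G' u) u)
    (hG : ∀ u, 0 < u → ‖G u‖ ≤ M * u ^ (-(1 / 2) : ℝ))
    (hG' : ∀ u, 0 < u → ‖G' u‖ ≤ M * u ^ (-(3 / 2) : ℝ)) (hi : IntegrableOn G (Ioi 0))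
    (hs : Summable fun n : ℕ => G ((n : ℝ) + 1)) :
    ‖∑' n : ℕ, G ((n : ℝ) + 1) - ∫ u in Ioi (0 : ℝ), G u‖ ≤
      3 * M * ∑' n : ℕ, ((n : ℝ) + 1) ^ (-(3 / 2) : ℝ) := by
  have hM : 0 ≤ M := by
    have := (norm_nonneg _).trans (hG 1 one_pos)
    simpa using this
  have hI : HasSum (fun n : ℕ => ∫ u in (n : ℝ)..((n : ℝ) + 1), G u) (∫ u in Ioi (0 : ℝ), G u) := by
    refine (hasSum_integral_unit hi).congr_fun fun n => ?_
    rw [intervalIntegral.integral_comp_add_left G (0 + (n : ℝ))]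
    simp
  have hc : ∀ u, 0 < u → ContinuousAt G u := fun u hu => (hd u hu).continuousAt
  have hterm : ∀ n : ℕ, ‖G ((n : ℝ) + 1) - ∫ u in (n : ℝ)..((n : ℝ) + 1), G u‖ ≤
      3 * M * ((n : ℝ) + 1) ^ (-(3 / 2) : ℝ) := fun n => by
    rcases Nat.eq_zero_or_pos n with rfl | hn
    · have h1 := hG 1 one_pos
      have hii : IntervalIntegrable (fun u : ℝ => M * u ^ (-(1 / 2) : ℝ)) volume 0 1 :=
        (intervalIntegral.intervalIntegrable_rpow' (by norm_num)).const_mul M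
      have h2 : ‖∫ u in (0 : ℝ)..1, G u‖ ≤ ∫ u in (0 : ℝ)..1, M * u ^ (-(1 / 2) : ℝ) :=
        intervalIntegral.norm_integral_le_of_norm_le zero_le_one
          (ae_of_all _ fun u hu => hG u hu.1) hii
      rw [intervalIntegral.integral_const_mul, integral_rpow (Or.inl (by norm_num))] at h2
      norm_num at h1 h2 ⊢
      exact (norm_sub_le _ _).trans (by linarith)
    · have hn1 : (1 : ℝ) ≤ n := by exact_mod_cast hn
      have hn0 : (0 : ℝ) < n := by linarith
      have hsub : ∀ u ∈ Icc (n : ℝ) (n + 1), 0 < u := fun u hu => by linarith [hu.1]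
      have hbd : ∀ u ∈ Icc (n : ℝ) (n + 1), ‖G' u‖ ≤ M * (n : ℝ) ^ (-(3 / 2) : ℝ) := fun u hu =>
        (hG' u (hsub u hu)).trans (mul_le_mul_of_nonneg_left
          (Real.rpow_le_rpow_of_nonpos hn0 hu.1 (by norm_num)) hM)
      have hlip : ∀ u ∈ Icc (n : ℝ) (n + 1), ‖G ((n : ℝ) + 1) - G u‖ ≤ M * (n : ℝ) ^ (-(3 / 2) : ℝ) :=
        fun u hu => by
        have h1 := Convex.norm_image_sub_le_of_norm_hasDerivWithin_le
          (fun x hx => (hd x (hsub x hx)).hasDerivWithinAt) hbd (convex_Icc _ _) hu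
          (right_mem_Icc.mpr (by linarith))
        refine h1.trans (mul_le_of_le_one_right (by positivity) ?_)
        rw [Real.norm_of_nonneg (by linarith [hu.2])]
        linarith [hu.1]
      have hii : IntervalIntegrable G volume n (n + 1) :=
        ContinuousOn.intervalIntegrable_of_Icc (by linarith)
          fun u hu => (hc u (hsub u hu)).continuousWithinAt
      have e : G ((n : ℝ) + 1) - ∫ u in (n : ℝ)..((n : ℝ) + 1), G u =
          ∫ u in (n : ℝ)..((n : ℝ) + 1), (G ((n : ℝ) + 1) - G u) := by
        rw [intervalIntegral.integral_sub intervalIntegrable_const hii]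
        simp
      have h2 : (n : ℝ) ^ (-(3 / 2) : ℝ) ≤ 3 * ((n : ℝ) + 1) ^ (-(3 / 2) : ℝ) := by
        have h3 : (n : ℝ) ^ (-(3 / 2) : ℝ) ≤ (((n : ℝ) + 1) / 2) ^ (-(3 / 2) : ℝ) :=
          Real.rpow_le_rpow_of_nonpos (by positivity) (by linarith) (by norm_num)
        have h4 : ((2 : ℝ) ^ (-(3 / 2) : ℝ))⁻¹ ≤ 3 := by
          rw [rpow_neg_three_half two_pos, inv_inv]
          have h5 := Real.sq_sqrt (zero_le_two (α := ℝ))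
          have h6 : √2 ≤ 3 / 2 := by
            rw [Real.sqrt_le_left (by norm_num)]
            norm_num
          nlinarith [Real.sqrt_nonneg 2]
        rw [Real.div_rpow (by positivity) (by norm_num)] at h3
        refine (h3.trans_eq (div_eq_inv_mul _ _)).trans (mul_le_mul_of_nonneg_right h4 (by positivity))
      rw [e]
      have h3 := intervalIntegral.norm_integral_le_of_norm_le_const (a := (n : ℝ)) (b := n + 1)
        (f := fun u => G ((n : ℝ) + 1) - G u) (C := M * (n : ℝ) ^ (-(3 / 2) : ℝ)) fun u hu => by
          rw [uIoc_of_le (by linarith)] at hu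
          exact hlip u ⟨hu.1.le, hu.2⟩
      rw [add_sub_cancel_left, abs_one, mul_one] at h3
      refine h3.trans ?_
      nlinarith
  have hs2 := (summable_succ_rpow (c := 3 / 2) (by norm_num)).mul_left (3 * M)
  rw [← tsum_mul_left, ← (hs.hasSum.sub hI).tsum_eq]
  exact tsum_of_norm_bounded hs2.hasSum hterm

/-! ### The remainder in a narrow sector -/

/-- The open sector `|z| < 2 Re z`. -/
def narrowSector : Set ℂ := {z | ‖z‖ < 2 * z.re}

lemma re_pos_of_mem_narrowSector {z : ℂ} (hz : z ∈ narrowSector) : 0 < z.re := by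
  have : ‖z‖ < 2 * z.re := hz
  linarith [norm_nonneg z]

lemma inSector_of_mem_narrowSector {z : ℂ} (hz : z ∈ narrowSector) : InSector z :=
  ⟨re_pos_of_mem_narrowSector hz, by
    have h1 : ‖z‖ < 2 * z.re := hz
    have := re_pos_of_mem_narrowSector hz
    linarith⟩

lemma isOpen_narrowSector : IsOpen narrowSector :=
  isOpen_lt continuous_norm (continuous_const.mul Complex.continuous_re)

lemma real_mul_mem_narrowSector {z : ℂ} (hz : z ∈ narrowSector) {r : ℝ} (hr : 0 < r) :
    (r : ℂ) * z ∈ narrowSector := by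
  have h1 : ‖z‖ < 2 * z.re := hz
  show ‖(r : ℂ) * z‖ < 2 * ((r : ℂ) * z).re
  rw [norm_mul, Complex.norm_real, Real.norm_of_nonneg hr.le, Complex.re_ofReal_mul]
  nlinarith

lemma ofReal_mem_narrowSector {r : ℝ} (hr : 0 < r) : (r : ℂ) ∈ narrowSector := by
  show ‖(r : ℂ)‖ < 2 * (r : ℂ).re
  rw [Complex.norm_real, Real.norm_of_nonneg hr.le, Complex.ofReal_re]
  linarith

lemma convex_narrowSector : Convex ℝ narrowSector := by
  intro x hx y hy a b ha hb hab
  have hx' : ‖x‖ < 2 * x.re := hx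
  have hy' : ‖y‖ < 2 * y.re := hy
  show ‖a • x + b • y‖ < 2 * (a • x + b • y).re
  have h1 : ‖a • x + b • y‖ ≤ a * ‖x‖ + b * ‖y‖ := by
    refine (norm_add_le _ _).trans_eq ?_
    rw [norm_smul, norm_smul, Real.norm_of_nonneg ha, Real.norm_of_nonneg hb]
  refine h1.trans_lt ?_
  simp only [Complex.add_re, Complex.real_smul, Complex.re_ofReal_mul]
  rcases ha.eq_or_lt with rfl | ha'
  · have : b = 1 := by linarith
    subst this
    linarith
  · nlinarith

/-- Radius |z|/8 leaves Re w ≥ 3|z|/8 and |w| ≤ 9|z|/8. Two nested sectors thus give room for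
Cauchy's estimates on discs proportional to |z|. -/
lemma inSector_of_mem_closedBall {z w : ℂ} (hz : z ∈ narrowSector)
    (hw : w ∈ Metric.closedBall z (‖z‖ / 8)) : InSector w ∧ ‖w‖ ≤ 2 * ‖z‖ := by
  have h1 : ‖z‖ < 2 * z.re := hz
  have h2 : ‖w - z‖ ≤ ‖z‖ / 8 := by rwa [mem_closedBall_iff_norm] at hw
  have h3 : |w.re - z.re| ≤ ‖w - z‖ := by
    rw [← Complex.sub_re]
    exact Complex.abs_re_le_norm _
  have h4 : ‖w‖ ≤ ‖w - z‖ + ‖z‖ := by simpa using norm_add_le (w - z) z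
  have h5 := neg_le_of_abs_le h3
  have h6 := norm_nonneg z
  have h7 : 0 < z.re := re_pos_of_mem_narrowSector hz
  exact ⟨⟨by linarith, by linarith⟩, by linarith⟩

lemma exists_deriv_heatRem_le : ∃ K : ℝ, 0 < K ∧ ∀ z ∈ narrowSector,
    ‖deriv heatRem z‖ ≤ K * ‖z‖ ^ (-(1 / 2) : ℝ) := by
  obtain ⟨K, hK, h⟩ := exists_heatRem_le
  refine ⟨16 * K, by positivity, fun z hz => ?_⟩
  have hpos := (inSector_of_mem_narrowSector hz).norm_pos
  have hcl : DiffContOnCl ℂ heatRem (Metric.ball z (‖z‖ / 8)) :=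
    (differentiableOn_heatRem.mono fun w hw => (inSector_of_mem_closedBall hz hw).1.1).diffContOnCl_ball
      Subset.rfl
  have h1 := Complex.norm_deriv_le_of_forall_mem_sphere_norm_le (C := 2 * K * ‖z‖ ^ (1 / 2 : ℝ))
    (by positivity) hcl fun w hw => by
      obtain ⟨hw1, hw2⟩ := inSector_of_mem_closedBall hz (Metric.sphere_subset_closedBall hw)
      refine (h w hw1).1.trans ?_
      have h2 : ‖w‖ ^ (1 / 2 : ℝ) ≤ (4 * ‖z‖) ^ (1 / 2 : ℝ) :=
        Real.rpow_le_rpow (norm_nonneg _) (by linarith) (by norm_num)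
      have h3 : (4 : ℝ) ^ (1 / 2 : ℝ) = 2 := by
        rw [← Real.sqrt_eq_rpow, show (4 : ℝ) = 2 ^ 2 by norm_num, Real.sqrt_sq (by norm_num)]
      rw [Real.mul_rpow (by norm_num) hpos.le, h3] at h2
      nlinarith
  refine h1.trans_eq ?_
  have h4 : ‖z‖ * ‖z‖ ^ (-(1 / 2) : ℝ) = ‖z‖ ^ (1 / 2 : ℝ) := by
    rw [mul_comm, ← Real.rpow_add_one hpos.ne']
    norm_num
  rw [← h4]
  field_simp
  norm_num

/-! ### The logarithmic sum of the remainder -/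

/-- The integrand `heatRem (u z) / u`. -/
noncomputable def radial (z : ℂ) (u : ℝ) : ℂ := (u : ℂ)⁻¹ * heatRem (u * z)

/-- `∑ heatRem (n z) / n`. -/
noncomputable def remSum (z : ℂ) : ℂ := ∑' n : ℕ, radial z ((n : ℝ) + 1)

lemma exists_radial_le : ∃ K : ℝ, 0 < K ∧ ∀ z : ℂ, InSector z → ∀ u : ℝ, 0 < u →
    ‖radial z u‖ ≤ K * ‖z‖ ^ (1 / 2 : ℝ) * u ^ (-(1 / 2) : ℝ) ∧
    ‖radial z u‖ ≤ K * ‖z‖ ^ (-(1 / 2) : ℝ) * u ^ (-(3 / 2) : ℝ) := by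
  obtain ⟨K, hK, h⟩ := exists_heatRem_le
  refine ⟨K, hK, fun z hz u hu => ?_⟩
  obtain ⟨h1, h2⟩ := h _ (hz.real_mul hu)
  rw [norm_mul, Complex.norm_real, Real.norm_of_nonneg hu.le,
    Real.mul_rpow hu.le (norm_nonneg z)] at h1 h2
  have e1 : u⁻¹ * u ^ (1 / 2 : ℝ) = u ^ (-(1 / 2) : ℝ) := by
    rw [← Real.rpow_neg_one, ← Real.rpow_add hu]
    norm_num
  have e2 : u⁻¹ * u ^ (-(1 / 2) : ℝ) = u ^ (-(3 / 2) : ℝ) := by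
    rw [← Real.rpow_neg_one, ← Real.rpow_add hu]
    norm_num
  have hu' : 0 < u⁻¹ := by positivity
  rw [radial, norm_mul, norm_inv, Complex.norm_real, Real.norm_of_nonneg hu.le]
  constructor
  · refine (mul_le_mul_of_nonneg_left h1 hu'.le).trans_eq ?_
    rw [← e1]
    ring
  · refine (mul_le_mul_of_nonneg_left h2 hu'.le).trans_eq ?_
    rw [← e2]
    ring

lemma re_ofReal_mul_pos {z : ℂ} (hz : 0 < z.re) {u : ℝ} (hu : 0 < u) : 0 < ((u : ℂ) * z).re := by
  rw [Complex.re_ofReal_mul]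
  positivity

lemma hasDerivAt_radial {z : ℂ} (hz : 0 < z.re) {u : ℝ} (hu : 0 < u) :
    HasDerivAt (radial z) (-((u : ℂ) ^ 2)⁻¹ * heatRem (u * z) +
      (u : ℂ)⁻¹ * (deriv heatRem (u * z) * z)) u := by
  have hu' : (u : ℂ) ≠ 0 := by exact_mod_cast hu.ne'
  have h1 : HasDerivAt heatRem (deriv heatRem (u * z)) (u * z) :=
    (differentiableOn_heatRem.differentiableAt
      ((isOpen_halfPlane 0).mem_nhds (re_ofReal_mul_pos hz hu))).hasDerivAt
  have h2 : HasDerivAt (fun w : ℂ => w⁻¹ * heatRem (w * z)) (-((u : ℂ) ^ 2)⁻¹ * heatRem (u * z) +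
      (u : ℂ)⁻¹ * (deriv heatRem (u * z) * z)) (u : ℂ) :=
    (hasDerivAt_inv hu').fun_mul (HasDerivAt.comp (h := fun w : ℂ => w * z) (u : ℂ) h1
      (((hasDerivAt_id (u : ℂ)).mul_const z).congr_deriv (one_mul z)))
  exact h2.comp_ofReal

lemma continuousOn_radial {z : ℂ} (hz : 0 < z.re) : ContinuousOn (radial z) (Ioi 0) := fun _ hu =>
  (hasDerivAt_radial hz hu).continuousAt.continuousWithinAt

lemma integrableOn_radial {z : ℂ} (hz : InSector z) : IntegrableOn (radial z) (Ioi 0) := by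
  obtain ⟨K, hK, h⟩ := exists_radial_le
  have hm := continuousOn_radial hz.1
  rw [← Ioc_union_Ioi_eq_Ioi (zero_le_one : (0 : ℝ) ≤ 1)]
  refine IntegrableOn.union ?_ ?_
  · have hi : IntervalIntegrable (fun u : ℝ => K * ‖z‖ ^ (1 / 2 : ℝ) * u ^ (-(1 / 2) : ℝ))
        volume 0 1 := (intervalIntegral.intervalIntegrable_rpow' (by norm_num)).const_mul _
    exact Integrable.mono' ((intervalIntegrable_iff_integrableOn_Ioc_of_le (by norm_num)).mp hi)
      ((hm.mono Ioc_subset_Ioi_self).aestronglyMeasurable measurableSet_Ioc)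
      ((ae_restrict_mem measurableSet_Ioc).mono fun u hu => (h z hz u hu.1).1)
  · exact Integrable.mono' ((integrableOn_Ioi_rpow_of_lt (a := -(3 / 2)) (by norm_num)
      one_pos).const_mul (K * ‖z‖ ^ (-(1 / 2) : ℝ)))
      ((hm.mono (Ioi_subset_Ioi zero_le_one)).aestronglyMeasurable measurableSet_Ioi)
      ((ae_restrict_mem measurableSet_Ioi).mono fun u hu => (h z hz u (lt_trans one_pos hu)).2)

lemma summable_radial {z : ℂ} (hz : InSector z) :
    Summable fun n : ℕ => radial z ((n : ℝ) + 1) := by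
  obtain ⟨K, hK, h⟩ := exists_radial_le
  exact Summable.of_norm_bounded ((summable_succ_rpow (c := 3 / 2) (by norm_num)).mul_left _)
    fun n => (h z hz _ (by positivity)).2

lemma differentiableOn_remSum : DifferentiableOn ℂ remSum narrowSector := by
  obtain ⟨K, hK, h⟩ := exists_radial_le
  intro z₀ hz₀
  have hpos := (inSector_of_mem_narrowSector hz₀).norm_pos
  set V : Set ℂ := narrowSector ∩ {z | ‖z₀‖ / 2 < ‖z‖} with hV
  have hVo : IsOpen V := isOpen_narrowSector.inter (isOpen_lt continuous_const continuous_norm)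
  have hd : DifferentiableOn ℂ remSum V := by
    refine Complex.differentiableOn_tsum_of_summable_norm
      ((summable_succ_rpow (c := 3 / 2) (by norm_num)).mul_left (K * (‖z₀‖ / 2) ^ (-(1 / 2) : ℝ)))
      (fun n z hz => ?_) hVo fun n z hz => ?_
    · have hn : (0 : ℝ) < (n : ℝ) + 1 := by positivity
      have h1 := differentiableOn_heatRem.differentiableAt ((isOpen_halfPlane 0).mem_nhds
        (re_ofReal_mul_pos (re_pos_of_mem_narrowSector hz.1) hn))
      exact ((DifferentiableAt.fun_comp' z h1 (by fun_prop)).const_mul _).differentiableWithinAt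
    · refine (h z (inSector_of_mem_narrowSector hz.1) _ (by positivity)).2.trans ?_
      have h2 : ‖z₀‖ / 2 < ‖z‖ := hz.2
      have h3 : ‖z‖ ^ (-(1 / 2) : ℝ) ≤ (‖z₀‖ / 2) ^ (-(1 / 2) : ℝ) :=
        Real.rpow_le_rpow_of_nonpos (by positivity) h2.le (by norm_num)
      gcongr
  have hmem : z₀ ∈ V := ⟨hz₀, show ‖z₀‖ / 2 < ‖z₀‖ by linarith⟩
  exact (hd.differentiableAt (hVo.mem_nhds hmem)).differentiableWithinAt

/-- The integrand is bounded by |z|^(1/2) u^(-1/2) and, through the Cauchy bound for `heatRem`, its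
derivative by |z|^(1/2) u^(-3/2). The power of |z| factors out of the whole Riemann-sum error. -/
lemma exists_remSum_sub_integral_le : ∃ K : ℝ, 0 < K ∧ ∀ z ∈ narrowSector,
    ‖remSum z - ∫ u in Ioi (0 : ℝ), radial z u‖ ≤ K * ‖z‖ ^ (1 / 2 : ℝ) := by
  obtain ⟨K₁, hK₁, h₁⟩ := exists_radial_le
  obtain ⟨K₂, hK₂, h₂⟩ := exists_deriv_heatRem_le
  obtain ⟨K₃, hK₃, h₃⟩ := exists_heatRem_le
  have hs := summable_succ_rpow (c := 3 / 2) (by norm_num)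
  have hspos : 0 < ∑' l : ℕ, ((l : ℝ) + 1) ^ (-(3 / 2) : ℝ) :=
    hs.tsum_pos (fun n => by positivity) 0 (by positivity)
  refine ⟨3 * (K₁ + K₂ + K₃) * ∑' l : ℕ, ((l : ℝ) + 1) ^ (-(3 / 2) : ℝ), by positivity,
    fun z hz => ?_⟩
  have hzs := inSector_of_mem_narrowSector hz
  have hpos := hzs.norm_pos
  have hz2 : 0 < ‖z‖ ^ (1 / 2 : ℝ) := by positivity
  have h4 := norm_riemann_sum_sub_le (M := (K₁ + K₂ + K₃) * ‖z‖ ^ (1 / 2 : ℝ))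
    (fun u hu => hasDerivAt_radial hzs.1 hu)
    (fun u hu => (h₁ z hzs u hu).1.trans (by gcongr; linarith)) (fun u hu => ?_)
    (integrableOn_radial hzs) (summable_radial hzs)
  · refine h4.trans_eq ?_
    ring
  · have h5 := h₂ _ (real_mul_mem_narrowSector hz hu)
    have h6 := (h₃ _ (hzs.real_mul hu)).1
    rw [norm_mul, Complex.norm_real, Real.norm_of_nonneg hu.le,
      Real.mul_rpow hu.le hpos.le] at h5 h6
    have e1 : (u ^ 2)⁻¹ * u ^ (1 / 2 : ℝ) = u ^ (-(3 / 2) : ℝ) := by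
      rw [← Real.rpow_natCast, ← Real.rpow_neg hu.le, ← Real.rpow_add hu]
      norm_num
    have e2 : u⁻¹ * u ^ (-(1 / 2) : ℝ) = u ^ (-(3 / 2) : ℝ) := by
      rw [← Real.rpow_neg_one, ← Real.rpow_add hu]
      norm_num
    have e3 : ‖z‖ ^ (-(1 / 2) : ℝ) * ‖z‖ = ‖z‖ ^ (1 / 2 : ℝ) := by
      rw [← Real.rpow_add_one hpos.ne']
      norm_num
    have hu' : 0 < u⁻¹ := by positivity
    have hu2 : 0 < (u ^ 2)⁻¹ := by positivity
    refine (norm_add_le _ _).trans ?_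
    rw [norm_mul, norm_mul, norm_mul, norm_neg, norm_inv, norm_inv, norm_pow, Complex.norm_real,
      Real.norm_of_nonneg hu.le]
    calc _ ≤ (u ^ 2)⁻¹ * (K₃ * (u ^ (1 / 2 : ℝ) * ‖z‖ ^ (1 / 2 : ℝ))) +
          u⁻¹ * (K₂ * (u ^ (-(1 / 2) : ℝ) * ‖z‖ ^ (-(1 / 2) : ℝ)) * ‖z‖) := by gcongr
      _ = K₃ * ‖z‖ ^ (1 / 2 : ℝ) * ((u ^ 2)⁻¹ * u ^ (1 / 2 : ℝ)) +
          K₂ * (‖z‖ ^ (-(1 / 2) : ℝ) * ‖z‖) * (u⁻¹ * u ^ (-(1 / 2) : ℝ)) := by ring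
      _ = (K₂ + K₃) * ‖z‖ ^ (1 / 2 : ℝ) * u ^ (-(3 / 2) : ℝ) := by rw [e1, e2, e3]; ring
      _ ≤ _ := by
        gcongr
        linarith

/-- Invariance of the measure du/u under dilations. -/
lemma integral_radial_real_mul (z : ℂ) {r : ℝ} (hr : 0 < r) :
    ∫ u in Ioi (0 : ℝ), radial (r * z) u = ∫ u in Ioi (0 : ℝ), radial z u := by
  have h1 := integral_comp_mul_left_Ioi (radial z) 0 hr
  rw [mul_zero] at h1
  have hr' : (r : ℂ) ≠ 0 := by exact_mod_cast hr.ne'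
  have e : ∀ u : ℝ, radial (r * z) u = r * radial z (r * u) := fun u => by
    simp only [radial]
    push_cast
    rw [mul_inv, ← mul_assoc (r : ℂ), mul_inv_cancel_left₀ hr', ← mul_assoc, mul_comm (u : ℂ) r]
  simp_rw [e]
  rw [integral_const_mul, h1, Complex.real_smul, Complex.ofReal_inv, mul_inv_cancel_left₀ hr']

/-- Dilation invariance turns the Riemann-sum error at z/(n + 1) into an approximation of the
integral at z itself, so the integral is a locally uniform limit of holomorphic functions. -/
lemma differentiableOn_integral_radial :
    DifferentiableOn ℂ (fun z => ∫ u in Ioi (0 : ℝ), radial z u) narrowSector := by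
  obtain ⟨K, hK, h⟩ := exists_remSum_sub_integral_le
  have hr : ∀ n : ℕ, (0 : ℝ) < ((n : ℝ) + 1)⁻¹ := fun n => by positivity
  refine TendstoLocallyUniformlyOn.differentiableOn (φ := atTop)
    (F := fun (n : ℕ) z => remSum ((((n : ℝ) + 1)⁻¹ : ℝ) * z)) ?_
    (Eventually.of_forall fun n => differentiableOn_remSum.comp (by fun_prop)
      fun z hz => real_mul_mem_narrowSector hz (hr n)) isOpen_narrowSector
  rw [Metric.tendstoLocallyUniformlyOn_iff]
  intro ε hε x hx
  refine ⟨narrowSector ∩ Metric.ball x 1, inter_mem self_mem_nhdsWithin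
    (mem_nhdsWithin_of_mem_nhds (Metric.ball_mem_nhds x one_pos)), ?_⟩
  have ht : Tendsto (fun n : ℕ => K * (((n : ℝ) + 1)⁻¹ * (‖x‖ + 1)) ^ (1 / 2 : ℝ)) atTop (𝓝 0) := by
    have h1 : Tendsto (fun n : ℕ => ((n : ℝ) + 1)⁻¹ * (‖x‖ + 1)) atTop (𝓝 0) := by
      have := (tendsto_one_div_add_atTop_nhds_zero_nat (𝕜 := ℝ)).mul_const (‖x‖ + 1)
      simpa using this
    have h2 := (h1.rpow_const (p := 1 / 2) (Or.inr (by norm_num))).const_mul K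
    simpa using h2
  filter_upwards [ht.eventually_lt_const hε] with n hn z hz
  have h3 := h _ (real_mul_mem_narrowSector hz.1 (hr n))
  rw [integral_radial_real_mul z (hr n), norm_mul, Complex.norm_real,
    Real.norm_of_nonneg (hr n).le] at h3
  rw [dist_comm, dist_eq_norm]
  refine h3.trans_lt (lt_of_le_of_lt ?_ hn)
  have h4 : ‖z‖ ≤ ‖x‖ + 1 := by
    have h5 : ‖z - x‖ < 1 := by simpa [dist_eq_norm] using hz.2
    have h6 : ‖z‖ ≤ ‖z - x‖ + ‖x‖ := by simpa using norm_add_le (z - x) x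
    linarith
  have := hr n
  gcongr

/-- Dilation invariance kills the derivative in the radial direction, and for a holomorphic function
one real direction suffices. At z = 1 the integral is the Mellin integral at 0. -/
lemma integral_radial_eq {z : ℂ} (hz : z ∈ narrowSector) :
    ∫ u in Ioi (0 : ℝ), radial z u = mellin (fun x : ℝ => heatRem x) 0 := by
  have h1 : (1 : ℂ) ∈ narrowSector := by
    have := ofReal_mem_narrowSector one_pos
    rwa [Complex.ofReal_one] at this
  have hc := isOpen_narrowSector.is_const_of_deriv_eq_zero convex_narrowSector.isPreconnected
    differentiableOn_integral_radial (fun w hw => ?_) hz h1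
  · rw [hc, mellin]
    refine setIntegral_congr_fun measurableSet_Ioi fun u _ => ?_
    simp [radial, Complex.cpow_neg_one]
  · have hd := (differentiableOn_integral_radial.differentiableAt
      (isOpen_narrowSector.mem_nhds hw)).hasDerivAt
    have hw0 := (inSector_of_mem_narrowSector hw).ne_zero
    have h2 : HasDerivAt (fun s : ℂ => s * w) w ((1 : ℝ) : ℂ) := by
      simpa using (hasDerivAt_id ((1 : ℝ) : ℂ)).mul_const w
    have hd' : HasDerivAt (fun z => ∫ u in Ioi (0 : ℝ), radial z u)
        (deriv (fun z => ∫ u in Ioi (0 : ℝ), radial z u) w) (((1 : ℝ) : ℂ) * w) := by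
      simpa using hd
    have h3 := (HasDerivAt.comp ((1 : ℝ) : ℂ) hd' h2).comp_ofReal
    have h4 : HasDerivAt (fun r : ℝ => ∫ u in Ioi (0 : ℝ), radial (r * w) u) 0 1 := by
      refine (hasDerivAt_const (1 : ℝ) (∫ u in Ioi (0 : ℝ), radial w u)).congr_of_eventuallyEq ?_
      filter_upwards [lt_mem_nhds one_pos] with r hr
      exact integral_radial_real_mul w hr
    have h5 := h3.unique h4
    exact (mul_eq_zero.mp h5).resolve_right hw0

/-- Subtracting the constant limit does not change derivatives, so Cauchy's estimates on a disc of
radius x/8 convert the O(|z|^(1/2)) bound into bounds losing one power of x per derivative. -/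
lemma exists_remSum_le : ∃ K : ℝ, 0 < K ∧ ∀ x : ℝ, 0 < x →
    ‖remSum x - mellin (fun x : ℝ => heatRem x) 0‖ ≤ K * x ^ (1 / 2 : ℝ) ∧
    ‖deriv remSum x‖ ≤ K * x ^ (-(1 / 2) : ℝ) ∧
    ‖deriv (deriv remSum) x‖ ≤ K * x ^ (-(3 / 2) : ℝ) := by
  obtain ⟨K, hK, h⟩ := exists_remSum_sub_integral_le
  -- The second derivative decides: 2! · 2K x^(1/2) / (x/8)² = 256 K x^(-3/2).
  refine ⟨256 * K, by positivity, fun x hx => ?_⟩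
  set c := mellin (fun x : ℝ => heatRem x) 0
  have hxN := ofReal_mem_narrowSector hx
  have hle : ∀ z ∈ narrowSector, ‖remSum z - c‖ ≤ K * ‖z‖ ^ (1 / 2 : ℝ) := fun z hz => by
    have := h z hz
    rwa [integral_radial_eq hz] at this
  have hball : ∀ w ∈ Metric.closedBall (x : ℂ) (x / 8), w ∈ narrowSector ∧ ‖w‖ ≤ 2 * x := fun w hw => by
    have h2 : ‖w - x‖ ≤ x / 8 := by rwa [mem_closedBall_iff_norm] at hw
    have h3 : |w.re - x| ≤ ‖w - x‖ := by
      have := Complex.abs_re_le_norm (w - x)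
      rwa [Complex.sub_re, Complex.ofReal_re] at this
    have h4 : ‖w‖ ≤ ‖w - x‖ + ‖(x : ℂ)‖ := by simpa using norm_add_le (w - x) x
    rw [Complex.norm_real, Real.norm_of_nonneg hx.le] at h4
    have h5 := neg_le_of_abs_le h3
    refine ⟨?_, by linarith⟩
    show ‖w‖ < 2 * w.re
    linarith
  have hx0 : 0 < x ^ (1 / 2 : ℝ) := by positivity
  have hsph : ∀ w ∈ Metric.sphere (x : ℂ) (x / 8), ‖remSum w - c‖ ≤ 2 * K * x ^ (1 / 2 : ℝ) :=
    fun w hw => by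
    obtain ⟨hw1, hw2⟩ := hball w (Metric.sphere_subset_closedBall hw)
    refine (hle w hw1).trans ?_
    have h2 : ‖w‖ ^ (1 / 2 : ℝ) ≤ (4 * x) ^ (1 / 2 : ℝ) :=
      Real.rpow_le_rpow (norm_nonneg _) (by linarith) (by norm_num)
    have h3 : (4 : ℝ) ^ (1 / 2 : ℝ) = 2 := by
      rw [← Real.sqrt_eq_rpow, show (4 : ℝ) = 2 ^ 2 by norm_num, Real.sqrt_sq (by norm_num)]
    rw [Real.mul_rpow (by norm_num) hx.le, h3] at h2
    nlinarith
  have hdc : DiffContOnCl ℂ (fun z => remSum z - c) (Metric.ball (x : ℂ) (x / 8)) :=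
    ((differentiableOn_remSum.sub_const c).mono fun w hw => (hball w hw).1).diffContOnCl_ball
      Subset.rfl
  have e1 : x * x ^ (-(1 / 2) : ℝ) = x ^ (1 / 2 : ℝ) := by
    rw [mul_comm, ← Real.rpow_add_one hx.ne']
    norm_num
  have e2 : x * x ^ (-(3 / 2) : ℝ) = x ^ (-(1 / 2) : ℝ) := by
    rw [mul_comm, ← Real.rpow_add_one hx.ne']
    norm_num
  have hm1 : 0 < x ^ (-(1 / 2) : ℝ) := by positivity
  have hm2 : 0 < x ^ (-(3 / 2) : ℝ) := by positivity
  have ed : deriv (fun z => remSum z - c) = deriv remSum := by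
    ext z
    exact deriv_sub_const c
  refine ⟨?_, ?_, ?_⟩
  · refine (hle x hxN).trans ?_
    rw [Complex.norm_real, Real.norm_of_nonneg hx.le]
    nlinarith
  · have h1 := Complex.norm_deriv_le_of_forall_mem_sphere_norm_le (by positivity) hdc hsph
    rw [ed] at h1
    refine h1.trans ?_
    rw [div_le_iff₀ (by positivity), ← e1]
    nlinarith [mul_pos hx hm1]
  · have h1 := Complex.norm_iteratedDeriv_le_of_forall_mem_sphere_norm_le 2 (by positivity) hdc hsph
    rw [iteratedDeriv_succ, iteratedDeriv_one, ed] at h1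
    refine h1.trans ?_
    rw [div_le_iff₀ (by positivity), ← e1, ← e2]
    norm_num
    nlinarith [mul_pos hx (mul_pos hx hm2)]

/-! ### The generating function -/

lemma factor_eq (t : ℝ) (p : ℕ+ × ℕ+) :
    factor t p = (1 - Real.exp (-((weight p : ℝ) * (t / 2))))⁻¹ := by
  rw [factor]
  congr 3
  ring

lemma exp_neg_weight_lt_one {t : ℝ} (ht : 0 < t) (p : ℕ+ × ℕ+) :
    Real.exp (-((weight p : ℝ) * (t / 2))) < 1 := by
  have hw : (0 : ℝ) < weight p := by exact_mod_cast one_le_weight p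
  rw [Real.exp_lt_one_iff, neg_lt_zero]
  positivity

lemma factor_pos {t : ℝ} (ht : 0 < t) (p : ℕ+ × ℕ+) : 0 < factor t p := by
  rw [factor_eq, inv_pos]
  linarith [exp_neg_weight_lt_one ht p]

lemma hasSum_log_factor {t : ℝ} (ht : 0 < t) (p : ℕ+ × ℕ+) :
    HasSum (fun n : ℕ => ((n : ℝ) + 1)⁻¹ * Real.exp (-((weight p : ℝ) * (((n : ℝ) + 1) * (t / 2)))))
      (Real.log (factor t p)) := by
  have h1 := Real.hasSum_pow_div_log_of_abs_lt_one
    (x := Real.exp (-((weight p : ℝ) * (t / 2)))) (by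
      rw [abs_of_pos (Real.exp_pos _)]
      exact exp_neg_weight_lt_one ht p)
  rw [factor_eq, Real.log_inv]
  refine h1.congr_fun fun n => ?_
  rw [← Real.exp_nat_mul, div_eq_inv_mul]
  push_cast
  ring_nf

lemma summable_double {t : ℝ} (ht : 0 < t) : Summable fun q : (ℕ+ × ℕ+) × ℕ =>
    ((q.2 : ℝ) + 1)⁻¹ * Real.exp (-((weight q.1 : ℝ) * (((q.2 : ℝ) + 1) * (t / 2)))) := by
  have h1 := (summable_weight_rpow (σ := 1) (by norm_num)).mul_of_nonneg
    (summable_succ_rpow (c := 2) (by norm_num)) (fun p => by positivity) (fun n => by positivity)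
  refine Summable.of_nonneg_of_le (fun q => by positivity) (fun q => ?_) (h1.mul_left (t / 2)⁻¹)
  have hw : (0 : ℝ) < weight q.1 := by exact_mod_cast one_le_weight q.1
  have hn : (0 : ℝ) < (q.2 : ℝ) + 1 := by positivity
  calc _ ≤ ((q.2 : ℝ) + 1)⁻¹ * ((weight q.1 : ℝ) * (((q.2 : ℝ) + 1) * (t / 2)))⁻¹ := by
        gcongr
        exact exp_neg_le_inv (by positivity)
    _ = _ := by
        rw [Real.rpow_neg_one, Real.rpow_neg hn.le, Real.rpow_two]
        field_simp

lemma multipliable_factor {t : ℝ} (ht : 0 < t) : Multipliable (factor t) :=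
  Real.multipliable_of_summable_log (fun p => factor_pos ht p)
    ((summable_double ht).hasSum.prod_fiberwise fun p => hasSum_log_factor ht p).summable

/-- The logarithm of the product is a double series over pairs and exponents n. Its terms are
nonnegative and summable, so the sum over pairs may be taken first, which produces the heat trace at
n t/2. -/
lemma hasSum_h {t : ℝ} (ht : 0 < t) : HasSum (fun n : ℕ => (((n : ℝ) + 1 : ℝ) : ℂ)⁻¹ *
    heat ((((n : ℝ) + 1 : ℝ) : ℂ) * ((t / 2 : ℝ) : ℂ))) (h t : ℂ) := by
  have h1 := (summable_double ht).hasSum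
  have h2 := h1.prod_fiberwise fun p => hasSum_log_factor ht p
  have h3 : ∑' q : (ℕ+ × ℕ+) × ℕ, ((q.2 : ℝ) + 1)⁻¹ *
      Real.exp (-((weight q.1 : ℝ) * (((q.2 : ℝ) + 1) * (t / 2)))) = h t := by
    rw [h, ← Real.rexp_tsum_eq_tprod (fun p => factor_pos ht p) h2.summable, Real.log_exp,
      h2.tsum_eq]
  rw [h3] at h1
  have h4 := (Complex.hasSum_ofReal.mpr h1)
  have h5 := (Equiv.prodComm ℕ (ℕ+ × ℕ+)).hasSum_iff.mpr h4
  refine h5.prod_fiberwise fun n => ?_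
  have hn : (0 : ℝ) < (n : ℝ) + 1 := by positivity
  have h6 := ((summable_heat (z := (((n : ℝ) + 1 : ℝ) : ℂ) * ((t / 2 : ℝ) : ℂ)) (by
    rw [← Complex.ofReal_mul, Complex.ofReal_re]
    positivity)).hasSum).mul_left (((n : ℝ) + 1 : ℝ) : ℂ)⁻¹
  refine h6.congr_fun fun p => ?_
  simp only [Function.comp_apply, Equiv.prodComm_apply, Prod.swap]
  push_cast
  rfl

lemma ofReal_re_zeta (x : ℝ) : (((riemannZeta x).re : ℝ) : ℂ) = riemannZeta x := by
  refine Complex.conj_eq_iff_re.mp ?_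
  rw [← riemannZeta_conj, Complex.conj_ofReal]

lemma hasSum_zeta {σ : ℝ} (hσ : 1 < σ) :
    HasSum (fun n : ℕ => ((n : ℝ) + 1) ^ (-σ)) (riemannZeta σ).re := by
  have h1 := zeta_eq_tsum_one_div_nat_add_one_cpow (s := (σ : ℂ)) (by simpa using hσ)
  have h2 := (summable_succ_rpow hσ).hasSum
  have h3 : ∑' n : ℕ, ((n : ℝ) + 1) ^ (-σ) = (riemannZeta σ).re := by
    apply Complex.ofReal_injective
    rw [ofReal_re_zeta, h1, Complex.ofReal_tsum]
    refine tsum_congr fun n => ?_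
    rw [Complex.ofReal_cpow (by positivity), one_div, Complex.ofReal_neg, Complex.cpow_neg]
    push_cast
    rfl
  rwa [h3] at h2

lemma hasSum_log_one_sub_exp {x : ℝ} (hx : 0 < x) :
    HasSum (fun n : ℕ => ((n : ℝ) + 1)⁻¹ * Real.exp (-(((n : ℝ) + 1) * x)))
      (-Real.log (1 - Real.exp (-x))) := by
  have h1 := Real.hasSum_pow_div_log_of_abs_lt_one (x := Real.exp (-x)) (by
      rw [abs_of_pos (Real.exp_pos _), Real.exp_lt_one_iff]
      linarith)
  refine h1.congr_fun fun n => ?_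
  rw [← Real.exp_nat_mul, div_eq_inv_mul]
  push_cast
  ring_nf

/-! ### The coefficients and the decomposition of h -/

/-- The leading coefficient of `h`. -/
noncomputable def muOne : ℝ :=
  2 ^ (2 / 3 : ℝ) / 3 * Real.Gamma (1 / 3) ^ 2 * (riemannZeta (5 / 3)).re

/-- The second coefficient of `h`. -/
noncomputable def muTwo : ℝ :=
  √(2 * Real.pi) * (riemannZeta (1 / 2)).re * (riemannZeta (3 / 2)).re

lemma ofReal_re_zeta_div (a b : ℕ) :
    (((riemannZeta ((a : ℂ) / b)).re : ℝ) : ℂ) = riemannZeta ((a : ℂ) / b) := by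
  have := ofReal_re_zeta ((a : ℝ) / b)
  push_cast at this
  exact this

lemma Gamma_one_third : Complex.Gamma (1 / 3) = (Real.Gamma (1 / 3) : ℂ) := by
  rw [← Complex.Gamma_ofReal]
  push_cast
  rfl

lemma ofReal_muOne : (muOne : ℂ) =
    2 ^ (2 / 3 : ℂ) / 3 * Complex.Gamma (1 / 3) ^ 2 * riemannZeta (5 / 3) := by
  have h1 : (2 : ℂ) ^ (2 / 3 : ℂ) = ((2 ^ (2 / 3 : ℝ) : ℝ) : ℂ) := by
    rw [Complex.ofReal_cpow zero_le_two]
    push_cast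
    rfl
  have h2 := ofReal_re_zeta_div 5 3
  norm_num only [Nat.cast_ofNat] at h2
  rw [muOne, Gamma_one_third, h1, ← h2]
  push_cast
  rfl

lemma ofReal_muTwo : (muTwo : ℂ) =
    (√(2 * Real.pi) : ℂ) * riemannZeta (1 / 2) * riemannZeta (3 / 2) := by
  have h2 := ofReal_re_zeta_div 3 2
  have h3 := ofReal_re_zeta_div 1 2
  norm_num only [Nat.cast_ofNat, Nat.cast_one] at h2 h3
  rw [muTwo]
  push_cast
  rw [h2, h3]

lemma hasSum_remSum {x : ℝ} (hx : 0 < x) :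
    HasSum (fun n : ℕ => radial x ((n : ℝ) + 1)) (remSum x) :=
  (summable_radial (inSector_ofReal hx)).hasSum

/-- `h` in terms of the sum of the remainders. -/
lemma ofReal_h {t : ℝ} (ht : 0 < t) : (h t : ℂ) = ((muOne * t ^ (-(2 / 3) : ℝ) +
    muTwo * t ^ (-(1 / 2) : ℝ) - 1 / 3 * Real.log (1 - Real.exp (-(t / 2))) : ℝ) : ℂ) +
    remSum ((t / 2 : ℝ) : ℂ) := by
  have hx : 0 < t / 2 := by positivity
  have hh := hasSum_h ht
  obtain ⟨x, hxt⟩ : ∃ x, x = t / 2 := ⟨_, rfl⟩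
  rw [← hxt] at hx hh ⊢
  have hR := hasSum_remSum hx
  have h1 := (Complex.hasSum_ofReal.mpr (hasSum_zeta (σ := 5 / 3) (by norm_num))).mul_left
    (heatA * (x : ℂ) ^ (-(2 / 3) : ℂ))
  have h2 := (Complex.hasSum_ofReal.mpr (hasSum_zeta (σ := 3 / 2) (by norm_num))).mul_left
    (heatB * (x : ℂ) ^ (-(1 / 2) : ℂ))
  have h3 := (Complex.hasSum_ofReal.mpr (hasSum_log_one_sub_exp hx)).mul_left (1 / 3 : ℂ)
  have h4 := ((hR.add h1).add h2).add h3
  have h5 := hh.unique (h4.congr_fun fun n => ?_)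
  · rw [h5]
    have hA : heatA * (x : ℂ) ^ (-(2 / 3) : ℂ) * (((riemannZeta ((5 / 3 : ℝ) : ℂ)).re : ℝ) : ℂ) =
        ((muOne * t ^ (-(2 / 3) : ℝ) : ℝ) : ℂ) := by
      have e1 : (-(2 / 3) : ℂ) = ((-(2 / 3) : ℝ) : ℂ) := by push_cast; rfl
      have e2 : ((5 / 3 : ℝ) : ℂ) = 5 / 3 := by push_cast; rfl
      have e3 : x ^ (-(2 / 3) : ℝ) = 2 ^ (2 / 3 : ℝ) * t ^ (-(2 / 3) : ℝ) := by
        rw [hxt, Real.div_rpow ht.le zero_le_two, Real.rpow_neg zero_le_two, div_inv_eq_mul, mul_comm]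
      rw [heatA, Gamma_one_third, e1, e2, ← Complex.ofReal_cpow hx.le, e3, muOne]
      push_cast
      ring
    have hB : heatB * (x : ℂ) ^ (-(1 / 2) : ℂ) * (((riemannZeta ((3 / 2 : ℝ) : ℂ)).re : ℝ) : ℂ) =
        ((muTwo * t ^ (-(1 / 2) : ℝ) : ℝ) : ℂ) := by
      have e1 : (-(1 / 2) : ℂ) = ((-(1 / 2) : ℝ) : ℂ) := by push_cast; rfl
      have e2 : ((3 / 2 : ℝ) : ℂ) = 3 / 2 := by push_cast; rfl
      have e3 : x ^ (-(1 / 2) : ℝ) = √2 * t ^ (-(1 / 2) : ℝ) := by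
        rw [hxt, Real.div_rpow ht.le zero_le_two, Real.rpow_neg zero_le_two, div_inv_eq_mul, mul_comm,
          Real.sqrt_eq_rpow]
      have e4 : Complex.Gamma (1 / 2) = ((√Real.pi : ℝ) : ℂ) := by
        rw [← Real.Gamma_one_half_eq, ← Complex.Gamma_ofReal]
        push_cast
        rfl
      have e5 := ofReal_re_zeta_div 1 2
      norm_num only [Nat.cast_ofNat, Nat.cast_one] at e5
      rw [heatB, e4, e1, e2, ← Complex.ofReal_cpow hx.le, e3, muTwo,
        Real.sqrt_mul zero_le_two]
      push_cast
      rw [e5]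
      ring
    rw [hA, hB]
    push_cast
    ring
  · have hn : (0 : ℝ) < (n : ℝ) + 1 := by positivity
    have hn' : (((n : ℝ) + 1 : ℝ) : ℂ) ≠ 0 := by exact_mod_cast hn.ne'
    have hxc : (x : ℂ) ≠ 0 := by exact_mod_cast hx.ne'
    have e1 : ((((n : ℝ) + 1) ^ (-(5 / 3) : ℝ) : ℝ) : ℂ) =
        (((n : ℝ) + 1 : ℝ) : ℂ)⁻¹ * (((n : ℝ) + 1 : ℝ) : ℂ) ^ (-(2 / 3) : ℂ) := by
      rw [Complex.ofReal_cpow hn.le, ← Complex.cpow_neg_one, ← Complex.cpow_add _ _ hn']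
      push_cast
      norm_num
    have e2 : ((((n : ℝ) + 1) ^ (-(3 / 2) : ℝ) : ℝ) : ℂ) =
        (((n : ℝ) + 1 : ℝ) : ℂ)⁻¹ * (((n : ℝ) + 1 : ℝ) : ℂ) ^ (-(1 / 2) : ℂ) := by
      rw [Complex.ofReal_cpow hn.le, ← Complex.cpow_neg_one, ← Complex.cpow_add _ _ hn']
      push_cast
      norm_num
    rw [e1, e2, radial, heatRem, ofReal_mul_cpow hn hxc, ofReal_mul_cpow hn hxc]
    push_cast
    ring

lemma h_eq {t : ℝ} (ht : 0 < t) : h t = muOne * t ^ (-(2 / 3) : ℝ) +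
    muTwo * t ^ (-(1 / 2) : ℝ) - 1 / 3 * Real.log (1 - Real.exp (-(t / 2))) +
    (remSum ((t / 2 : ℝ) : ℂ)).re := by
  have := congrArg Complex.re (ofReal_h ht)
  rwa [Complex.add_re, Complex.ofReal_re, Complex.ofReal_re] at this

lemma remSum_im {x : ℝ} (hx : 0 < x) : (remSum x).im = 0 := by
  have := congrArg Complex.im (ofReal_h (t := 2 * x) (by positivity))
  rw [Complex.add_im, Complex.ofReal_im, Complex.ofReal_im, zero_add,
    mul_div_cancel_left₀ x two_ne_zero] at this
  exact this.symm

/-- `remSum` is real on the positive axis because h and the explicit terms are; its limit at 0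
inherits this. Hence ω'(0) is real. -/
lemma mellin_heatRem_im : (mellin (fun x : ℝ => heatRem x) 0).im = 0 := by
  obtain ⟨K, hK, hb⟩ := exists_remSum_le
  have ht : Tendsto (fun x : ℝ => K * x ^ (1 / 2 : ℝ)) (𝓝[>] 0) (𝓝 0) := by
    have h1 : ContinuousAt (fun x : ℝ => K * x ^ (1 / 2 : ℝ)) 0 :=
      (Real.continuousAt_rpow_const 0 (1 / 2) (Or.inr (by norm_num))).const_mul K
    have h2 := h1.tendsto
    simp only [Real.zero_rpow (by norm_num : (1 / 2 : ℝ) ≠ 0), mul_zero] at h2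
    exact h2.mono_left nhdsWithin_le_nhds
  have h3 : |(mellin (fun x : ℝ => heatRem x) 0).im| ≤ 0 := by
    refine ge_of_tendsto ht ?_
    filter_upwards [self_mem_nhdsWithin] with x hx
    have h4 := (Complex.abs_im_le_norm _).trans (hb x hx).1
    rwa [Complex.sub_im, remSum_im hx, zero_sub, abs_neg] at h4
  exact abs_nonpos_iff.mp h3

/-! ### Derivatives of `h` -/

lemma exp_half_sub_one_pos {t : ℝ} (ht : 0 < t) : 0 < Real.exp (t / 2) - 1 := by
  linarith [Real.add_one_le_exp (t / 2)]

lemma one_sub_exp_neg_pos {x : ℝ} (hx : 0 < x) : 0 < 1 - Real.exp (-x) := by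
  have : Real.exp (-x) < 1 := Real.exp_lt_one_iff.mpr (by linarith)
  linarith

lemma hasDerivAt_half (t : ℝ) : HasDerivAt (fun t : ℝ => t / 2) (1 / 2) t :=
  (hasDerivAt_id t).div_const 2

lemma hasDerivAt_log_one_sub_exp {t : ℝ} (ht : 0 < t) :
    HasDerivAt (fun t : ℝ => Real.log (1 - Real.exp (-(t / 2))))
      (1 / 2 * (Real.exp (t / 2) - 1)⁻¹) t := by
  have h0 := one_sub_exp_neg_pos (half_pos ht)
  refine (((hasDerivAt_half t).fun_neg.exp.const_sub 1).log h0.ne').congr_deriv ?_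
  have h1 := exp_half_sub_one_pos ht
  have h2 : Real.exp (-(t / 2)) * Real.exp (t / 2) = 1 := by
    rw [← Real.exp_add]
    simp
  have h3 : (Real.exp (t / 2) - 1)⁻¹ * (1 - Real.exp (-(t / 2))) = Real.exp (-(t / 2)) := by
    rw [inv_mul_eq_iff_eq_mul₀ h1.ne']
    linear_combination -h2
  rw [div_eq_iff h0.ne']
  linear_combination -(1 / 2) * h3

lemma hasDerivAt_inv_exp_sub_one {t : ℝ} (ht : 0 < t) :
    HasDerivAt (fun t : ℝ => 1 / 2 * (Real.exp (t / 2) - 1)⁻¹)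
      (-(1 / 4) * (Real.exp (t / 2) / (Real.exp (t / 2) - 1) ^ 2)) t := by
  have h1 := exp_half_sub_one_pos ht
  refine ((((hasDerivAt_half t).exp.sub_const 1).fun_inv h1.ne').const_mul (1 / 2)).congr_deriv ?_
  ring

lemma hasDerivAt_re_comp_half {f : ℂ → ℂ} (hf : DifferentiableOn ℂ f narrowSector) {t : ℝ}
    (ht : 0 < t) : HasDerivAt (fun t : ℝ => (f ((t / 2 : ℝ) : ℂ)).re)
      (1 / 2 * (deriv f ((t / 2 : ℝ) : ℂ)).re) t := by
  have e : ∀ t : ℝ, ((t / 2 : ℝ) : ℂ) = (t : ℂ) / 2 := fun t => by push_cast; rfl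
  have h1 : HasDerivAt f (deriv f ((t : ℂ) / 2)) ((t : ℂ) / 2) := by
    rw [← e]
    exact (hf.differentiableAt (isOpen_narrowSector.mem_nhds
      (ofReal_mem_narrowSector (half_pos ht)))).hasDerivAt
  have h2 := HasDerivAt.real_of_complex
    (h1.comp (h := fun z : ℂ => z / 2) (t : ℂ) ((hasDerivAt_id (t : ℂ)).div_const 2))
  simp only [e]
  refine h2.congr_deriv ?_
  rw [mul_one_div, mul_comm]
  simp [div_eq_mul_inv]

lemma hasDerivAt_h {t : ℝ} (ht : 0 < t) : HasDerivAt h (-(2 / 3) * muOne * t ^ (-(5 / 3) : ℝ) -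
    1 / 2 * muTwo * t ^ (-(3 / 2) : ℝ) - 1 / 3 * (1 / 2 * (Real.exp (t / 2) - 1)⁻¹) +
    1 / 2 * (deriv remSum ((t / 2 : ℝ) : ℂ)).re) t := by
  have h1 := (Real.hasDerivAt_rpow_const (x := t) (p := -(2 / 3)) (Or.inl ht.ne')).const_mul muOne
  have h2 := (Real.hasDerivAt_rpow_const (x := t) (p := -(1 / 2)) (Or.inl ht.ne')).const_mul muTwo
  have h3 := (hasDerivAt_log_one_sub_exp ht).const_mul (1 / 3)
  have h4 := hasDerivAt_re_comp_half differentiableOn_remSum ht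
  refine ((((h1.fun_add h2).fun_sub h3).fun_add h4).congr_of_eventuallyEq ?_).congr_deriv ?_
  · filter_upwards [lt_mem_nhds ht] with u hu
    exact h_eq hu
  · rw [show (-(2 / 3) - 1 : ℝ) = -(5 / 3) by norm_num, show (-(1 / 2) - 1 : ℝ) = -(3 / 2) by norm_num]
    ring

lemma hasDerivAt_deriv_h {t : ℝ} (ht : 0 < t) : HasDerivAt (deriv h)
    (10 / 9 * muOne * t ^ (-(8 / 3) : ℝ) + 3 / 4 * muTwo * t ^ (-(5 / 2) : ℝ) +
    1 / 12 * (Real.exp (t / 2) / (Real.exp (t / 2) - 1) ^ 2) +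
    1 / 4 * (deriv (deriv remSum) ((t / 2 : ℝ) : ℂ)).re) t := by
  have h1 := (Real.hasDerivAt_rpow_const (x := t) (p := -(5 / 3)) (Or.inl ht.ne')).const_mul
    (-(2 / 3) * muOne)
  have h2 := (Real.hasDerivAt_rpow_const (x := t) (p := -(3 / 2)) (Or.inl ht.ne')).const_mul
    (1 / 2 * muTwo)
  have h3 := (hasDerivAt_inv_exp_sub_one ht).const_mul (1 / 3)
  have h4 := (hasDerivAt_re_comp_half (differentiableOn_remSum.deriv isOpen_narrowSector)
    ht).const_mul (1 / 2)
  refine ((((h1.fun_sub h2).fun_sub h3).fun_add h4).congr_of_eventuallyEq ?_).congr_deriv ?_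
  · filter_upwards [lt_mem_nhds ht] with u hu
    exact (hasDerivAt_h hu).deriv
  · rw [show (-(5 / 3) - 1 : ℝ) = -(8 / 3) by norm_num, show (-(3 / 2) - 1 : ℝ) = -(5 / 2) by norm_num]
    ring

lemma contDiffOn_h : ContDiffOn ℝ 2 h (Ioi 0) := by
  have hp : ∀ a : ℝ, ContDiffOn ℝ 2 (fun t : ℝ => t ^ a) (Ioi 0) := fun a =>
    contDiffOn_id.rpow_const_of_ne fun t ht => ne_of_gt ht
  have hl : ContDiffOn ℝ 2 (fun t : ℝ => Real.log (1 - Real.exp (-(t / 2)))) (Ioi 0) :=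
    ContDiffOn.log (ContDiff.contDiffOn (by fun_prop)) fun t ht =>
      (one_sub_exp_neg_pos (half_pos ht)).ne'
  have hr : ContDiffOn ℝ 2 (fun t : ℝ => (remSum ((t / 2 : ℝ) : ℂ)).re) (Ioi 0) := by
    have h1 : ContDiffOn ℝ 2 remSum narrowSector :=
      (differentiableOn_remSum.contDiffOn isOpen_narrowSector).restrict_scalars ℝ
    have h2 : ContDiff ℝ 2 (fun t : ℝ => ((t / 2 : ℝ) : ℂ)) :=
      Complex.ofRealCLM.contDiff.comp (contDiff_id.div_const 2)
    exact Complex.reCLM.contDiff.comp_contDiffOn (h1.comp h2.contDiffOn fun t ht =>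
      ofReal_mem_narrowSector (half_pos ht))
  exact ((((hp _).const_smul muOne).add ((hp _).const_smul muTwo)).sub
    (hl.const_smul (1 / 3 : ℝ))|>.add hr).congr fun t ht => h_eq ht

/-! ### Elementary estimates for the logarithmic term -/

lemma abs_log_one_sub_exp_sub_le {x : ℝ} (hx : 0 < x) (hx1 : x ≤ 1 / 2) :
    |Real.log (1 - Real.exp (-x)) - Real.log x| ≤ 2 * x := by
  have h1 := Real.abs_exp_sub_one_sub_id_le (x := -x) (by rw [abs_neg, abs_of_pos hx]; linarith)
  have h2 := abs_le.mp h1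
  have hw := one_sub_exp_neg_pos hx
  set w := 1 - Real.exp (-x) with hwd
  have h3 : w ≤ x := by linarith [Real.add_one_le_exp (-x)]
  have h4 : x - x ^ 2 ≤ w := by linarith [h2.2]
  rw [← Real.log_div hw.ne' hx.ne']
  have h5 : Real.log (w / x) ≤ 0 := Real.log_nonpos (by positivity) ((div_le_one hx).mpr h3)
  have h6 := Real.one_sub_inv_le_log_of_pos (div_pos hw hx)
  rw [inv_div] at h6
  rw [abs_of_nonpos h5]
  have h7 : x / w ≤ 1 + 2 * x := by
    rw [div_le_iff₀ hw]
    nlinarith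
  linarith

lemma exp_sub_one_mem {x : ℝ} (hx : 0 < x) (hx1 : x ≤ 1 / 2) :
    x ≤ Real.exp x - 1 ∧ Real.exp x - 1 ≤ x + x ^ 2 := by
  have h1 := Real.abs_exp_sub_one_sub_id_le (x := x) (by rw [abs_of_pos hx]; linarith)
  have h2 := abs_le.mp h1
  exact ⟨by linarith [Real.add_one_le_exp x], by linarith [h2.2]⟩

lemma abs_inv_exp_sub_one_sub_le {x : ℝ} (hx : 0 < x) (hx1 : x ≤ 1 / 2) :
    |(Real.exp x - 1)⁻¹ - x⁻¹| ≤ 1 := by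
  obtain ⟨h1, h2⟩ := exp_sub_one_mem hx hx1
  set y := Real.exp x - 1
  have hy : 0 < y := by linarith
  rw [abs_sub_comm, abs_of_nonneg (sub_nonneg.mpr (inv_anti₀ hx h1)), inv_sub_inv hx.ne' hy.ne',
    div_le_one (by positivity)]
  nlinarith

lemma abs_exp_div_sq_sub_le {x : ℝ} (hx : 0 < x) (hx1 : x ≤ 1 / 2) :
    |Real.exp x / (Real.exp x - 1) ^ 2 - (x ^ 2)⁻¹| ≤ 4 * x⁻¹ := by
  obtain ⟨h1, h2⟩ := exp_sub_one_mem hx hx1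
  obtain ⟨y, hy⟩ : ∃ y, y = Real.exp x - 1 := ⟨_, rfl⟩
  have e : Real.exp x = 1 + y := by rw [hy]; ring
  rw [← hy] at h1 h2 ⊢
  have hy0 : 0 < y := by linarith
  rw [e, div_sub' (by positivity), abs_div, abs_of_pos (by positivity : 0 < y ^ 2),
    div_le_iff₀ (by positivity)]
  have h3 : (1 + y) - y ^ 2 * (x ^ 2)⁻¹ = (x ^ 2 * (1 + y) - y ^ 2) * (x ^ 2)⁻¹ := by
    field_simp
  have h4 : |x ^ 2 * (1 + y) - y ^ 2| ≤ 4 * x ^ 3 := by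
    have hx3 : 0 < x ^ 3 := by positivity
    have hx2 : 0 < x ^ 2 := by positivity
    rw [abs_le]
    constructor
    · nlinarith
    · nlinarith
  rw [h3, abs_mul, abs_of_pos (by positivity : 0 < (x ^ 2)⁻¹)]
  calc |x ^ 2 * (1 + y) - y ^ 2| * (x ^ 2)⁻¹ ≤ 4 * x ^ 3 * (x ^ 2)⁻¹ := by gcongr
    _ = 4 * x⁻¹ * x ^ 2 := by field_simp
    _ ≤ _ := by gcongr

lemma half_rpow_neg_le {t p : ℝ} (ht : 0 < t) (hp : p ≤ 2) :
    (t / 2) ^ (-p) ≤ 4 * t ^ (-p) := by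
  rw [Real.div_rpow ht.le zero_le_two, Real.rpow_neg zero_le_two, div_inv_eq_mul, mul_comm]
  have : (2 : ℝ) ^ p ≤ 4 := by
    calc (2 : ℝ) ^ p ≤ 2 ^ (2 : ℝ) := Real.rpow_le_rpow_of_exponent_le one_le_two hp
      _ = 4 := by norm_num
  gcongr

end SU3

/-! ### The three expansions -/

theorem mainTheorem8 :
    -- the objects of the theorem are well defined: `ω` has a meromorphic continuation,
    -- the product in `h` converges, and `h` is twice differentiable on `(0, ∞)`
    SU3.IsContinuation SU3.omega ∧
    (∀ t : ℝ, 0 < t → Multipliable (SU3.factor t)) ∧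
    ContDiffOn ℝ 2 SU3.h (Ioi 0) ∧
    -- `c = ω'(0)`; the three constants are real
    ∃ μ₁ μ₂ c : ℝ,
      (μ₁ : ℂ) = 2 ^ (2 / 3 : ℂ) / 3 * Complex.Gamma (1 / 3) ^ 2 * riemannZeta (5 / 3) ∧
      (μ₂ : ℂ) = (Real.sqrt (2 * Real.pi) : ℂ) * riemannZeta (1 / 2) * riemannZeta (3 / 2) ∧
      HasDerivAt SU3.omega (c : ℂ) 0 ∧
      (fun t : ℝ => SU3.h t - (μ₁ * t ^ (-(2 / 3) : ℝ) + μ₂ * t ^ (-(1 / 2) : ℝ)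
          - 1 / 3 * Real.log t + c + 1 / 3 * Real.log 2))
        =O[𝓝[>] 0] (fun t : ℝ => t ^ (1 / 2 : ℝ)) ∧
      (fun t : ℝ => deriv SU3.h t - (-(2 / 3) * μ₁ * t ^ (-(5 / 3) : ℝ)
          - 1 / 2 * μ₂ * t ^ (-(3 / 2) : ℝ) - 1 / 3 * t⁻¹))
        =O[𝓝[>] 0] (fun t : ℝ => t ^ (-(1 / 2) : ℝ)) ∧
      (fun t : ℝ => deriv (deriv SU3.h) t - (10 / 9 * μ₁ * t ^ (-(8 / 3) : ℝ)
          + 3 / 4 * μ₂ * t ^ (-(5 / 2) : ℝ) + 1 / 3 * (t ^ 2)⁻¹))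
        =O[𝓝[>] 0] (fun t : ℝ => t ^ (-(3 / 2) : ℝ)) := by
  obtain ⟨K, hK, hb⟩ := SU3.exists_remSum_le
  set c := (mellin (fun x : ℝ => SU3.heatRem x) 0).re with hc
  have hcc : mellin (fun x : ℝ => SU3.heatRem x) 0 = (c : ℂ) :=
    Complex.ext (by simp [hc]) (by simp [SU3.mellin_heatRem_im])
  rw [hcc] at hb
  refine ⟨SU3.isContinuation_omega, fun t ht => SU3.multipliable_factor ht, SU3.contDiffOn_h,
    SU3.muOne, SU3.muTwo, c, SU3.ofReal_muOne, SU3.ofReal_muTwo, hcc ▸ SU3.hasDerivAt_omega_zero,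
    ?_, ?_, ?_⟩
  · refine IsBigO.of_bound (1 + K) ?_
    filter_upwards [Ioc_mem_nhdsGT (zero_lt_one : (0 : ℝ) < 1)] with t ht
    have ht0 : 0 < t := ht.1
    have ht1 : t ≤ 1 := ht.2
    have h1 := (Complex.abs_re_le_norm _).trans (hb (t / 2) (half_pos ht0)).1
    have h2 := SU3.abs_log_one_sub_exp_sub_le (half_pos ht0) (by linarith)
    -- The explicit term behaves like log(t/2), and this splitting is where the constant (1/3) log 2
    -- arises.
    rw [Real.log_div ht0.ne' two_ne_zero] at h2
    rw [Complex.sub_re, Complex.ofReal_re] at h1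
    have h3 : (t / 2) ^ (1 / 2 : ℝ) ≤ t ^ (1 / 2 : ℝ) :=
      Real.rpow_le_rpow (by positivity) (by linarith) (by norm_num)
    have h4 : t ≤ t ^ (1 / 2 : ℝ) := by
      nth_rewrite 1 [← Real.rpow_one t]
      exact Real.rpow_le_rpow_of_exponent_ge ht0 ht1 (by norm_num)
    have h5 := h1.trans (mul_le_mul_of_nonneg_left h3 hK.le)
    rw [Real.norm_eq_abs, Real.norm_of_nonneg (by positivity), SU3.h_eq ht0]
    rw [abs_le] at h2 h5 ⊢
    constructor <;> linarith
  · refine IsBigO.of_bound (1 + 4 * K) ?_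
    filter_upwards [Ioc_mem_nhdsGT (zero_lt_one : (0 : ℝ) < 1)] with t ht
    have ht0 : 0 < t := ht.1
    have ht1 : t ≤ 1 := ht.2
    have h1 := (Complex.abs_re_le_norm _).trans (hb (t / 2) (half_pos ht0)).2.1
    have h2 := SU3.abs_inv_exp_sub_one_sub_le (half_pos ht0) (by linarith)
    rw [inv_div] at h2
    have h3 := SU3.half_rpow_neg_le (p := 1 / 2) ht0 (by norm_num)
    have h4 : 1 ≤ t ^ (-(1 / 2) : ℝ) :=
      Real.one_le_rpow_of_pos_of_le_one_of_nonpos ht0 ht1 (by norm_num)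
    have h5 := h1.trans (mul_le_mul_of_nonneg_left h3 hK.le)
    have h6 : 2 / t = 2 * t⁻¹ := rfl
    have h7 : 0 < K * t ^ (-(1 / 2) : ℝ) := by positivity
    rw [Real.norm_eq_abs, Real.norm_of_nonneg (by positivity), (SU3.hasDerivAt_h ht0).deriv]
    rw [h6] at h2
    rw [abs_le] at h2 h5 ⊢
    constructor <;> linarith
  · refine IsBigO.of_bound (1 + 4 * K) ?_
    filter_upwards [Ioc_mem_nhdsGT (zero_lt_one : (0 : ℝ) < 1)] with t ht
    have ht0 : 0 < t := ht.1
    have ht1 : t ≤ 1 := ht.2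
    have h1 := (Complex.abs_re_le_norm _).trans (hb (t / 2) (half_pos ht0)).2.2
    have h2 := SU3.abs_exp_div_sq_sub_le (half_pos ht0) (by linarith)
    have h3 := SU3.half_rpow_neg_le (p := 3 / 2) ht0 (by norm_num)
    have h4 : t⁻¹ ≤ t ^ (-(3 / 2) : ℝ) := by
      rw [← Real.rpow_neg_one]
      exact Real.rpow_le_rpow_of_exponent_ge ht0 ht1 (by norm_num)
    have h5 := h1.trans (mul_le_mul_of_nonneg_left h3 hK.le)
    have h6 : ((t / 2) ^ 2)⁻¹ = 4 * (t ^ 2)⁻¹ := by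
      field_simp
      norm_num
    have h7 : 0 < K * t ^ (-(3 / 2) : ℝ) := by positivity
    have h8 : (t / 2)⁻¹ = 2 * t⁻¹ := by
      rw [inv_div]
      rfl
    have h9 : 0 < t⁻¹ := by positivity
    rw [Real.norm_eq_abs, Real.norm_of_nonneg (by positivity), (SU3.hasDerivAt_deriv_h ht0).deriv]
    rw [h6, h8] at h2
    rw [abs_le] at h2 h5 ⊢
    constructor <;> linarith
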